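/- Fix $n\ge 0$. Let $B^n$ be the set of crossingless matchings of $2n$ points on a horizontal line (drawn below the line), $W(b)$ the reflection of $b\in B^n$ across the line, and $W(b)a$ the union of circles obtained by gluing $W(b)$ on top of $a$; $|W(b)a|$ is its number of circles. For a finite set $S$ of circles let $OF(S)=\Lambda^*(\mathbb Z^{S})$. Put $$OH^n=\bigoplus_{a,b\in B^n} b(OH^n)a,\qquad b(OH^n)a=OF(W(b)a),$$ where $\Lambda^p\subset b(OH^n)a$ has quantum degree $2p-|W(b)a|+n$ and arc degree the arrow $W(b)a:a\to b$. A choice $C\in\mathcal C^n$ consists, for every triple $c,b,a\in B^n$, of a chronological cobordism $C_{cba}:W(c)bW(b)a\to W(c)a$, that is, an order in which the arcs of $b$ are contracted with their mirror images in $W(b)$, no arc before one surrounding it, and an arrow at each saddle (relevant for splits only). The odd functor $OF$ sends a merge of two circles to the map of exterior algebras identifying them, and a split of a circle into $b_1,b_2$ with arrow from $b_1$ to $b_2$ to the map that replaces the circle by $b_1$ (or $b_2$) and multiplies from the left by $b_1-b_2$. The nonassociative algebra $OH^n_C$ is $OH^n$ with the product $xy=OF(C_{cba})(x\wedge y)$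 for $x\in c(OH^n)b$, $y\in b(OH^n)a$, and with $d(OH^n)c\cdot b(OH^n)a=0$ for $c\neq b$. Let $\mathcal G^n\times\mathcal Z$ be the groupoid whose morphisms are the pairs $(W(b)a,k)$ with $k\in\mathbb Z$, composed by $(W(c)b,k)\circ(W(b)a,l)=(W(c)a,k+l)$, and let $N_2$ be the set of its composable pairs. For a map $\tau:N_2\to\mathbb Z/4\mathbb Z$ let $(OH^n_C\otimes_{\mathbb Z}\mathbb Z[i])_\tau$ be the $\mathbb Z[i]$-module $OH^n\otimes_{\mathbb Z}\mathbb Z[i]$ with the $\mathbb Z[i]$-bilinear product $$x*_\tau y=i^{\tau(|x|,|y|)}\,xy$$ for $x,y$ homogeneous of composable bidegrees $|x|,|y|$ (arc degree and quantum degree), and $x*_\tau y=0$ for homogeneous $x,y$ whose bidegrees are not composable. Call $\tau$ an associating twist for $C$ if this algebra is associative. **Proposition and Corollary.** For all $C,C'\in\mathcal C^n$, every associating twist $\tau_C$ for $C$ and every associating twist $\tau_{C'}$ for $C'$, there is an isomorphism of $\mathbb Z[i]$-algebras, preserving the arc degree and the quantum degree, $$(OH^n_C\otimes_{\mathbb Z}\mathbb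 Z[i])_{\tau_C}\;\simeq\;(OH^n_{C'}\otimes_{\mathbb Z}\mathbb Z[i])_{\tau_{C'}}.$$ In other words, the associative twisted odd arc algebra $OH^n_\tau$ is unique up to isomorphism: it depends neither on $C$ nor on the twist. -/

import Mathlib

open scoped TensorProduct

noncomputable section

namespace OddArc

/-- A crossingless matching of `2n` points on a horizontal line, given by its fixed-point-free
involution `i ↦ partner of i`.  An arc that starts strictly under another arc also ends there. -/
structure Matching (n : ℕ) where
  partner : Fin (2 * n) → Fin (2 * n)
  involutive : ∀ i, partner (partner i) = i
  ne_self : ∀ i, partner i ≠ i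
  noncrossing : ∀ i j, i < j → j < partner i → i < partner j ∧ partner j < partner i

variable {n : ℕ}

theorem Matching.partner_injective :
    Function.Injective (Matching.partner : Matching n → Fin (2 * n) → Fin (2 * n)) := by
  rintro ⟨f, _, _, _⟩ ⟨g, _, _, _⟩ h
  cases h
  rfl

instance : Finite (Matching n) := Finite.of_injective _ Matching.partner_injective

instance : Fintype (Matching n) := Fintype.ofFinite _

instance : DecidableEq (Matching n) := Classical.decEq _

/-- The arcs of `b`, each named by its left end point. -/
def Matching.Arc (b : Matching n) : Type := {i : Fin (2 * n) // i < b.partner i}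

/-- The two end points of an arc. -/
def Matching.Arc.left {b : Matching n} (α : b.Arc) : Fin (2 * n) := α.1

def Matching.Arc.right {b : Matching n} (α : b.Arc) : Fin (2 * n) := b.partner α.1

/-- `α` surrounds `β`. -/
def Matching.Arc.Surrounds {b : Matching n} (α β : b.Arc) : Prop :=
  α.left < β.left ∧ β.right < α.right

/-! ### Circle diagrams and the odd functor on objects -/

/-- The circles of the diagram `W(b)a`: the `2n` points modulo the arcs of `a` and of `W(b)`. -/
def Circle (b a : Matching n) : Type :=
  Quot fun i j : Fin (2 * n) => j = b.partner i ∨ j = a.partner i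

instance (b a : Matching n) : Finite (Circle b a) := Quot.finite _

/-- The number `|W(b)a|` of circles. -/
def numCircles (b a : Matching n) : ℕ := Nat.card (Circle b a)

/-- The exterior algebra of the free abelian group on a set `S` of circles. -/
abbrev OF (S : Type) : Type := ExteriorAlgebra ℤ (S →₀ ℤ)

/-- The map of exterior algebras that renames circles along `f`. -/
def OF.rename {S T : Type} (f : S → T) : OF S →ₐ[ℤ] OF T :=
  ExteriorAlgebra.map (Finsupp.lmapDomain ℤ ℤ f)

/-- A circle as an element of degree one of the exterior algebra. -/
def OF.gen {S : Type} (s : S) : OF S := ExteriorAlgebra.ι ℤ (Finsupp.single s 1)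

/-! ### Chronological contraction cobordisms -/

/-- The strands of the diagram obtained from `W(c)bW(b)a` by contracting some symmetric arcs of
`bW(b)`.  The point `(true, i)` lies on the upper line (between `W(c)` and `b`) and `(false, i)` on
the lower line (between `W(b)` and `a`); `K` is the set of end points of the contracted arcs.  A
contracted arc and its mirror image are replaced by two vertical strands. -/
inductive Strand (c b a : Matching n) (K : Set (Fin (2 * n))) :
    Bool × Fin (2 * n) → Bool × Fin (2 * n) → Prop
  | top (i : Fin (2 * n)) : Strand c b a K (true, i) (true, c.partner i)
  | upper (i : Fin (2 * n)) (h : i ∉ K) : Strand c b a K (true, i) (true, b.partner i)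
  | lower (i : Fin (2 * n)) (h : i ∉ K) : Strand c b a K (false, i) (false, b.partner i)
  | bottom (i : Fin (2 * n)) : Strand c b a K (false, i) (false, a.partner i)
  | vertical (i : Fin (2 * n)) (h : i ∈ K) : Strand c b a K (true, i) (false, i)

/-- The circles of the partially contracted diagram. -/
def StateCircle (c b a : Matching n) (K : Set (Fin (2 * n))) : Type := Quot (Strand c b a K)

/-- The circle through a given point. -/
def circleAt (c b a : Matching n) (K : Set (Fin (2 * n))) (x : Bool × Fin (2 * n)) :
    StateCircle c b a K := Quot.mk _ x

/-- A chronology on the contraction cobordism of `b`: an order in which the arcs of `b` are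
contracted, no arc before one that surrounds it, and an arrow at each saddle.  The arrow is
`true` when it points from the strand at the left end point of the arc to the strand at the right
one.  (It is used only when the saddle is a split.) -/
structure Chronology (b : Matching n) where
  order : Fin n ≃ b.Arc
  outer_first : ∀ α β : b.Arc, α.Surrounds β → order.symm α < order.symm β
  arrow : b.Arc → Bool

namespace Chronology

variable {b : Matching n} (γ : Chronology b)

/-- The end points of the first `t` arcs that are contracted. -/
def contracted (t : ℕ) : Set (Fin (2 * n)) :=
  {i | ∃ α : b.Arc, (i = α.left ∨ i = α.right) ∧ (γ.order.symm α : ℕ) < t}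

/-- The diagram circles after `t` contractions. -/
abbrev CircleAfter (c a : Matching n) (t : ℕ) : Type := StateCircle c b a (γ.contracted t)

/-- Is the `t`-th saddle a split, that is, does it join a circle to itself? -/
def IsSplit (c a : Matching n) (t : Fin n) : Prop :=
  circleAt c b a (γ.contracted t) (true, (γ.order t).left) =
    circleAt c b a (γ.contracted t) (false, (γ.order t).left)

open Classical in
/-- What the `t`-th saddle does to circles.  The circles that meet the saddle go to the circle
through the left strand (for a merge this is the merged circle, for a split it is one of the two
new circles); every other circle goes to the circle through the same points. -/
def pushCircle (c a : Matching n) (t : Fin n) (s : γ.CircleAfter c a t) :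
    γ.CircleAfter c a (t + 1) :=
  if s = circleAt c b a (γ.contracted t) (true, (γ.order t).left) ∨
      s = circleAt c b a (γ.contracted t) (false, (γ.order t).left) then
    circleAt c b a _ (true, (γ.order t).left)
  else circleAt c b a _ (Quot.out s)

/-- The element `b₁ - b₂` of a split with arrow from the circle `b₁` to the circle `b₂`. -/
def splitElement (c a : Matching n) (t : Fin n) : OF (γ.CircleAfter c a (t + 1)) :=
  let l := OF.gen (circleAt c b a (γ.contracted (t + 1)) (true, (γ.order t).left))
  let r := OF.gen (circleAt c b a (γ.contracted (t + 1)) (true, (γ.order t).right))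
  if γ.arrow (γ.order t) then l - r else r - l

open Classical in
/-- The odd functor on the `t`-th saddle: a merge identifies the two circles, a split replaces the
circle by one of the two new ones and multiplies from the left by `b₁ - b₂`. -/
def saddle (c a : Matching n) (t : Fin n) :
    OF (γ.CircleAfter c a t) →ₗ[ℤ] OF (γ.CircleAfter c a (t + 1)) :=
  if γ.IsSplit c a t then
    LinearMap.mulLeft ℤ (γ.splitElement c a t) ∘ₗ (OF.rename (γ.pushCircle c a t)).toLinearMap
  else (OF.rename (γ.pushCircle c a t)).toLinearMap

/-- The odd functor on the first `t` saddles. -/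
def saddles (c a : Matching n) :
    (t : ℕ) → t ≤ n → (OF (γ.CircleAfter c a 0) →ₗ[ℤ] OF (γ.CircleAfter c a t))
  | 0, _ => LinearMap.id
  | t + 1, h => γ.saddle c a ⟨t, h⟩ ∘ₗ saddles c a t (Nat.le_of_succ_le h)

theorem contracted_zero : γ.contracted 0 = ∅ := by
  ext i
  simp [contracted]

theorem mem_contracted_last (i : Fin (2 * n)) : i ∈ γ.contracted n := by
  rcases lt_or_gt_of_ne (b.ne_self i) with h | h
  · exact ⟨⟨b.partner i, by rwa [b.involutive]⟩, Or.inr (b.involutive i).symm,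
      (γ.order.symm _).isLt⟩
  · exact ⟨⟨i, h⟩, Or.inl rfl, (γ.order.symm _).isLt⟩

/-- The inclusion of the circles of `W(c)b` in those of `W(c)bW(b)a`. -/
def inclUpper (c a : Matching n) : Circle c b → γ.CircleAfter c a 0 :=
  Quot.lift (fun i => circleAt c b a _ (true, i)) (by
    rintro i j (rfl | rfl)
    · exact Quot.sound (Strand.top i)
    · exact Quot.sound (Strand.upper i (by simp [contracted_zero])))

/-- The inclusion of the circles of `W(b)a` in those of `W(c)bW(b)a`. -/
def inclLower (c a : Matching n) : Circle b a → γ.CircleAfter c a 0 :=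
  Quot.lift (fun i => circleAt c b a _ (false, i)) (by
    rintro i j (rfl | rfl)
    · exact Quot.sound (Strand.lower i (by simp [contracted_zero]))
    · exact Quot.sound (Strand.bottom i))

/-- The identification of the circles of the fully contracted diagram with those of `W(c)a`, by
shrinking the vertical strands. -/
def shrink (c a : Matching n) : γ.CircleAfter c a n → Circle c a :=
  Quot.lift (fun x => Quot.mk _ x.2) (by
    intro x y h
    cases h with
    | top i => exact Quot.sound (Or.inl rfl)
    | upper i h => exact absurd (γ.mem_contracted_last i) h
    | lower i h => exact absurd (γ.mem_contracted_last i) h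
    | bottom i => exact Quot.sound (Or.inr rfl)
    | vertical i h => rfl)

/-- The multiplication map `OF(W(c)b) × OF(W(b)a) → OF(W(c)a)`: the exterior product in
`OF(W(c)bW(b)a)`, followed by the odd functor on the chronological contraction cobordism. -/
def mulMap (c a : Matching n) :
    OF (Circle c b) →ₗ[ℤ] OF (Circle b a) →ₗ[ℤ] OF (Circle c a) :=
  ((LinearMap.mul ℤ (OF (γ.CircleAfter c a 0))).compl₁₂
    (OF.rename (γ.inclUpper c a)).toLinearMap
    (OF.rename (γ.inclLower c a)).toLinearMap).compr₂
      ((OF.rename (γ.shrink c a)).toLinearMap ∘ₗ γ.saddles c a n le_rfl)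

end Chronology

/-! ### The odd arc algebra -/

/-- A choice `C` of a chronological cobordism `C_{cba}` for every triple `c, b, a`. -/
def Choice (n : ℕ) : Type := (c b a : Matching n) → Chronology b

/-- The abelian group `OH^n`, the direct sum over the finitely many pairs `(b, a)` of the groups
`b(OH^n)a = OF(W(b)a)`.  (Its product is `OH.mul` below, not the pointwise one.) -/
abbrev OH (n : ℕ) : Type := (b a : Matching n) → OF (Circle b a)

/-- The projection on the summand `b(OH^n)a`. -/
def OH.entry (b a : Matching n) : OH n →ₗ[ℤ] OF (Circle b a) :=
  LinearMap.proj a ∘ₗ LinearMap.proj b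

/-- The inclusion of the summand `b(OH^n)a`. -/
def OH.single (b a : Matching n) : OF (Circle b a) →ₗ[ℤ] OH n :=
  LinearMap.single ℤ (fun b : Matching n => (a : Matching n) → OF (Circle b a)) b ∘ₗ
    LinearMap.single ℤ (fun a : Matching n => OF (Circle b a)) a

/-- The product of `OH^n_C`; `d(OH^n)c` times `b(OH^n)a` is zero for `c ≠ b`. -/
def OH.mul (C : Choice n) : OH n →ₗ[ℤ] OH n →ₗ[ℤ] OH n :=
  ∑ c : Matching n, ∑ b : Matching n, ∑ a : Matching n,
    (((C c b a).mulMap c a).compl₁₂ (OH.entry c b) (OH.entry b a)).compr₂ (OH.single c a)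

/-- The projection of `OH^n` on the summand `Λ^p` of `b(OH^n)a`. -/
def OH.component (b a : Matching n) (p : ℕ) : OH n →ₗ[ℤ] OH n :=
  OH.single b a ∘ₗ GradedAlgebra.proj (fun p : ℕ => ⋀[ℤ]^p (Circle b a →₀ ℤ)) p ∘ₗ OH.entry b a

/-- The quantum degree of the elements of `Λ^p` in `b(OH^n)a`. -/
def quantumDegree (b a : Matching n) (p : ℕ) : ℤ := 2 * p - numCircles b a + n

/-! ### Extension to the Gaussian integers and twisting -/

/-- The underlying module of `OH^n ⊗ ℤ[i]`. -/
abbrev GaussOH (n : ℕ) : Type := GaussianInt ⊗[ℤ] OH n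

/-- The product of `OH^n_C ⊗ ℤ[i]`. -/
def GaussOH.mul (C : Choice n) :
    GaussOH n →ₗ[GaussianInt] GaussOH n →ₗ[GaussianInt] GaussOH n :=
  LinearMap.BilinMap.baseChange GaussianInt (OH.mul C)

/-- The projection of `OH^n ⊗ ℤ[i]` on its homogeneous component of degree
`(W(b)a, quantumDegree b a p)`. -/
def GaussOH.component (b a : Matching n) (p : ℕ) : GaussOH n →ₗ[GaussianInt] GaussOH n :=
  (OH.component b a p).baseChange GaussianInt

/-- A map `τ : N₂(𝒢ⁿ × 𝒵) → ℤ/4ℤ`.  The groupoid `𝒢ⁿ` has exactly one morphism `W(b)a : a → b`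
for any two matchings, so a pair of composable morphisms
`((W(c)b, k), (W(b)a, l))` of `𝒢ⁿ × 𝒵` is given by `c, b, a` and the integers `k, l`. -/
def Twist (n : ℕ) : Type := (c b a : Matching n) → (k l : ℤ) → ZMod 4

/-- The identification `t ↦ i ^ t` of `ℤ/4ℤ` with the units of `ℤ[i]`. -/
def iPow (t : ZMod 4) : GaussianInt := (⟨0, 1⟩ : GaussianInt) ^ t.val

/-- The product twisted by `τ`, that is `x * y = i ^ τ(|x|, |y|) x y` for homogeneous `x` and `y`
of composable degrees: the arguments are split into their homogeneous components.  (The exterior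
powers `Λ^p` in `OF(W(b)a)` vanish for `p > |W(b)a|`, and the product of elements whose degrees are
not composable is zero.) -/
def GaussOH.twistedMul (C : Choice n) (τ : Twist n) :
    GaussOH n →ₗ[GaussianInt] GaussOH n →ₗ[GaussianInt] GaussOH n :=
  ∑ c : Matching n, ∑ b : Matching n, ∑ a : Matching n,
    ∑ p ∈ Finset.range (numCircles c b + 1), ∑ q ∈ Finset.range (numCircles b a + 1),
      iPow (τ c b a (quantumDegree c b p) (quantumDegree b a q)) •
        (GaussOH.mul C).compl₁₂ (GaussOH.component c b p) (GaussOH.component b a q)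

/-- The twisted algebra `(OH^n_C ⊗ ℤ[i])_τ`, a possibly nonassociative `ℤ[i]`-algebra. -/
def TwistedOH {n : ℕ} (_C : Choice n) (_τ : Twist n) : Type := GaussOH n

namespace TwistedOH

variable (C : Choice n) (τ : Twist n)

instance : AddCommGroup (TwistedOH C τ) := inferInstanceAs (AddCommGroup (GaussOH n))

instance : Module GaussianInt (TwistedOH C τ) := inferInstanceAs (Module GaussianInt (GaussOH n))

instance : Mul (TwistedOH C τ) := ⟨fun x y => GaussOH.twistedMul C τ x y⟩

instance : NonUnitalNonAssocRing (TwistedOH C τ) where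
  left_distrib x y z := (GaussOH.twistedMul C τ x).map_add y z
  right_distrib x y z := LinearMap.map_add₂ (GaussOH.twistedMul C τ) x y z
  zero_mul x := LinearMap.map_zero₂ (GaussOH.twistedMul C τ) x
  mul_zero x := (GaussOH.twistedMul C τ x).map_zero

instance : IsScalarTower GaussianInt (TwistedOH C τ) (TwistedOH C τ) :=
  ⟨fun r x y => LinearMap.map_smul₂ (GaussOH.twistedMul C τ) r x y⟩

instance : SMulCommClass GaussianInt (TwistedOH C τ) (TwistedOH C τ) :=
  ⟨fun r x y => ((GaussOH.twistedMul C τ x).map_smul r y).symm⟩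

/-- The homogeneous component of degree `(W(b)a, k)`, for the morphism `W(b)a : a → b` of `𝒢ⁿ` and
the quantum degree `k`. -/
def homogeneous (b a : Matching n) (k : ℤ) : Submodule GaussianInt (TwistedOH C τ) :=
  ⨆ p : {p : ℕ // quantumDegree b a p = k}, LinearMap.range (GaussOH.component b a p)

/-- The twist `τ` is associating for `C`: the twisted algebra is associative. -/
def IsAssociative : Prop := ∀ x y z : TwistedOH C τ, x * y * z = x * (y * z)

end TwistedOH

end OddArc

end

open scoped TensorProduct

noncomputable section

namespace OddArc

/-! ### Counting classes of finite relations -/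

/-! Write `A` for the standard matching with arcs {2k, 2k+1}. When circles are lifted to points, the
product of c(OH)b and b(OH)a becomes (X, Y) ↦ image of ω X Y, where ω is the exterior product of the
vectors "left end minus right end", up to sign, of those arcs of b whose contraction is a split
(`Chronology.mulMap_renameCircle`). For every chronology these vectors span, among the circles of
W(c)a, the kernel of the map from circles to components of the union of c, b, a, and their number is
fixed by an Euler characteristic count. Exterior products of equally many integral vectors with the
same span agree up to sign, so another choice changes each product only by a sign
(`Chronology.renameCircle_omega_eq_or`). Signs are powers of i, and it remains to compare two
associating weights w, w' for one and the same choice.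

The difference σ = w - w' satisfies a 2-cocycle relation wherever triple products do not vanish, and
multiplying homogeneous components by i^θ changes σ by a coboundary. Such rescalings make σ vanish
for c = b, become independent of the exterior degrees, and vanish for a = `A`. The last
normalization is strong because no product of Λ⁰ with Λ⁰ that lands in the column of `A` vanishes:
the contraction cobordism then has genus zero (`Choice.numCircles_std`). It forces σ to vanish on
all products without splits. What remains are the values at (b, c, b) for neighbours b, c with c
nearer to `A`. These agree on opposite sides of squares of neighbours (`IsNormalized.square`), and
squares connect all such pairs (`Choice.cover_function_eq`), so a single element of ℤ/4 survives. It
is read off by `atomInvariant`.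

This last class is removed by an isomorphism that is not a scalar on homogeneous components. The
height map N sends a point to the alternating sum of the points on its left, itself included when it
is odd. It is idempotent, it descends to the circles of every diagram, and modulo nested arcs it
fixes the vector of an arc that starts at an even point and kills the vector of any other arc.
Nested arcs are contracted later, so ω is an eigenvector of Λ(1 + (μ - 1)N) with eigenvalue μ to the
number of splits along even arcs (`Chronology.scale_omega`). For μ = i^κ this algebra map changes
the weights by κ times a cocycle of invariant 1 (`atomInvariant_evenCochain`). A suitable κ together
with a suitable θ gives the isomorphism. -/

theorem card_eq_add_one_of_pair_fiber {X Y : Type*} [Finite X] (f : X → Y)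
    (hf : Function.Surjective f) (u w : X) (huw : u ≠ w) (hfu : f u = f w)
    (h : ∀ x y, f x = f y → x = y ∨ ((x = u ∨ x = w) ∧ (y = u ∨ y = w))) :
    Nat.card X = Nat.card Y + 1 := by
  classical
  have e : Function.Bijective (fun x : {x : X // x ≠ w} => f x) := by
    constructor
    · rintro ⟨x, hx⟩ ⟨y, hy⟩ hxy
      rcases h x y hxy with h | ⟨h1, h2⟩
      · exact Subtype.ext h
      · exact Subtype.ext ((h1.resolve_right hx).trans (h2.resolve_right hy).symm)
    · intro y
      obtain ⟨x, rfl⟩ := hf y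
      by_cases hx : x = w
      · exact ⟨⟨u, huw⟩, by simp [hx, hfu]⟩
      · exact ⟨⟨x, hx⟩, rfl⟩
  rw [← Nat.card_eq_of_bijective _ e]
  have := Fintype.ofFinite X
  rw [Nat.card_eq_fintype_card, Nat.card_eq_fintype_card, Fintype.card_subtype_compl,
    Fintype.card_subtype_eq, Nat.sub_add_cancel]
  exact Fintype.card_pos_iff.2 ⟨w⟩

/-- Equality in a quotient is the generated equivalence, so any equivalence containing the
generators contains it. Later claims about circles and components are reduced in this way to single
strands. -/
theorem quot_eq_imp {X Z : Type*} {r : X → X → Prop} (E : Z → Z → Prop) (hE : Equivalence E)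
    (f : X → Z) (h : ∀ x y, r x y → E (f x) (f y)) {x y : X} (hxy : Quot.mk r x = Quot.mk r y) :
    E (f x) (f y) := by
  have := Quot.eqvGen_exact hxy
  induction this with
  | rel x y hr => exact h x y hr
  | refl x => exact hE.refl _
  | symm x y _ ih => exact hE.symm (ih (Quot.eqvGen_sound ‹_›))
  | trans x y z _ _ ih1 ih2 =>
    exact hE.trans (ih1 (Quot.eqvGen_sound ‹_›)) (ih2 (Quot.eqvGen_sound ‹_›))

/-- The equivalence that glues `u` to `w` and nothing else: this is how a saddle or a flip of two
arcs alters the set of circles. -/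
theorem equivalence_eq_or_pair {Z : Type*} (u w : Z) :
    Equivalence fun x y : Z => x = y ∨ ((x = u ∨ x = w) ∧ (y = u ∨ y = w)) where
  refl x := Or.inl rfl
  symm := by rintro x y (h | h); exacts [Or.inl h.symm, Or.inr h.symm]
  trans := by
    rintro x y z (rfl | h) (rfl | h')
    exacts [Or.inl rfl, Or.inr h', Or.inr h, Or.inr ⟨h.1, h'.2⟩]

theorem quot_eq_or_pair {X Z : Type*} {r : X → X → Prop} (f : X → Z) (u w : Z)
    (h : ∀ x y, r x y → f x = f y ∨ ((f x = u ∨ f x = w) ∧ (f y = u ∨ f y = w))) {x y : X}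
    (hxy : Quot.mk r x = Quot.mk r y) :
    f x = f y ∨ ((f x = u ∨ f x = w) ∧ (f y = u ∨ f y = w)) :=
  quot_eq_imp _ (equivalence_eq_or_pair u w) f h hxy

theorem quot_eq_of_rel {X Z : Type*} {r : X → X → Prop} (f : X → Z)
    (h : ∀ x y, r x y → f x = f y) {x y : X} (hxy : Quot.mk r x = Quot.mk r y) : f x = f y :=
  quot_eq_imp _ eq_equivalence f h hxy

/-! ### Orbits of two involutions -/

section Involutions

variable {X : Type*}

/-- A class of two involutions contains at most two fixed points of the second one. -/
theorem eq_of_fixed_of_class (p q : Equiv.Perm X) (hp : ∀ x, p (p x) = x) (hq : ∀ x, q (q x) = x)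
    {a y z : X} (ha : q a = a) (hy : q y = y) (hz : q z = z)
    (hay : Quot.mk (fun i j => j = p i ∨ j = q i) a = Quot.mk _ y)
    (haz : Quot.mk (fun i j => j = p i ∨ j = q i) a = Quot.mk _ z) (hya : y ≠ a) (hza : z ≠ a) :
    y = z := by
  -- The two involutions generate a dihedral group. Since `q` fixes `a` and conjugates `f` to its
  -- inverse, the class of `a` is the `f`-orbit of `a`, and `q` sends `f ^ k a` to `f ^ (-k) a`. So
  -- `f ^ k a` is fixed exactly when the period divides `2 * k`.
  set f : Equiv.Perm X := q * p with hf
  have hqf : ∀ x, q (f x) = p x := fun x => hq _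
  have hqinv : q⁻¹ = q := by ext x; rw [Equiv.Perm.inv_eq_iff_eq, hq]
  have hpinv : p⁻¹ = p := by ext x; rw [Equiv.Perm.inv_eq_iff_eq, hp]
  have hconj : q * f * q⁻¹ = f⁻¹ := by
    rw [hf, mul_inv_rev, hqinv, hpinv]
    ext x; simp [hq]
  have hconjz : ∀ k : ℤ, q * f ^ k = f ^ (-k) * q := by
    intro k
    rw [← mul_inv_eq_iff_eq_mul, ← conj_zpow, hconj, inv_zpow, zpow_neg]
  have orb : ∀ x y, Quot.mk (fun i j => j = p i ∨ j = q i) x = Quot.mk _ y →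
      ((∃ k : ℤ, (f ^ k) a = x) ↔ ∃ k : ℤ, (f ^ k) a = y) := by
    intro x y hxy
    refine quot_eq_imp (fun P Q : Prop => (P ↔ Q)) ⟨fun _ => Iff.rfl, Iff.symm, Iff.trans⟩
      (fun x => ∃ k : ℤ, (f ^ k) a = x) ?_ hxy
    have key : ∀ k : ℤ, q ((f ^ k) a) = (f ^ (-k)) a := by
      intro k
      rw [← Equiv.Perm.mul_apply, hconjz, Equiv.Perm.mul_apply, ha]
    have hqstep : ∀ x, (∃ k : ℤ, (f ^ k) a = x) → ∃ k : ℤ, (f ^ k) a = q x := by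
      rintro x ⟨k, rfl⟩
      exact ⟨-k, (key k).symm⟩
    have hfstep : ∀ x, (∃ k : ℤ, (f ^ k) a = x) → ∃ k : ℤ, (f ^ k) a = f x := by
      rintro x ⟨k, rfl⟩
      exact ⟨1 + k, by rw [zpow_add, zpow_one, Equiv.Perm.mul_apply]⟩
    have hpstep : ∀ x, (∃ k : ℤ, (f ^ k) a = x) → ∃ k : ℤ, (f ^ k) a = p x := by
      intro x hx
      rw [← hqf]
      exact hqstep _ (hfstep _ hx)
    rintro x y (rfl | rfl)
    · exact ⟨hpstep x, fun h => by simpa [hp] using hpstep _ h⟩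
    · exact ⟨hqstep x, fun h => by simpa [hq] using hqstep _ h⟩
  have key : ∀ y, q y = y → y ≠ a → Quot.mk (fun i j => j = p i ∨ j = q i) a = Quot.mk _ y →
      ∃ k : ℤ, (f ^ k) a = y ∧ (MulAction.period f a : ℤ) ∣ 2 * k ∧
        ¬ (MulAction.period f a : ℤ) ∣ k := by
    intro y hy hya h
    obtain ⟨k, rfl⟩ := (orb a y h).1 ⟨0, rfl⟩
    refine ⟨k, rfl, ?_, ?_⟩
    · rw [← MulAction.zpow_smul_eq_iff_period_dvd, Equiv.Perm.smul_def, two_mul, zpow_add,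
        Equiv.Perm.mul_apply]
      rw [← Equiv.Perm.mul_apply, hconjz, Equiv.Perm.mul_apply, ha] at hy
      rw [← hy, ← Equiv.Perm.mul_apply, ← zpow_add, add_neg_cancel, zpow_zero,
        Equiv.Perm.one_apply]
    · rw [← MulAction.zpow_smul_eq_iff_period_dvd]
      exact hya
  obtain ⟨k, rfl, ⟨u, hu⟩, hk'⟩ := key y hy hya hay
  obtain ⟨j, rfl, ⟨v, hv⟩, hj'⟩ := key z hz hza haz
  -- Both exponents are odd multiples of half the period, hence they differ by a multiple of the
  -- period.
  have hu' : ¬ (2 : ℤ) ∣ u := by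
    rintro ⟨w, rfl⟩
    exact hk' ⟨w, by linarith⟩
  have hv' : ¬ (2 : ℤ) ∣ v := by
    rintro ⟨w, rfl⟩
    exact hj' ⟨w, by linarith⟩
  obtain ⟨w, hw⟩ : (2 : ℤ) ∣ u - v := by omega
  have : (MulAction.period f a : ℤ) ∣ k - j := ⟨w, by
    have : 2 * (k - j) = 2 * (MulAction.period f a * w) := by
      rw [mul_sub, hu, hv, ← mul_sub, hw]; ring
    linarith⟩
  rw [← MulAction.zpow_smul_eq_iff_period_dvd, Equiv.Perm.smul_def] at this
  calc (f ^ k) a = (f ^ j) ((f ^ (k - j)) a) := by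
        rw [← Equiv.Perm.mul_apply, ← zpow_add, add_sub_cancel]
    _ = (f ^ j) a := by rw [this]

open Classical in
/-- The signs of the fixed points in a class of two sign-reversing involutions cancel. -/
theorem sum_sign_fixed_of_class [Fintype X] (p q : Equiv.Perm X) (hp : ∀ x, p (p x) = x)
    (hq : ∀ x, q (q x) = x) (sgn : X → ℤ)
    (hps : ∀ x, sgn (p x) = - sgn x) (hqs : ∀ x, q x ≠ x → sgn (q x) = - sgn x) (a : X) :
    ∑ x with Quot.mk (fun i j => j = p i ∨ j = q i) x = Quot.mk _ a ∧ q x = x, sgn x = 0 := by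
  set S : X → Prop := fun x => Quot.mk (fun i j => j = p i ∨ j = q i) x = Quot.mk _ a with hS
  have hSp : ∀ x, S x → S (p x) := fun x hx => by
    exact (Quot.sound (r := fun i j => j = p i ∨ j = q i) (Or.inl rfl)).symm.trans hx
  have hSq : ∀ x, S x → S (q x) := fun x hx => by
    exact (Quot.sound (r := fun i j => j = p i ∨ j = q i) (Or.inr rfl)).symm.trans hx
  -- The involution `p` cancels the signs of the whole class, and `q` those of the points that it
  -- moves. Only the fixed points of `q` are left over.
  have h1 : ∑ x with S x, sgn x = 0 := by
    refine Finset.sum_involution (fun x _ => p x) ?_ ?_ ?_ ?_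
    · intro x _; simp [hps]
    · intro x _ h0 h
      have := hps x
      rw [h] at this
      exact h0 (by linarith)
    · intro x hx
      simp only [Finset.mem_filter, Finset.mem_univ, true_and] at hx ⊢
      exact hSp x hx
    · intro x _; exact hp x
  have h2 : ∑ x with S x ∧ ¬ q x = x, sgn x = 0 := by
    refine Finset.sum_involution (fun x _ => q x) ?_ ?_ ?_ ?_
    · intro x hx
      simp only [Finset.mem_filter, Finset.mem_univ, true_and] at hx
      simp [hqs x hx.2]
    · intro x hx h0
      simp only [Finset.mem_filter, Finset.mem_univ, true_and] at hx
      exact hx.2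
    · intro x hx
      simp only [Finset.mem_filter, Finset.mem_univ, true_and] at hx ⊢
      refine ⟨hSq x hx.1, ?_⟩
      rw [hq]
      exact fun h => hx.2 h.symm
    · intro x _; exact hq x
  rw [← Finset.sum_filter_add_sum_filter_not _ (fun x => q x = x), Finset.filter_filter,
    Finset.filter_filter, h2, add_zero] at h1
  exact h1

/-- If the second of two sign-reversing involutions has exactly four fixed points `a, b, c, d`, of
which `a` and `d` have the same sign and `b`, `c` the other one, then `a` is in the class of exactly
one of `b` and `c`, and not in that of `d`. -/
theorem class_of_four_fixed [Finite X] (p q : Equiv.Perm X) (hp : ∀ x, p (p x) = x)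
    (hq : ∀ x, q (q x) = x) (sgn : X → ℤ) (hs0 : ∀ x, sgn x ≠ 0)
    (hps : ∀ x, sgn (p x) = - sgn x) (hqs : ∀ x, q x ≠ x → sgn (q x) = - sgn x) (a b c d : X)
    (hfix : ∀ x, q x = x ↔ x = a ∨ x = b ∨ x = c ∨ x = d)
    (hb : sgn b = - sgn a) (hc : sgn c = - sgn a) (hd : sgn d = sgn a) (had : a ≠ d)
    (hbc : b ≠ c) :
    let C : X → Quot (fun i j : X => j = p i ∨ j = q i) := Quot.mk _
    C a ≠ C d ∧ ((C b = C a ∧ C c ≠ C a) ∨ (C b ≠ C a ∧ C c = C a)) := by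
  classical
  have := Fintype.ofFinite X
  intro C
  have hab : a ≠ b := by rintro rfl; exact hs0 a (by linarith)
  have hac : a ≠ c := by rintro rfl; exact hs0 a (by linarith)
  have hbd : b ≠ d := by rintro rfl; exact hs0 a (by linarith)
  have hcd : c ≠ d := by rintro rfl; exact hs0 a (by linarith)
  have hfa := (hfix a).2 (by tauto)
  have hfb := (hfix b).2 (by tauto)
  have hfc := (hfix c).2 (by tauto)
  have hfd := (hfix d).2 (by tauto)
  -- At most one of `b`, `c`, `d` shares the class of `a`. The signs of the fixed points in this
  -- class sum to zero, so exactly one does, and its sign is opposite to that of `a`.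
  have hbc' : ¬ (C a = C b ∧ C a = C c) := fun h =>
    hbc (eq_of_fixed_of_class p q hp hq hfa hfb hfc h.1 h.2 hab.symm hac.symm)
  have hbd' : ¬ (C a = C b ∧ C a = C d) := fun h =>
    hbd (eq_of_fixed_of_class p q hp hq hfa hfb hfd h.1 h.2 hab.symm had.symm)
  have hcd' : ¬ (C a = C c ∧ C a = C d) := fun h =>
    hcd (eq_of_fixed_of_class p q hp hq hfa hfc hfd h.1 h.2 hac.symm had.symm)
  have hsum := sum_sign_fixed_of_class p q hp hq sgn hps hqs a
  have hset : (Finset.univ.filter fun x => Quot.mk (fun i j => j = p i ∨ j = q i) x = Quot.mk _ a ∧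
      q x = x) = ({a, b, c, d} : Finset X).filter fun x => C x = C a := by
    ext x
    simp only [Finset.mem_filter, Finset.mem_univ, true_and, hfix, Finset.mem_insert,
      Finset.mem_singleton]
    exact and_comm
  rw [hset, Finset.sum_filter, Finset.sum_insert (by simp [hab, hac, had]),
    Finset.sum_insert (by simp [hbc, hbd]), Finset.sum_insert (by simp [hcd]),
    Finset.sum_singleton, if_pos rfl, hb, hc, hd] at hsum
  have := hs0 a
  have e : ∀ x, C x = C a ↔ C a = C x := fun x => eq_comm
  simp only [ne_eq]
  rw [e b, e c]
  rw [e b, e c, e d] at hsum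
  clear_value C
  clear hset hfix hps hqs
  generalize sgn a = sa at hsum this
  split_ifs at hsum with h1 h2 h3 h4 h5 h6 h7
  all_goals first
    | exact (hbc' ⟨h1, h2⟩).elim
    | (exfalso; omega)
    | exact ⟨‹_›, Or.inl ⟨‹_›, ‹_›⟩⟩
    | exact ⟨‹_›, Or.inr ⟨‹_›, ‹_›⟩⟩

end Involutions

end OddArc

namespace OddArc

variable {n : ℕ}

/-! ### Parity of the end points of an arc -/

theorem Matching.partner_partner (b : Matching n) (i : Fin (2 * n)) :
    b.partner (b.partner i) = i := b.involutive i

/-- The points strictly between the end points of an arc are matched among themselves. -/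
theorem Matching.partner_mem_Ioo (b : Matching n) {i j : Fin (2 * n)}
    (h : i < j ∧ j < b.partner i) : i < b.partner j ∧ b.partner j < b.partner i :=
  b.noncrossing i j h.1 h.2

/-- The partner map is a fixed-point-free involution of `S`, so the constant 1 sums to zero modulo
2. -/
theorem Matching.even_card_of_closed (b : Matching n) (S : Finset (Fin (2 * n)))
    (h : ∀ i ∈ S, b.partner i ∈ S) : Even S.card := by
  have : ∑ i ∈ S, (1 : ZMod 2) = 0 :=
    Finset.sum_involution (fun i _ => b.partner i) (fun _ _ => by decide)
      (fun i _ _ => b.ne_self i) h (fun i _ => b.involutive i)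
  rw [Finset.sum_const, nsmul_eq_mul, mul_one] at this
  exact (ZMod.natCast_eq_zero_iff_even).1 this

/-- An arc joins an even point with an odd one. -/
theorem Matching.parity_partner (b : Matching n) (i : Fin (2 * n)) :
    ((b.partner i : ℕ) + i) % 2 = 1 := by
  have key : ∀ i, i < b.partner i → ((b.partner i : ℕ) + i) % 2 = 1 := by
    intro i hi
    have := b.even_card_of_closed (Finset.Ioo i (b.partner i)) (by
      intro j hj
      rw [Finset.mem_Ioo] at hj ⊢
      exact b.partner_mem_Ioo hj)
    rw [Fin.card_Ioo] at this
    have h1 : (i : ℕ) < b.partner i := hi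
    obtain ⟨k, hk⟩ := this
    omega
  rcases lt_or_gt_of_ne (b.ne_self i) with h | h
  · have := key (b.partner i) (by rwa [b.involutive])
    rw [b.involutive] at this
    omega
  · exact key i h

/-! ### The topology of a saddle -/

section Saddle

variable (c b a : Matching n) (K : Set (Fin (2 * n))) (l : Fin (2 * n))

/-- The involution that follows the strands of `W(c)` and of `a`. -/
def outerStrand : Equiv.Perm (Bool × Fin (2 * n)) :=
  Function.Involutive.toPerm (fun x => (x.1, if x.1 then c.partner x.2 else a.partner x.2)) (by
    rintro ⟨_ | _, i⟩ <;> simp [Matching.partner_partner])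

open Classical in
/-- The involution that follows the other strands of the diagram in which the end points in `K` are
contracted, except those of the arc at `l`, whose end points are fixed. -/
def innerStrand (hK : ∀ i ∈ K, b.partner i ∈ K) : Equiv.Perm (Bool × Fin (2 * n)) :=
  Function.Involutive.toPerm (fun x => if x.2 ∈ K then (!x.1, x.2) else
      if x.2 = l ∨ x.2 = b.partner l then x else (x.1, b.partner x.2)) (by
    rintro ⟨s, i⟩
    have hK' : b.partner i ∈ K ↔ i ∈ K := ⟨fun h => by simpa [b.involutive] using hK _ h, hK i⟩
    by_cases hi : i ∈ K
    · simp [hi]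
    · by_cases h : i = l ∨ i = b.partner l
      · simp [hi, h]
      · have h' : ¬ (b.partner i = l ∨ b.partner i = b.partner l) := by
          rintro (h' | h')
          · exact h (Or.inr (by rw [← h', b.involutive]))
          · exact h (Or.inl (by rw [← b.involutive i, h', b.involutive]))
        simp [hi, h, hK', h', b.involutive])

variable {c b a K l}

open Classical in
theorem innerStrand_apply (hK : ∀ i ∈ K, b.partner i ∈ K) (x : Bool × Fin (2 * n)) :
    innerStrand b K l hK x = if x.2 ∈ K then (!x.1, x.2) else
      if x.2 = l ∨ x.2 = b.partner l then x else (x.1, b.partner x.2) := rfl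

theorem innerStrand_of_mem (hK : ∀ i ∈ K, b.partner i ∈ K) {s : Bool} {i : Fin (2 * n)}
    (hi : i ∈ K) : innerStrand b K l hK (s, i) = (!s, i) := by
  simp [innerStrand_apply, hi]

theorem innerStrand_of_not_mem (hK : ∀ i ∈ K, b.partner i ∈ K) {s : Bool} {i : Fin (2 * n)}
    (hi : i ∉ K) (h : ¬ (i = l ∨ i = b.partner l)) :
    innerStrand b K l hK (s, i) = (s, b.partner i) := by
  simp [innerStrand_apply, hi, h]

theorem innerStrand_fixed (hK : ∀ i ∈ K, b.partner i ∈ K) (hl : l ∉ K) (x : Bool × Fin (2 * n)) :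
    innerStrand b K l hK x = x ↔
      x = (true, l) ∨ x = (true, b.partner l) ∨ x = (false, l) ∨ x = (false, b.partner l) := by
  have hr : b.partner l ∉ K := fun h => hl (by simpa [b.involutive] using hK _ h)
  obtain ⟨s, i⟩ := x
  by_cases hi : i ∈ K
  · have h1 : i ≠ l := by rintro rfl; exact hl hi
    have h2 : i ≠ b.partner l := by rintro rfl; exact hr hi
    simp [innerStrand_of_mem hK hi, h1, h2]
  · by_cases h : i = l ∨ i = b.partner l
    · have : innerStrand b K l hK (s, i) = (s, i) := by simp [innerStrand_apply, hi, h]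
      simp only [this, true_iff]
      rcases h with rfl | rfl <;> cases s <;> simp
    · rw [innerStrand_of_not_mem hK hi h]
      push Not at h
      simp [h.1, h.2, b.ne_self]

/-- What a saddle does to circles.  Here `K` and `K'` are the sets of contracted points before and
after the contraction of the arc at `l`. -/
theorem saddle_topology (K' : Set (Fin (2 * n))) (hK : ∀ i ∈ K, b.partner i ∈ K) (hl : l ∉ K)
    (hK' : ∀ i, i ∈ K' ↔ i ∈ K ∨ i = l ∨ i = b.partner l) :
    (∀ x y, circleAt c b a K x = circleAt c b a K y →
      circleAt c b a K' x = circleAt c b a K' y ∨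
      ((circleAt c b a K' x = circleAt c b a K' (true, l) ∨
        circleAt c b a K' x = circleAt c b a K' (true, b.partner l)) ∧
       (circleAt c b a K' y = circleAt c b a K' (true, l) ∨
        circleAt c b a K' y = circleAt c b a K' (true, b.partner l)))) ∧
    ((circleAt c b a K (true, l) = circleAt c b a K (false, l) ∧
      circleAt c b a K' (true, l) ≠ circleAt c b a K' (true, b.partner l) ∧
      Nat.card (StateCircle c b a K') = Nat.card (StateCircle c b a K) + 1) ∨
     (circleAt c b a K (true, l) ≠ circleAt c b a K (false, l) ∧
      circleAt c b a K' (true, l) = circleAt c b a K' (true, b.partner l) ∧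
      Nat.card (StateCircle c b a K) = Nat.card (StateCircle c b a K') + 1)) := by
  have hr : b.partner l ∉ K := fun h => hl (by simpa [b.involutive] using hK _ h)
  set p := outerStrand c a with hp
  set q := innerStrand b K l hK with hq
  -- The strands that avoid the saddle. The diagram before the contraction adds to them the arc at
  -- `l` and its mirror image, the diagram after it adds two vertical strands at the same four end
  -- points. Both sets of circles are therefore quotients of the classes of `r0`.
  let r0 : Bool × Fin (2 * n) → Bool × Fin (2 * n) → Prop := fun i j => j = p i ∨ j = q i
  let C : Bool × Fin (2 * n) → Quot r0 := Quot.mk r0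
  have hpT : ∀ i, p (true, i) = (true, c.partner i) := fun i => rfl
  have hpF : ∀ i, p (false, i) = (false, a.partner i) := fun i => rfl
  have vert : ∀ s i, i ∈ K' → circleAt c b a K' (s, i) = circleAt c b a K' (!s, i) := by
    rintro (_ | _) i hi
    · exact (Quot.sound (Strand.vertical i hi)).symm
    · exact Quot.sound (Strand.vertical i hi)
  have hlK' : l ∈ K' := (hK' l).2 (by tauto)
  have hrK' : b.partner l ∈ K' := (hK' _).2 (by tauto)
  -- the basic strands belong to both diagrams
  have r0K : ∀ x y, r0 x y → circleAt c b a K x = circleAt c b a K y := by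
    rintro ⟨s, i⟩ y (rfl | rfl)
    · cases s
      · rw [hpF]; exact Quot.sound (Strand.bottom i)
      · rw [hpT]; exact Quot.sound (Strand.top i)
    · by_cases hi : i ∈ K
      · rw [hq, innerStrand_of_mem hK hi]
        cases s
        · exact (Quot.sound (Strand.vertical i hi)).symm
        · exact Quot.sound (Strand.vertical i hi)
      · by_cases h : i = l ∨ i = b.partner l
        · rw [(innerStrand_fixed hK hl (s, i)).2 (by rcases h with rfl | rfl <;> cases s <;> simp)]
        · rw [hq, innerStrand_of_not_mem hK hi h]
          cases s
          · exact Quot.sound (Strand.lower i hi)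
          · exact Quot.sound (Strand.upper i hi)
  have r0K' : ∀ x y, r0 x y → circleAt c b a K' x = circleAt c b a K' y := by
    rintro ⟨s, i⟩ y (rfl | rfl)
    · cases s
      · rw [hpF]; exact Quot.sound (Strand.bottom i)
      · rw [hpT]; exact Quot.sound (Strand.top i)
    · by_cases hi : i ∈ K
      · rw [hq, innerStrand_of_mem hK hi]
        exact vert s i ((hK' i).2 (Or.inl hi))
      · by_cases h : i = l ∨ i = b.partner l
        · rw [(innerStrand_fixed hK hl (s, i)).2 (by rcases h with rfl | rfl <;> cases s <;> simp)]
        · rw [hq, innerStrand_of_not_mem hK hi h]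
          have hi' : i ∉ K' := by rw [hK']; tauto
          cases s
          · exact Quot.sound (Strand.lower i hi')
          · exact Quot.sound (Strand.upper i hi')
  have hCp : ∀ x, C x = C (p x) := fun x => Quot.sound (Or.inl rfl)
  have hCq : ∀ x, C x = C (q x) := fun x => Quot.sound (Or.inr rfl)
  -- the strands of the two diagrams
  have KC : ∀ x y, Strand c b a K x y → C x = C y ∨
      ∃ s, (x = (s, l) ∧ y = (s, b.partner l)) ∨ (x = (s, b.partner l) ∧ y = (s, l)) := by
    have arc : ∀ s i, i ∉ K → C (s, i) = C (s, b.partner i) ∨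
      ∃ s', ((s, i) = (s', l) ∧ (s, b.partner i) = (s', b.partner l)) ∨
        ((s, i) = (s', b.partner l) ∧ (s, b.partner i) = (s', l)) := by
      intro s i hi
      by_cases h : i = l ∨ i = b.partner l
      · right
        refine ⟨s, ?_⟩
        rcases h with rfl | rfl <;> simp [b.involutive]
      · left
        rw [hCq (s, i), hq, innerStrand_of_not_mem hK hi h]
    intro x y h
    cases h with
    | top i => left; rw [hCp (true, i), hpT]
    | bottom i => left; rw [hCp (false, i), hpF]
    | upper i hi => exact arc true i hi
    | lower i hi => exact arc false i hi
    | vertical i hi => left; rw [hCq (true, i), hq, innerStrand_of_mem hK hi]; rfl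
  have K'C : ∀ x y, Strand c b a K' x y → C x = C y ∨
      (x = (true, l) ∧ y = (false, l)) ∨ (x = (true, b.partner l) ∧ y = (false, b.partner l)) := by
    intro x y h
    cases h with
    | top i => left; rw [hCp (true, i), hpT]
    | bottom i => left; rw [hCp (false, i), hpF]
    | upper i hi =>
      left; rw [hK'] at hi; push Not at hi
      rw [hCq (true, i), hq, innerStrand_of_not_mem hK hi.1 (by tauto)]
    | lower i hi =>
      left; rw [hK'] at hi; push Not at hi
      rw [hCq (false, i), hq, innerStrand_of_not_mem hK hi.1 (by tauto)]
    | vertical i hi =>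
      rcases (hK' i).1 hi with hi | rfl | rfl
      · left; rw [hCq (true, i), hq, innerStrand_of_mem hK hi]; rfl
      · right; left; exact ⟨rfl, rfl⟩
      · right; right; exact ⟨rfl, rfl⟩
  let gK : Quot r0 → StateCircle c b a K := Quot.lift (circleAt c b a K) r0K
  let gK' : Quot r0 → StateCircle c b a K' := Quot.lift (circleAt c b a K') r0K'
  have gKs : Function.Surjective gK := by
    rintro ⟨x⟩; exact ⟨C x, rfl⟩
  have gK's : Function.Surjective gK' := by
    rintro ⟨x⟩; exact ⟨C x, rfl⟩
  have liftK : ∀ x y, C x = C y → circleAt c b a K x = circleAt c b a K y :=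
    fun x y h => congrArg gK h
  have liftK' : ∀ x y, C x = C y → circleAt c b a K' x = circleAt c b a K' y :=
    fun x y h => congrArg gK' h
  refine ⟨?_, ?_⟩
  · intro x y hxy
    refine quot_eq_or_pair (circleAt c b a K') _ _ ?_ hxy
    intro x y h
    rcases KC x y h with h | ⟨s, h⟩
    · exact Or.inl (liftK' _ _ h)
    · have e1 : circleAt c b a K' (s, l) = circleAt c b a K' (true, l) := by
        cases s
        · exact vert false l hlK'
        · rfl
      have e2 : circleAt c b a K' (s, b.partner l) = circleAt c b a K' (true, b.partner l) := by
        cases s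
        · exact vert false _ hrK'
        · rfl
      rcases h with ⟨rfl, rfl⟩ | ⟨rfl, rfl⟩
      · exact Or.inr ⟨Or.inl e1, Or.inr e2⟩
      · exact Or.inr ⟨Or.inr e2, Or.inl e1⟩
  -- the four end points of the saddle
  let sgn : Bool × Fin (2 * n) → ℤ := fun x => (if x.1 then 1 else -1) * (-1) ^ (x.2 : ℕ)
  have hsp : ∀ (b : Matching n) i, ((-1 : ℤ)) ^ (b.partner i : ℕ) = - (-1) ^ (i : ℕ) := by
    intro b i
    have := b.parity_partner i
    rcases Nat.even_or_odd (i : ℕ) with h | h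
    · have h' : Odd (b.partner i : ℕ) := by
        rw [Nat.odd_iff]; rw [Nat.even_iff] at h; omega
      rw [h.neg_one_pow, h'.neg_one_pow]
    · have h' : Even (b.partner i : ℕ) := by
        rw [Nat.even_iff]; rw [Nat.odd_iff] at h; omega
      rw [h.neg_one_pow, h'.neg_one_pow]; rfl
  have hs0 : ∀ x, sgn x ≠ 0 := by
    rintro ⟨_ | _, i⟩ <;> simp [sgn]
  have hps : ∀ x, sgn (p x) = - sgn x := by
    rintro ⟨_ | _, i⟩
    · rw [hpF]; simp [sgn, hsp]
    · rw [hpT]; simp [sgn, hsp]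
  have hqs : ∀ x, q x ≠ x → sgn (q x) = - sgn x := by
    rintro ⟨s, i⟩ hx
    by_cases hi : i ∈ K
    · rw [hq, innerStrand_of_mem hK hi]
      cases s <;> simp [sgn]
    · by_cases h : i = l ∨ i = b.partner l
      · exact absurd ((innerStrand_fixed hK hl (s, i)).2
          (by rcases h with rfl | rfl <;> cases s <;> simp)) hx
      · rw [hq, innerStrand_of_not_mem hK hi h]
        cases s <;> simp [sgn, hsp]
  have hpp : ∀ x, p (p x) = x := fun x => Function.Involutive.toPerm_involutive _ x
  have hqq : ∀ x, q (q x) = x := fun x => Function.Involutive.toPerm_involutive _ x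
  -- Every strand joins points of opposite sign: an arc changes the parity of the point, a vertical
  -- strand changes the line. Hence the two open paths that end at the saddle cannot pair it
  -- diagonally. They run either between the ends of each arc (a merge) or between an end point and
  -- its mirror image (a split).
  have ha := class_of_four_fixed p q hpp hqq sgn hs0 hps hqs (true, l) (true, b.partner l)
    (false, l) (false, b.partner l) (innerStrand_fixed hK hl) (by simp [sgn, hsp]) (by simp [sgn])
    (by simp [sgn, hsp]) (by simp) (by simp)
  -- The same argument at the opposite corner identifies the second open path.
  have hd := class_of_four_fixed p q hpp hqq sgn hs0 hps hqs (false, b.partner l) (true, b.partner l)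
    (false, l) (true, l) (fun x => (innerStrand_fixed hK hl x).trans (by tauto))
    (by simp [sgn]) (by simp [sgn, hsp])
    (by simp [sgn, hsp]) (by simp) (by simp)
  change C _ ≠ C _ ∧ ((C _ = C _ ∧ C _ ≠ C _) ∨ (C _ ≠ C _ ∧ C _ = C _)) at ha hd
  obtain ⟨had, ⟨hba, hca⟩ | ⟨hba, hca⟩⟩ := ha
  · -- merge
    have hcd : C (false, l) = C (false, b.partner l) := by
      rcases hd.2 with h | h
      · exact absurd (h.1.symm.trans hba).symm had
      · exact h.2
    have KC' : ∀ x y, Strand c b a K x y → C x = C y := by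
      intro x y h
      rcases KC x y h with h | ⟨_ | _, ⟨rfl, rfl⟩ | ⟨rfl, rfl⟩⟩
      exacts [h, hcd, hcd.symm, hba.symm, hba]
    right
    refine ⟨fun h => hca (quot_eq_of_rel C KC' h).symm, liftK' _ _ hba.symm, ?_⟩
    have e1 : Nat.card (Quot r0) = Nat.card (StateCircle c b a K) := by
      refine Nat.card_eq_of_bijective gK ⟨?_, gKs⟩
      rintro ⟨x⟩ ⟨y⟩ h
      exact quot_eq_of_rel C KC' h
    rw [← e1]
    refine card_eq_add_one_of_pair_fiber gK' gK's (C (true, l)) (C (false, l)) hca.symm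
      (vert true l hlK') ?_
    rintro ⟨x⟩ ⟨y⟩ h
    refine quot_eq_or_pair C _ _ ?_ h
    intro x y h
    rcases K'C x y h with h | ⟨rfl, rfl⟩ | ⟨rfl, rfl⟩
    · exact Or.inl h
    · exact Or.inr ⟨Or.inl rfl, Or.inr rfl⟩
    · exact Or.inr ⟨Or.inl hba, Or.inr hcd.symm⟩
  · -- split
    have hbd : C (true, b.partner l) = C (false, b.partner l) := by
      rcases hd.2 with h | h
      · exact h.1
      · exact absurd (hca.symm.trans h.2) had
    have K'C' : ∀ x y, Strand c b a K' x y → C x = C y := by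
      intro x y h
      rcases K'C x y h with h | ⟨rfl, rfl⟩ | ⟨rfl, rfl⟩
      exacts [h, hca.symm, hbd]
    left
    refine ⟨liftK _ _ hca.symm, fun h => hba (quot_eq_of_rel C K'C' h).symm, ?_⟩
    have e1 : Nat.card (Quot r0) = Nat.card (StateCircle c b a K') := by
      refine Nat.card_eq_of_bijective gK' ⟨?_, gK's⟩
      rintro ⟨x⟩ ⟨y⟩ h
      exact quot_eq_of_rel C K'C' h
    rw [← e1]
    refine card_eq_add_one_of_pair_fiber gK gKs (C (true, l)) (C (true, b.partner l))
      (Ne.symm hba) (Quot.sound (Strand.upper l hl)) ?_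
    rintro ⟨x⟩ ⟨y⟩ h
    refine quot_eq_or_pair C _ _ ?_ h
    intro x y h
    rcases KC x y h with h | ⟨_ | _, ⟨rfl, rfl⟩ | ⟨rfl, rfl⟩⟩
    · exact Or.inl h
    · exact Or.inr ⟨Or.inl hca, Or.inr hbd.symm⟩
    · exact Or.inr ⟨Or.inr hbd.symm, Or.inl hca⟩
    · exact Or.inr ⟨Or.inl rfl, Or.inr rfl⟩
    · exact Or.inr ⟨Or.inr rfl, Or.inl rfl⟩

end Saddle

end OddArc

namespace OddArc

/-! ### Exterior algebras -/

section Exterior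

open ExteriorAlgebra

variable {V U : Type*} [AddCommGroup V] [AddCommGroup U]

/-- The product of a list of vectors in the exterior algebra. -/
def wedge (L : List V) : ExteriorAlgebra ℤ V := (L.map (ι ℤ)).prod

@[simp] theorem wedge_nil : wedge ([] : List V) = 1 := rfl

@[simp] theorem wedge_cons (v : V) (L : List V) : wedge (v :: L) = ι ℤ v * wedge L := by
  simp [wedge]

theorem wedge_eq_ιMulti (L : List V) : wedge L = ιMulti ℤ L.length L.get := by
  rw [ιMulti_apply, wedge]
  congr 1
  conv_lhs => rw [← List.ofFn_get L, List.map_ofFn]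
  rfl

theorem ι_mul_wedge_eq_zero {v : V} {L : List V} (h : v ∈ L) : ι ℤ v * wedge L = 0 := by
  obtain ⟨i, rfl⟩ := List.get_of_mem h
  rw [wedge_eq_ιMulti, ιMulti_apply]
  exact ι_mul_prod_list _ i

theorem wedge_mul_ι (v : V) (L : List V) :
    wedge L * ι ℤ v = (-1) ^ L.length * (ι ℤ v * wedge L) := by
  induction L with
  | nil => simp
  | cons w L ih =>
    rw [wedge_cons, mul_assoc, ih, List.length_cons, pow_succ]
    have h1 : ι ℤ w * ι ℤ v = - (ι ℤ v * ι ℤ w) := eq_neg_of_add_eq_zero_left (ι_add_mul_swap w v)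
    have h2 : ∀ k : ℕ, ι ℤ w * (-1) ^ k = (-1) ^ k * ι ℤ w := fun k =>
      ((Commute.neg_one_right (ι ℤ w)).pow_right k).eq
    rw [← mul_assoc (ι ℤ w), h2, mul_assoc, ← mul_assoc (ι ℤ w), h1]
    simp [mul_assoc]

/-- An exterior product of vectors kills their span. -/
theorem wedge_mul_ι_of_mem_span {v : V} {L : List V} (h : v ∈ Submodule.span ℤ {w | w ∈ L}) :
    wedge L * ι ℤ v = 0 := by
  induction h using Submodule.span_induction with
  | mem w hw => rw [wedge_mul_ι, ι_mul_wedge_eq_zero hw, mul_zero]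
  | zero => simp
  | add x y _ _ hx hy => rw [map_add, mul_add, hx, hy, add_zero]
  | smul r x _ hx => rw [map_smul, mul_smul_comm, hx, smul_zero]

/-- The induction over `z` has to carry the second claim along: after multiplication by `map g x`
the element still kills `W`, because vectors anticommute, and it can then play the role of `Ω` for
the next factor. -/
theorem mul_map_eq_of_kills (W : Set V) (f g : U →ₗ[ℤ] V) (hfg : ∀ u, f u - g u ∈ W)
    (z : ExteriorAlgebra ℤ U) : ∀ Ω : ExteriorAlgebra ℤ V, (∀ w ∈ W, Ω * ι ℤ w = 0) →
      Ω * map f z = Ω * map g z ∧ ∀ w ∈ W, Ω * map g z * ι ℤ w = 0 := by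
  induction z using ExteriorAlgebra.induction with
  | algebraMap r =>
    intro Ω h
    refine ⟨by simp, fun w hw => ?_⟩
    rw [AlgHom.commutes, ← Algebra.commutes, mul_assoc, h w hw, mul_zero]
  | ι u =>
    intro Ω h
    rw [map_apply_ι, map_apply_ι]
    refine ⟨?_, fun w hw => ?_⟩
    · rw [← sub_eq_zero, ← mul_sub, ← map_sub, h _ (hfg u)]
    · rw [mul_assoc, eq_neg_of_add_eq_zero_left (ι_add_mul_swap (g u) w), mul_neg, ← mul_assoc,
        h w hw, zero_mul, neg_zero]
  | mul x y hx hy =>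
    intro Ω h
    rw [map_mul, map_mul, ← mul_assoc, ← mul_assoc, (hx Ω h).1]
    exact hy _ (hx Ω h).2
  | add x y hx hy =>
    intro Ω h
    refine ⟨by rw [map_add, map_add, mul_add, mul_add, (hx Ω h).1, (hy Ω h).1], fun w hw => ?_⟩
    rw [map_add, mul_add, add_mul, (hx Ω h).2 w hw, (hy Ω h).2 w hw, add_zero]

/-- An exterior product that kills the differences of two linear maps does not distinguish the
induced maps of exterior algebras. -/
theorem mul_map_congr {Ω : ExteriorAlgebra ℤ V} {W : Set V} (h : ∀ w ∈ W, Ω * ι ℤ w = 0)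
    {f g : U →ₗ[ℤ] V} (hfg : ∀ u, f u - g u ∈ W) (z : ExteriorAlgebra ℤ U) :
    Ω * map f z = Ω * map g z :=
  (mul_map_eq_of_kills W f g hfg z Ω h).1

/-- Both sides are alternating in the rows of `M`, so it suffices to compare them on the standard
basis. -/
theorem ιMulti_sum_smul {s : ℕ} (M : Matrix (Fin s) (Fin s) ℤ) (w : Fin s → V) :
    ιMulti ℤ s (fun i => ∑ j, M i j • w j) = M.det • ιMulti ℤ s w := by
  let f : (Fin s → ℤ) [⋀^Fin s]→ₗ[ℤ] ExteriorAlgebra ℤ V :=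
    (ιMulti ℤ s).compLinearMap (Fintype.linearCombination ℤ w)
  let g : (Fin s → ℤ) [⋀^Fin s]→ₗ[ℤ] ExteriorAlgebra ℤ V :=
    (LinearMap.toSpanSingleton ℤ _ (ιMulti ℤ s w)).compAlternatingMap Matrix.detRowAlternating
  have hfg : f = g := by
    refine Module.Basis.ext_alternating (Pi.basisFun ℤ (Fin s)) fun i h => ?_
    let σ : Equiv.Perm (Fin s) := Equiv.ofBijective i (Finite.injective_iff_bijective.1 h)
    change f (Pi.basisFun ℤ (Fin s) ∘ σ) = g (Pi.basisFun ℤ (Fin s) ∘ σ)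
    rw [AlternatingMap.map_perm, AlternatingMap.map_perm]
    congr 1
    have e1 : f (Pi.basisFun ℤ (Fin s)) = ιMulti ℤ s w := by
      simp [f, Fintype.linearCombination_apply, AlternatingMap.compLinearMap_apply]
    have e2 : Matrix.detRowAlternating (Pi.basisFun ℤ (Fin s)) = (1 : ℤ) := by
      have : (Pi.basisFun ℤ (Fin s) : Fin s → Fin s → ℤ) = (1 : Matrix (Fin s) (Fin s) ℤ) := by
        ext i j; simp [Matrix.one_apply, Pi.single_apply, eq_comm]
      rw [this]
      exact Matrix.det_one
    rw [e1]
    simp [g, e2]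
  exact congrArg (fun h => h M) hfg

/-- Exterior products of equally many vectors with the same span agree up to sign. -/
theorem ιMulti_eq_or_eq_neg [Module.IsTorsionFree ℤ (ExteriorAlgebra ℤ V)] {s : ℕ} (v w : Fin s → V)
    (h : Submodule.span ℤ (Set.range v) = Submodule.span ℤ (Set.range w)) :
    ιMulti ℤ s v = ιMulti ℤ s w ∨ ιMulti ℤ s v = - ιMulti ℤ s w := by
  have key : ∀ v w : Fin s → V, Submodule.span ℤ (Set.range v) ≤ Submodule.span ℤ (Set.range w) →
      ∃ d : ℤ, ιMulti ℤ s v = d • ιMulti ℤ s w := by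
    intro v w h
    have : ∀ i, ∃ c : Fin s → ℤ, ∑ j, c j • w j = v i := fun i =>
      (Submodule.mem_span_range_iff_exists_fun ℤ).1 (h (Submodule.subset_span ⟨i, rfl⟩))
    choose M hM using this
    refine ⟨Matrix.det (Matrix.of M), ?_⟩
    rw [← ιMulti_sum_smul]
    congr 1
    ext i
    exact (hM i).symm
  obtain ⟨d, hd⟩ := key v w h.le
  obtain ⟨e, he⟩ := key w v h.ge
  by_cases h0 : ιMulti ℤ s v = 0
  · rw [he, h0]; simp
  -- The determinants of the two changes of generators multiply to 1 on a nonzero element of a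
  -- torsion-free module. They are integers, hence both are 1 or both are -1.
  have : (d * e - 1) • ιMulti ℤ s v = 0 := by
    rw [sub_smul, one_smul, mul_smul, ← he, ← hd, sub_self]
  rw [smul_eq_zero, or_iff_left h0, sub_eq_zero] at this
  rcases Int.eq_one_or_neg_one_of_mul_eq_one this with rfl | rfl
  · left; simpa using hd
  · right; simpa using hd

/-- Freeness supplies the torsion-freeness used to turn proportional products into products equal up
to sign, and later to compare powers of i. -/
instance (S : Type) [Finite S] : Module.Free ℤ (OF S) := by
  classical
  have := Fintype.ofFinite S
  let := (Fintype.equivFin S).linearOrder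
  exact Module.Free.of_basis (Finsupp.basisSingleOne (R := ℤ) (ι := S)).ExteriorAlgebra

/-- Linearly independent vectors of a free abelian group have a nonzero exterior product. -/
theorem ιMulti_ne_zero {S : Type} {s : ℕ} (v : Fin s → (S →₀ ℤ)) (hv : LinearIndependent ℤ v) :
    ιMulti ℤ s v ≠ 0 := by
  let cast : (S →₀ ℤ) →ₗ[ℤ] (S →₀ ℚ) := Finsupp.mapRange.linearMap (Algebra.linearMap ℤ ℚ)
  have hcast : LinearMap.ker cast = ⊥ := LinearMap.ker_eq_bot.2
    (Finsupp.mapRange_injective _ (map_zero _) (Int.cast_injective (α := ℚ)))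
  have h1 : LinearIndependent ℚ (cast ∘ v) :=
    (LinearIndependent.iff_fractionRing ℤ ℚ).1 (hv.map' cast hcast)
  obtain ⟨g, hg⟩ := LinearMap.exists_leftInverse_of_injective
    (Fintype.linearCombination ℚ (cast ∘ v))
    (LinearMap.ker_eq_bot.2 (linearIndependent_iff_injective_fintypeLinearCombination.1 h1))
  let F : (S →₀ ℤ) [⋀^Fin s]→ₗ[ℤ] ℚ :=
    AlternatingMap.compLinearMap
      { (Matrix.detRowAlternating (R := ℚ) (n := Fin s)).toMultilinearMap.restrictScalars ℤ with
        map_eq_zero_of_eq' := (Matrix.detRowAlternating (R := ℚ) (n := Fin s)).map_eq_zero_of_eq' }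
      (g.restrictScalars ℤ ∘ₗ cast)
  have hF : F v = 1 := by
    have e : ∀ i, g (cast (v i)) = Pi.single i 1 := by
      intro i
      have := congrArg (fun h => h (Pi.single i 1)) hg
      simpa [Fintype.linearCombination_apply_single] using this
    have : (fun i => g (cast (v i))) = (1 : Matrix (Fin s) (Fin s) ℚ) := by
      ext i j; rw [e]; simp [Matrix.one_apply, Pi.single_apply, eq_comm]
    change Matrix.det (fun i => g (cast (v i))) = 1
    rw [this, Matrix.det_one]
  intro h0
  have : exteriorPower.alternatingMapLinearEquiv F (exteriorPower.ιMulti ℤ s v) = F v :=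
    exteriorPower.alternatingMapLinearEquiv_apply_ιMulti _ _
  have h0' : exteriorPower.ιMulti ℤ s v = 0 := Subtype.ext h0
  rw [h0', map_zero, hF] at this
  exact zero_ne_one this

theorem ιMulti_ne_zero_iff {S : Type} [Finite S] {s : ℕ} (v : Fin s → (S →₀ ℤ)) :
    ιMulti ℤ s v ≠ 0 ↔ LinearIndependent ℤ v := by
  refine ⟨fun h => ?_, ιMulti_ne_zero v⟩
  by_contra h'
  exact h (AlternatingMap.map_linearDependent _ v h')

end Exterior

/-! ### Renaming circles -/

section Rename

variable {S T T' : Type}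

theorem OF.rename_ι (f : S → T) (v : S →₀ ℤ) :
    OF.rename f (ExteriorAlgebra.ι ℤ v) = ExteriorAlgebra.ι ℤ (Finsupp.mapDomain f v) :=
  ExteriorAlgebra.map_apply_ι _ _

theorem OF.rename_rename (f : S → T) (g : T → T') (x : OF S) :
    OF.rename g (OF.rename f x) = OF.rename (g ∘ f) x := by
  rw [OF.rename, OF.rename, OF.rename, ← AlgHom.comp_apply, ExteriorAlgebra.map_comp_map,
    ← Finsupp.lmapDomain_comp]

theorem OF.rename_surjective {f : S → T} (hf : Function.Surjective f) :
    Function.Surjective (OF.rename f) :=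
  ExteriorAlgebra.map_surjective_iff.2 (Finsupp.mapDomain_surjective hf)

end Rename

end OddArc

/-! ### The multiplication as left multiplication by one product of arc vectors -/

namespace OddArc

variable {n : ℕ}

theorem wedge_append {V : Type*} [AddCommGroup V] (L L' : List V) :
    wedge (L ++ L') = wedge L * wedge L' := by
  simp [wedge]

theorem OF.rename_wedge {S T : Type} (f : S → T) (L : List (S →₀ ℤ)) :
    OF.rename f (wedge L) = wedge (L.map (Finsupp.mapDomain f)) := by
  induction L with
  | nil => simp
  | cons v L ih => rw [wedge_cons, map_mul, OF.rename_ι, ih, List.map_cons, wedge_cons]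

theorem OF.rename_id {S : Type} (x : OF S) : OF.rename id x = x := by
  have : OF.rename (id : S → S) = AlgHom.id ℤ _ := by
    unfold OF.rename
    rw [Finsupp.lmapDomain_id, ExteriorAlgebra.map_id]
  rw [this, AlgHom.id_apply]

/-- The quotient map from points to the circles of `W(b)a`. -/
def toCircle (b a : Matching n) (i : Fin (2 * n)) : Circle b a := Quot.mk _ i

theorem toCircle_surjective (b a : Matching n) : Function.Surjective (toCircle b a) :=
  Quot.mk_surjective

theorem toCircle_upper (b a : Matching n) (i : Fin (2 * n)) :
    toCircle b a (b.partner i) = toCircle b a i :=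
  (Quot.sound (r := fun i j => j = b.partner i ∨ j = a.partner i) (Or.inl rfl)).symm

theorem toCircle_lower (b a : Matching n) (i : Fin (2 * n)) :
    toCircle b a (a.partner i) = toCircle b a i :=
  (Quot.sound (r := fun i j => j = b.partner i ∨ j = a.partner i) (Or.inr rfl)).symm

/-- Renaming points as circles. -/
abbrev renameCircle (b a : Matching n) : OF (Fin (2 * n)) →ₐ[ℤ] OF (Circle b a) :=
  OF.rename (toCircle b a)

theorem renameCircle_surjective (b a : Matching n) : Function.Surjective (renameCircle b a) :=
  OF.rename_surjective (toCircle_surjective b a)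

namespace Chronology

variable {b : Matching n} (γ : Chronology b) (c a : Matching n)

theorem partner_mem_contracted (t : ℕ) {i : Fin (2 * n)} (h : i ∈ γ.contracted t) :
    b.partner i ∈ γ.contracted t := by
  obtain ⟨α, rfl | rfl, h⟩ := h
  · exact ⟨α, Or.inr rfl, h⟩
  · exact ⟨α, Or.inl (b.involutive _), h⟩

theorem arc_ext {α β : b.Arc} (h : α.left = β.left) : α = β := Subtype.ext h

theorem arc_eq_of_mem {α β : b.Arc} (h : α.left = β.left ∨ α.left = β.right) : α = β := by
  rcases h with h | h
  · exact arc_ext h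
  · have h1 : α.1 < b.partner α.1 := α.2
    have h2 : β.1 < b.partner β.1 := β.2
    have h3 : α.1 = b.partner β.1 := h
    rw [h3, b.involutive] at h1
    exact absurd (h1.trans h2) (lt_irrefl _)

theorem left_notMem_contracted (t : Fin n) : (γ.order t).left ∉ γ.contracted t := by
  rintro ⟨α, h, ht⟩
  rw [← arc_eq_of_mem h, Equiv.symm_apply_apply] at ht
  exact lt_irrefl _ ht

theorem mem_contracted_succ (t : Fin n) (i : Fin (2 * n)) :
    i ∈ γ.contracted (t + 1) ↔
      i ∈ γ.contracted t ∨ i = (γ.order t).left ∨ i = b.partner (γ.order t).left := by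
  constructor
  · rintro ⟨α, h, ht⟩
    rcases Nat.lt_succ_iff_lt_or_eq.1 ht with ht | ht
    · exact Or.inl ⟨α, h, ht⟩
    · right
      rw [← Fin.ext ht, Equiv.apply_symm_apply]
      exact h
  · rintro (⟨α, h, ht⟩ | h)
    · exact ⟨α, h, Nat.lt_succ_of_lt ht⟩
    · exact ⟨γ.order t, h, by simp⟩

/-- The circle of the diagram after `t` contractions through a point. -/
abbrev circleMap (t : ℕ) : Bool × Fin (2 * n) → γ.CircleAfter c a t :=
  circleAt c b a (γ.contracted t)

variable {c a} in
theorem circleMap_saddle {t : Fin n} {x y : Bool × Fin (2 * n)}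
    (h : γ.circleMap c a t x = γ.circleMap c a t y) :
    γ.circleMap c a (t + 1) x = γ.circleMap c a (t + 1) y ∨
      ((γ.circleMap c a (t + 1) x = γ.circleMap c a (t + 1) (true, (γ.order t).left) ∨
        γ.circleMap c a (t + 1) x = γ.circleMap c a (t + 1) (true, (γ.order t).right)) ∧
       (γ.circleMap c a (t + 1) y = γ.circleMap c a (t + 1) (true, (γ.order t).left) ∨
        γ.circleMap c a (t + 1) y = γ.circleMap c a (t + 1) (true, (γ.order t).right))) :=
  (saddle_topology _ (fun _ => γ.partner_mem_contracted t) (γ.left_notMem_contracted t)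
    (γ.mem_contracted_succ t)).1 x y h

theorem isSplit_or (t : Fin n) :
    (γ.IsSplit c a t ∧
      γ.circleMap c a (t + 1) (true, (γ.order t).left) ≠
        γ.circleMap c a (t + 1) (true, (γ.order t).right) ∧
      Nat.card (γ.CircleAfter c a (t + 1)) = Nat.card (γ.CircleAfter c a t) + 1) ∨
    (¬ γ.IsSplit c a t ∧
      γ.circleMap c a (t + 1) (true, (γ.order t).left) =
        γ.circleMap c a (t + 1) (true, (γ.order t).right) ∧
      Nat.card (γ.CircleAfter c a t) = Nat.card (γ.CircleAfter c a (t + 1)) + 1) :=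
  (saddle_topology _ (fun _ => γ.partner_mem_contracted t) (γ.left_notMem_contracted t)
    (γ.mem_contracted_succ t)).2

variable {c a} in
theorem circleMap_eq_of_not_isSplit {t : Fin n} (ht : ¬ γ.IsSplit c a t) :
    γ.circleMap c a (t + 1) (true, (γ.order t).left) =
      γ.circleMap c a (t + 1) (true, (γ.order t).right) :=
  ((γ.isSplit_or c a t).resolve_left fun h => ht h.1).2.1

/-- The definition of `pushCircle` uses an arbitrary representative of a circle and singles out one
of the two circles of a split. Both choices matter only up to exchanging the circles at the two ends
of the contracted arc. -/
theorem pushCircle_circleMap (t : Fin n) (x : Bool × Fin (2 * n)) :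
    γ.pushCircle c a t (γ.circleMap c a t x) = γ.circleMap c a (t + 1) x ∨
      ((γ.pushCircle c a t (γ.circleMap c a t x) =
          γ.circleMap c a (t + 1) (true, (γ.order t).left) ∨
        γ.pushCircle c a t (γ.circleMap c a t x) =
          γ.circleMap c a (t + 1) (true, (γ.order t).right)) ∧
       (γ.circleMap c a (t + 1) x = γ.circleMap c a (t + 1) (true, (γ.order t).left) ∨
        γ.circleMap c a (t + 1) x = γ.circleMap c a (t + 1) (true, (γ.order t).right))) := by
  have hv : γ.circleMap c a (t + 1) (false, (γ.order t).left) =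
      γ.circleMap c a (t + 1) (true, (γ.order t).left) :=
    (Quot.sound (Strand.vertical _ ((γ.mem_contracted_succ t _).2 (Or.inr (Or.inl rfl))))).symm
  rw [pushCircle]
  split_ifs with h
  · right
    refine ⟨Or.inl rfl, ?_⟩
    rcases h with h | h
    · rcases γ.circleMap_saddle h with h | h
      · exact Or.inl h
      · exact h.1
    · rcases γ.circleMap_saddle h with h | h
      · exact Or.inl (h.trans hv)
      · exact h.1
  · exact γ.circleMap_saddle (Quot.out_eq (γ.circleMap c a t x))

/-- The difference of the end points of an arc, with the sign given by the arrow. -/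
def arcVector (t : Fin n) : Fin (2 * n) →₀ ℤ :=
  if γ.arrow (γ.order t) then
    Finsupp.single (γ.order t).left 1 - Finsupp.single (γ.order t).right 1
  else Finsupp.single (γ.order t).right 1 - Finsupp.single (γ.order t).left 1

theorem mapDomain_arcVector {T : Type} (f : Fin (2 * n) → T) (t : Fin n) :
    Finsupp.mapDomain f (γ.arcVector t) =
      if γ.arrow (γ.order t) then
        Finsupp.single (f (γ.order t).left) 1 - Finsupp.single (f (γ.order t).right) 1
      else Finsupp.single (f (γ.order t).right) 1 - Finsupp.single (f (γ.order t).left) 1 := by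
  have : ∀ x y, Finsupp.mapDomain f (x - y : Fin (2 * n) →₀ ℤ) =
    Finsupp.mapDomain f x - Finsupp.mapDomain f y := map_sub (Finsupp.lmapDomain ℤ ℤ f)
  rw [arcVector]
  split_ifs <;> simp [this]

open Classical in
/-- The list of `t` alone if `t` is a split, and the empty list otherwise. -/
def splitTime (t : ℕ) : List (Fin n) :=
  if h : ∃ ht : t < n, γ.IsSplit c a ⟨t, ht⟩ then [⟨t, h.1⟩] else []

/-- The splits among the saddles `t₀, …, t₀ + k - 1`, later ones first. -/
def splitTimes (t₀ : ℕ) : ℕ → List (Fin n)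
  | 0 => []
  | k + 1 => γ.splitTime c a (t₀ + k) ++ splitTimes t₀ k

theorem mem_splitTime {t : ℕ} {u : Fin n} :
    u ∈ γ.splitTime c a t ↔ (u : ℕ) = t ∧ γ.IsSplit c a u := by
  rw [splitTime]
  split_ifs with h
  · obtain ⟨ht, h⟩ := h
    rw [List.mem_singleton]
    constructor
    · rintro rfl; exact ⟨rfl, h⟩
    · rintro ⟨rfl, _⟩; rfl
  · simp only [List.not_mem_nil, false_iff]
    rintro ⟨rfl, h'⟩
    exact h ⟨u.2, h'⟩

theorem mem_splitTimes {t₀ k : ℕ} {u : Fin n} :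
    u ∈ γ.splitTimes c a t₀ k ↔ t₀ ≤ u ∧ (u : ℕ) < t₀ + k ∧ γ.IsSplit c a u := by
  induction k with
  | zero => simp [splitTimes]; intros; omega
  | succ k ih =>
    rw [splitTimes, List.mem_append, mem_splitTime, ih]
    constructor
    · rintro (⟨h, h'⟩ | ⟨h, h', h''⟩)
      · exact ⟨by omega, by omega, h'⟩
      · exact ⟨h, by omega, h''⟩
    · rintro ⟨h, h', h''⟩
      by_cases hu : (u : ℕ) = t₀ + k
      · exact Or.inl ⟨hu, h''⟩
      · exact Or.inr ⟨h, by omega, h''⟩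

theorem splitTimes_succ_left (t₀ k : ℕ) :
    γ.splitTimes c a t₀ (k + 1) = γ.splitTimes c a (t₀ + 1) k ++ γ.splitTime c a t₀ := by
  induction k with
  | zero => simp [splitTimes]
  | succ k ih =>
    rw [splitTimes, ih, splitTimes, List.append_assoc]
    congr 2
    omega

/-- The number of splits. -/
def numSplits : ℕ := (γ.splitTimes c a 0 n).length

/-- The product of the arc vectors of the splits. -/
def omega : OF (Fin (2 * n)) := wedge ((γ.splitTimes c a 0 n).map γ.arcVector)

/-- Lifted to points, a saddle forgets circles altogether: a merge does nothing and a split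
multiplies from the left by the vector of its arc, read on the upper line. The arbitrary choices in
`pushCircle` disappear, since that vector squares to zero at a split and is itself zero at a merge.
-/
theorem saddle_rename (t : Fin n) (z : OF (Bool × Fin (2 * n))) :
    γ.saddle c a t (OF.rename (γ.circleMap c a t) z) =
      OF.rename (γ.circleMap c a (t + 1))
        (wedge ((γ.splitTime c a t).map fun u => Finsupp.mapDomain (Prod.mk true) (γ.arcVector u))
          * z) := by
  set v : γ.CircleAfter c a (t + 1) →₀ ℤ :=
    Finsupp.mapDomain (γ.circleMap c a (t + 1) ∘ Prod.mk true) (γ.arcVector t) with hv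
  have hv' := γ.mapDomain_arcVector (γ.circleMap c a (t + 1) ∘ Prod.mk true) t
  simp only [Function.comp_apply] at hv'
  rw [← hv] at hv'
  -- Pushing circles and following points agree modulo `v`.
  have hW : ∀ u, Finsupp.lmapDomain ℤ ℤ (γ.pushCircle c a t ∘ γ.circleMap c a t) u -
      Finsupp.lmapDomain ℤ ℤ (γ.circleMap c a (t + 1)) u ∈ Submodule.span ℤ {v} := by
    intro u
    induction u using Finsupp.induction_linear with
    | zero => simp
    | add x y hx hy =>
      rw [map_add, map_add, add_sub_add_comm]
      exact add_mem hx hy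
    | single x r =>
      have hlr : ∀ e : ℤ, Finsupp.single (γ.circleMap c a (t + 1) (true, (γ.order t).left)) e -
          Finsupp.single (γ.circleMap c a (t + 1) (true, (γ.order t).right)) e ∈
            Submodule.span ℤ {v} := by
        intro e
        rw [Submodule.mem_span_singleton]
        refine ⟨if γ.arrow (γ.order t) then e else -e, ?_⟩
        rw [hv']
        split_ifs <;> simp [smul_sub, neg_add_eq_sub]
      have hrl := fun e => neg_mem (hlr e)
      simp only [neg_sub] at hrl
      simp only [Finsupp.lmapDomain_apply, Finsupp.mapDomain_single, Function.comp_apply]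
      rcases γ.pushCircle_circleMap c a t x with h | ⟨h1 | h1, h2 | h2⟩
      · rw [h, sub_self]; exact zero_mem _
      · rw [h1, h2, sub_self]; exact zero_mem _
      · rw [h1, h2]; exact hlr r
      · rw [h1, h2]; exact hrl r
      · rw [h1, h2, sub_self]; exact zero_mem _
  have hcomp : OF.rename (γ.pushCircle c a t) (OF.rename (γ.circleMap c a t) z) =
      ExteriorAlgebra.map (Finsupp.lmapDomain ℤ ℤ (γ.pushCircle c a t ∘ γ.circleMap c a t)) z :=
    OF.rename_rename _ _ _
  by_cases ht : γ.IsSplit c a t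
  · have hsplit : γ.splitElement c a t = ExteriorAlgebra.ι ℤ v := by
      rw [splitElement, hv']
      simp only [OF.gen]
      split_ifs <;> rw [map_sub]
    have htime : γ.splitTime c a t = [t] := dif_pos ⟨t.2, ht⟩
    rw [saddle, if_pos ht, htime, LinearMap.comp_apply, LinearMap.mulLeft_apply,
      AlgHom.toLinearMap_apply, hsplit, hcomp,
      mul_map_congr (W := Submodule.span ℤ {v}) ?_ hW, List.map_singleton, wedge_cons, wedge_nil,
      mul_one, map_mul, OF.rename_ι, ← Finsupp.mapDomain_comp]
    · rfl
    · intro w hw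
      obtain ⟨r, rfl⟩ := Submodule.mem_span_singleton.1 hw
      rw [map_smul, mul_smul_comm, ExteriorAlgebra.ι_sq_zero, smul_zero]
  · have htime : γ.splitTime c a t = [] := dif_neg fun h => ht h.2
    have hv0 : v = 0 := by
      rw [hv', γ.circleMap_eq_of_not_isSplit ht]
      simp
    rw [hv0, Submodule.span_zero_singleton] at hW
    rw [saddle, if_neg ht, htime, AlgHom.toLinearMap_apply, hcomp, List.map_nil, wedge_nil, one_mul,
      OF.rename]
    congr 2
    ext1 x
    ext1
    have := sub_eq_zero.1 ((Submodule.mem_bot ℤ).1 (hW (Finsupp.single x 1)))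
    simpa using this

theorem saddles_rename (t : ℕ) (ht : t ≤ n) (z : OF (Bool × Fin (2 * n))) :
    γ.saddles c a t ht (OF.rename (γ.circleMap c a 0) z) =
      OF.rename (γ.circleMap c a t) (wedge ((γ.splitTimes c a 0 t).map fun u =>
        Finsupp.mapDomain (Prod.mk true) (γ.arcVector u)) * z) := by
  induction t with
  | zero => simp [saddles, splitTimes]
  | succ t ih =>
    rw [saddles, LinearMap.comp_apply, ih (Nat.le_of_succ_le ht), splitTimes, Nat.zero_add,
      List.map_append, wedge_append, mul_assoc]
    exact γ.saddle_rename c a ⟨t, ht⟩ _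

/-- The multiplication map in terms of points. -/
theorem mulMap_renameCircle (x y : OF (Fin (2 * n))) :
    γ.mulMap c a (renameCircle c b x) (renameCircle b a y) =
      renameCircle c a (γ.omega c a * x * y) := by
  have hU : γ.inclUpper c a ∘ toCircle c b = γ.circleMap c a 0 ∘ Prod.mk true := rfl
  have hL : γ.inclLower c a ∘ toCircle b a = γ.circleMap c a 0 ∘ Prod.mk false := rfl
  have hS : γ.shrink c a ∘ γ.circleMap c a n = toCircle c a ∘ Prod.snd := rfl
  have h1 : OF.rename Prod.snd (OF.rename (Prod.mk true) x) = x := by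
    rw [OF.rename_rename]
    exact OF.rename_id _
  have h2 : OF.rename Prod.snd (OF.rename (Prod.mk false) y) = y := by
    rw [OF.rename_rename]
    exact OF.rename_id _
  rw [mulMap, LinearMap.compr₂_apply, LinearMap.compl₁₂_apply, LinearMap.mul_apply',
    AlgHom.toLinearMap_apply, AlgHom.toLinearMap_apply, OF.rename_rename, OF.rename_rename, hU, hL,
    ← OF.rename_rename, ← OF.rename_rename, ← map_mul, LinearMap.comp_apply, saddles_rename,
    AlgHom.toLinearMap_apply, OF.rename_rename, hS, ← OF.rename_rename, map_mul, map_mul, map_mul, h1, h2,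
    OF.rename_wedge, List.map_map, omega, map_mul, map_mul, map_mul, mul_assoc]
  congr 3
  refine List.map_congr_left fun u _ => ?_
  rw [Function.comp_apply, ← Finsupp.mapDomain_comp]
  exact Finsupp.mapDomain_id

end Chronology

end OddArc

namespace OddArc

variable {n : ℕ}

instance (b a : Matching n) : Fintype (Circle b a) := Fintype.ofFinite _

namespace Chronology

variable {b : Matching n} (γ : Chronology b) (c a : Matching n)

/-! ### The number of splits -/

/-- A split adds a circle and a merge removes one, so after adding the elapsed time only the splits
contribute, by two each. -/
theorem card_circleAfter (t : ℕ) (ht : t ≤ n) :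
    Nat.card (γ.CircleAfter c a t) + t =
      Nat.card (γ.CircleAfter c a 0) + 2 * (γ.splitTimes c a 0 t).length := by
  induction t with
  | zero => simp [splitTimes]
  | succ t ih =>
    have ih := ih (Nat.le_of_succ_le ht)
    rw [splitTimes, List.length_append, Nat.zero_add]
    rcases γ.isSplit_or c a ⟨t, ht⟩ with ⟨h, _, h'⟩ | ⟨h, _, h'⟩
    · have : γ.splitTime c a t = [⟨t, ht⟩] := dif_pos ⟨ht, h⟩
      rw [this, List.length_singleton]
      simp only at h'
      omega
    · have : γ.splitTime c a t = [] := dif_neg fun h' => h h'.2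
      rw [this, List.length_nil]
      simp only at h'
      omega

theorem shrink_bijective : Function.Bijective (γ.shrink c a) := by
  constructor
  · rintro ⟨x⟩ ⟨y⟩ h
    have hv : ∀ s i, γ.circleMap c a n (s, i) = γ.circleMap c a n (true, i) := by
      rintro (_ | _) i
      · exact (Quot.sound (Strand.vertical i (γ.mem_contracted_last i))).symm
      · rfl
    have : γ.circleMap c a n (true, x.2) = γ.circleMap c a n (true, y.2) := by
      refine quot_eq_of_rel (fun i => γ.circleMap c a n (true, i)) ?_ h
      rintro i j (rfl | rfl)
      · exact Quot.sound (Strand.top i)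
      · exact (hv false i).symm.trans ((Quot.sound (Strand.bottom i)).trans (hv false _))
    exact (hv x.1 x.2).trans (this.trans (hv y.1 y.2).symm)
  · rintro ⟨i⟩
    exact ⟨γ.circleMap c a n (true, i), rfl⟩

theorem incl_bijective :
    Function.Bijective (Sum.elim (γ.inclUpper c a) (γ.inclLower c a)) := by
  let f : Bool × Fin (2 * n) → Circle c b ⊕ Circle b a := fun x =>
    if x.1 then Sum.inl (toCircle c b x.2) else Sum.inr (toCircle b a x.2)
  let g : γ.CircleAfter c a 0 → Circle c b ⊕ Circle b a := Quot.lift f (by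
    intro x y h
    cases h with
    | top i => simp [f, toCircle_upper]
    | upper i h => simp [f, toCircle_lower]
    | lower i h => simp [f, toCircle_upper]
    | bottom i => simp [f, toCircle_lower]
    | vertical i h => simp [contracted_zero] at h)
  refine Function.bijective_iff_has_inverse.2 ⟨g, ?_, ?_⟩
  · rintro (i | i) <;> obtain ⟨i⟩ := i <;> rfl
  · rintro ⟨_ | _, i⟩ <;> rfl

/-- The Euler characteristic count. The number of splits depends on the three matchings only, and
the number of circles changes parity with each saddle. -/
theorem numSplits_spec :
    n + numCircles c a = numCircles c b + numCircles b a + 2 * γ.numSplits c a := by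
  have h := γ.card_circleAfter c a n le_rfl
  rw [Nat.card_eq_of_bijective _ (γ.shrink_bijective c a),
    ← Nat.card_eq_of_bijective _ (γ.incl_bijective c a), Nat.card_sum] at h
  rw [numSplits, numCircles, numCircles, numCircles]
  omega

/-! ### The span of the arc vectors -/

/-- At a merge both ends of the arc lie on one circle, so its vector is zero; at a split it belongs
to the list. Earlier vectors are carried along by `pushCircle`, which agrees with following points
modulo the vector of the current arc, and this ambiguity stays in the span. The starting time `t₀`
is kept free because the eigenvalue of the rescaling requires the arcs that come after a given one.
-/
theorem mapDomain_mk_arcVector_mem_span (t₀ k : ℕ) (hk : t₀ + k ≤ n) (u : Fin n) (hu : t₀ ≤ u)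
    (hu' : (u : ℕ) < t₀ + k) :
    Finsupp.mapDomain (γ.circleMap c a (t₀ + k) ∘ Prod.mk true) (γ.arcVector u) ∈
      Submodule.span ℤ {w | w ∈ (γ.splitTimes c a t₀ k).map fun v =>
        Finsupp.mapDomain (γ.circleMap c a (t₀ + k) ∘ Prod.mk true) (γ.arcVector v)} := by
  induction k with
  | zero => omega
  | succ k ih =>
    set t : Fin n := ⟨t₀ + k, hk⟩ with ht
    set D := Submodule.span ℤ {w | w ∈ (γ.splitTimes c a t₀ (k + 1)).map fun v =>
        Finsupp.mapDomain (γ.circleMap c a (t₀ + (k + 1)) ∘ Prod.mk true) (γ.arcVector v)} with hD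
    have hmem : ∀ v ∈ γ.splitTimes c a t₀ (k + 1),
        Finsupp.mapDomain (γ.circleMap c a (t₀ + (k + 1)) ∘ Prod.mk true) (γ.arcVector v) ∈ D :=
      fun v hv => Submodule.subset_span (List.mem_map.2 ⟨v, hv, rfl⟩)
    have htD : Finsupp.mapDomain (γ.circleMap c a (t₀ + (k + 1)) ∘ Prod.mk true)
        (γ.arcVector t) ∈ D := by
      by_cases hs : γ.IsSplit c a t
      · exact hmem t ((γ.mem_splitTimes c a).2 ⟨by simp [ht], by simp [ht], hs⟩)
      · have := γ.circleMap_eq_of_not_isSplit hs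
        change γ.circleMap c a (t₀ + (k + 1)) _ = γ.circleMap c a (t₀ + (k + 1)) _ at this
        rw [mapDomain_arcVector, Function.comp_apply, Function.comp_apply, this]
        simp
    have hlr : ∀ e : ℤ,
        Finsupp.single (γ.circleMap c a (t₀ + (k + 1)) (true, (γ.order t).left)) e -
        Finsupp.single (γ.circleMap c a (t₀ + (k + 1)) (true, (γ.order t).right)) e ∈ D := by
      intro e
      rw [mapDomain_arcVector] at htD
      have := D.smul_mem (if γ.arrow (γ.order t) then e else -e) htD
      split_ifs at this <;> simpa [smul_sub, neg_add_eq_sub] using this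
    have hrl := fun e => neg_mem (hlr e)
    simp only [neg_sub] at hrl
    have hpush : ∀ w : Bool × Fin (2 * n) →₀ ℤ,
        Finsupp.mapDomain (γ.circleMap c a (t₀ + (k + 1))) w -
        Finsupp.mapDomain (γ.pushCircle c a t) (Finsupp.mapDomain (γ.circleMap c a t) w) ∈ D := by
      intro w
      induction w using Finsupp.induction_linear with
      | zero => simp
      | add x y hx hy =>
        rw [Finsupp.mapDomain_add, Finsupp.mapDomain_add, Finsupp.mapDomain_add, add_sub_add_comm]
        exact add_mem hx hy
      | single x r =>
        rw [Finsupp.mapDomain_single, Finsupp.mapDomain_single, Finsupp.mapDomain_single]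
        have := γ.pushCircle_circleMap c a t x
        change _ = γ.circleMap c a (t₀ + (k + 1)) _ ∨
          (_ = γ.circleMap c a (t₀ + (k + 1)) _ ∨ _ = γ.circleMap c a (t₀ + (k + 1)) _) ∧
          (γ.circleMap c a (t₀ + (k + 1)) _ = γ.circleMap c a (t₀ + (k + 1)) _ ∨
            γ.circleMap c a (t₀ + (k + 1)) _ = γ.circleMap c a (t₀ + (k + 1)) _) at this
        rcases this with h | ⟨h1 | h1, h2 | h2⟩
        · rw [h]
          convert zero_mem D
          exact sub_self _
        · rw [h1, h2]
          convert zero_mem D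
          exact sub_self _
        · rw [h1, h2]; exact hrl r
        · rw [h1, h2]; exact hlr r
        · rw [h1, h2]
          convert zero_mem D
          exact sub_self _
    have hpush' : ∀ w : Fin (2 * n) →₀ ℤ,
        Finsupp.mapDomain (γ.circleMap c a (t₀ + (k + 1)) ∘ Prod.mk true) w -
        Finsupp.mapDomain (γ.pushCircle c a t)
          (Finsupp.mapDomain (γ.circleMap c a (t₀ + k) ∘ Prod.mk true) w) ∈ D := by
      intro w
      rw [Finsupp.mapDomain_comp, Finsupp.mapDomain_comp]
      exact hpush _
    rcases Nat.lt_succ_iff_lt_or_eq.1 hu' with hu'' | hu''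
    · have h1 := ih (Nat.le_of_succ_le hk) hu''
      have h2 := Submodule.mem_map_of_mem (f := Finsupp.lmapDomain ℤ ℤ (γ.pushCircle c a t)) h1
      rw [Submodule.map_span] at h2
      have h3 : Submodule.span ℤ ((Finsupp.lmapDomain ℤ ℤ (γ.pushCircle c a t)) ''
          {w | w ∈ (γ.splitTimes c a t₀ k).map fun v =>
            Finsupp.mapDomain (γ.circleMap c a (t₀ + k) ∘ Prod.mk true) (γ.arcVector v)}) ≤ D := by
        rw [Submodule.span_le]
        rintro _ ⟨w, hw, rfl⟩
        obtain ⟨v, hv, rfl⟩ := List.mem_map.1 hw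
        have h4 := hpush' (γ.arcVector v)
        have h5 := sub_mem (hmem v ((γ.mem_splitTimes c a).2 (by
          have := (γ.mem_splitTimes c a).1 hv
          exact ⟨this.1, by omega, this.2.2⟩))) h4
        rw [sub_sub_cancel] at h5
        exact h5
      have h5 := add_mem (hpush' (γ.arcVector u)) (h3 h2)
      rw [Finsupp.lmapDomain_apply, sub_add_cancel] at h5
      exact h5
    · rwa [show u = t from Fin.ext hu'']

theorem mapDomain_arcVector_mem_span (t₀ k : ℕ) (hk : t₀ + k = n) (u : Fin n) (hu : t₀ ≤ u) :
    Finsupp.mapDomain (toCircle c a) (γ.arcVector u) ∈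
      Submodule.span ℤ {w | w ∈ (γ.splitTimes c a t₀ k).map fun v =>
        Finsupp.mapDomain (toCircle c a) (γ.arcVector v)} := by
  have h := γ.mapDomain_mk_arcVector_mem_span c a t₀ k hk.le u hu (by omega)
  rw [hk] at h
  have hS : ∀ w : Fin (2 * n) →₀ ℤ, Finsupp.lmapDomain ℤ ℤ (γ.shrink c a)
      (Finsupp.mapDomain (γ.circleMap c a n ∘ Prod.mk true) w) =
        Finsupp.mapDomain (toCircle c a) w := fun w => by
    rw [Finsupp.lmapDomain_apply, ← Finsupp.mapDomain_comp]
    rfl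
  have h2 := Submodule.mem_map_of_mem (f := Finsupp.lmapDomain ℤ ℤ (γ.shrink c a)) h
  rw [Submodule.map_span, hS] at h2
  refine Submodule.span_mono ?_ h2
  rintro _ ⟨w, hw, rfl⟩
  obtain ⟨v, hv, rfl⟩ := List.mem_map.1 hw
  rw [hS]
  exact List.mem_map.2 ⟨v, hv, rfl⟩

end Chronology

/-- The span of the differences of the end points of the arcs of `b` among the circles of
`W(c)a`. -/
def arcSpan (c b a : Matching n) : Submodule ℤ (Circle c a →₀ ℤ) :=
  Submodule.span ℤ (Set.range fun i => Finsupp.single (toCircle c a i) 1 -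
    Finsupp.single (toCircle c a (b.partner i)) 1)

theorem single_sub_single_partner_mem_arcSpan (c b a : Matching n) (i : Fin (2 * n)) :
    Finsupp.single (toCircle c a i) (1 : ℤ) - Finsupp.single (toCircle c a (b.partner i)) 1 ∈
      arcSpan c b a :=
  Submodule.subset_span ⟨i, rfl⟩

theorem single_sub_single_arcSpan_of_quot_eq (c b a : Matching n) {i j : Fin (2 * n)}
    (h : (Quot.mk (fun i j => j = c.partner i ∨ j = b.partner i ∨ j = a.partner i) i) =
      Quot.mk _ j) :
    Finsupp.single (toCircle c a i) (1 : ℤ) - Finsupp.single (toCircle c a j) 1 ∈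
      arcSpan c b a := by
  refine quot_eq_imp (fun x y : Circle c a =>
    Finsupp.single x (1 : ℤ) - Finsupp.single y 1 ∈ arcSpan c b a) ⟨?_, ?_, ?_⟩ (toCircle c a) ?_ h
  · intro x; simp
  · intro x y h
    rw [← neg_sub]
    exact neg_mem h
  · intro x y z h h'
    rw [← sub_add_sub_cancel]
    exact add_mem h h'
  · rintro i j (rfl | rfl | rfl)
    · simp [toCircle_upper]
    · exact single_sub_single_partner_mem_arcSpan c b a i
    · simp [toCircle_lower]

/-- The components of the union of three matchings. -/
def Comp (c b a : Matching n) : Type :=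
  Quot fun i j : Fin (2 * n) => j = c.partner i ∨ j = b.partner i ∨ j = a.partner i

instance (c b a : Matching n) : Finite (Comp c b a) := Quot.finite _

/-- The number of components of the union of three matchings. -/
def numComps (c b a : Matching n) : ℕ := Nat.card (Comp c b a)

/-- The component of a circle. -/
def circleToComp (c b a : Matching n) : Circle c a → Comp c b a :=
  Quot.lift (Quot.mk _) (by
    rintro i j (h | h)
    · exact Quot.sound (Or.inl h)
    · exact Quot.sound (Or.inr (Or.inr h)))

/-- A section `g` of the map to components moves any vector, modulo the span, to one determined by
its image. As a kernel the span has rank equal to the number of circles minus the number of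
components. -/
theorem arcSpan_eq_ker (c b a : Matching n) :
    arcSpan c b a = LinearMap.ker (Finsupp.lmapDomain ℤ ℤ (circleToComp c b a)) := by
  apply le_antisymm
  · rw [arcSpan, Submodule.span_le]
    rintro _ ⟨i, rfl⟩
    have : circleToComp c b a (toCircle c a i) =
      circleToComp c b a (toCircle c a (b.partner i)) := Quot.sound (Or.inr (Or.inl rfl))
    simp [this, Finsupp.mapDomain_sub]
  · intro v hv
    have hsurj : Function.Surjective (circleToComp c b a) := by
      rintro ⟨i⟩; exact ⟨toCircle c a i, rfl⟩
    obtain ⟨g, hg⟩ := hsurj.hasRightInverse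
    have key : ∀ v : Circle c a →₀ ℤ,
        v - Finsupp.mapDomain g (Finsupp.mapDomain (circleToComp c b a) v) ∈ arcSpan c b a := by
      intro v
      induction v using Finsupp.induction_linear with
      | zero => simp
      | add x y hx hy =>
        rw [Finsupp.mapDomain_add, Finsupp.mapDomain_add, add_sub_add_comm]
        exact add_mem hx hy
      | single x r =>
        rw [Finsupp.mapDomain_single, Finsupp.mapDomain_single]
        obtain ⟨i, rfl⟩ := toCircle_surjective c a x
        obtain ⟨j, hj⟩ := toCircle_surjective c a (g (circleToComp c b a (toCircle c a i)))
        have h : circleToComp c b a (toCircle c a i) = circleToComp c b a (toCircle c a j) := by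
          rw [hj, hg]
        rw [← hj]
        have := (arcSpan c b a).smul_mem r (single_sub_single_arcSpan_of_quot_eq c b a h)
        simpa [smul_sub] using this
    have h := key v
    rw [LinearMap.mem_ker, Finsupp.lmapDomain_apply] at hv
    rwa [hv, Finsupp.mapDomain_zero, sub_zero] at h

theorem finrank_range_add_finrank_ker_int {V W : Type} [AddCommGroup V] [AddCommGroup W]
    [Module.Finite ℤ V] (f : V →ₗ[ℤ] W) : Module.finrank ℤ (LinearMap.range f) +
      Module.finrank ℤ (LinearMap.ker f) = Module.finrank ℤ V := by
  rw [← f.quotKerEquivRange.finrank_eq, Submodule.finrank_quotient_add_finrank]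

theorem finrank_arcSpan (c b a : Matching n) :
    Module.finrank ℤ (arcSpan c b a) + numComps c b a = numCircles c a := by
  have := Fintype.ofFinite (Comp c b a)
  have hsurj : Function.Surjective (Finsupp.lmapDomain ℤ ℤ (circleToComp c b a)) :=
    Finsupp.mapDomain_surjective (by rintro ⟨i⟩; exact ⟨toCircle c a i, rfl⟩)
  have h := finrank_range_add_finrank_ker_int (Finsupp.lmapDomain ℤ ℤ (circleToComp c b a))
  rw [LinearMap.range_eq_top.2 hsurj, finrank_top, Module.finrank_finsupp_self,
    Module.finrank_finsupp_self, ← arcSpan_eq_ker] at h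
  rw [numComps, numCircles, Nat.card_eq_fintype_card, Nat.card_eq_fintype_card]
  omega

/-! ### Exterior products of lists -/

theorem linearIndependent_iff_finrank_span {S : Type} [Finite S] {s : ℕ}
    (v : Fin s → (S →₀ ℤ)) :
    LinearIndependent ℤ v ↔ s ≤ Module.finrank ℤ (Submodule.span ℤ (Set.range v)) := by
  have h := finrank_range_add_finrank_ker_int (Fintype.linearCombination ℤ v)
  rw [Fintype.range_linearCombination, Module.finrank_fin_fun] at h
  rw [linearIndependent_iff_injective_fintypeLinearCombination, ← LinearMap.ker_eq_bot,
    ← Submodule.finrank_eq_zero (R := ℤ)]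
  omega

theorem range_get_eq {V : Type*} (L : List V) : Set.range L.get = {w | w ∈ L} := by
  ext w
  rw [Set.mem_ofPred_eq, List.mem_iff_get, Set.mem_range]

theorem wedge_ne_zero_iff {S : Type} [Finite S] (L : List (S →₀ ℤ)) :
    wedge L ≠ 0 ↔ L.length ≤ Module.finrank ℤ (Submodule.span ℤ {w | w ∈ L}) := by
  rw [wedge_eq_ιMulti, ιMulti_ne_zero_iff, linearIndependent_iff_finrank_span, range_get_eq]

theorem wedge_eq_or_eq_neg {S : Type} [Finite S] (L L' : List (S →₀ ℤ))
    (hl : L.length = L'.length)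
    (h : Submodule.span ℤ {w | w ∈ L} = Submodule.span ℤ {w | w ∈ L'}) :
    wedge L = wedge L' ∨ wedge L = - wedge L' := by
  have e : wedge L' =
      ExteriorAlgebra.ιMulti ℤ L.length (fun i => L'.get (Fin.cast hl i)) := by
    rw [wedge_eq_ιMulti]
    generalize hm : L.length = m at hl
    subst hl
    rfl
  rw [e, wedge_eq_ιMulti]
  apply ιMulti_eq_or_eq_neg
  rw [range_get_eq, h]
  congr 1
  rw [← range_get_eq]
  exact ((Fin.castOrderIso hl).surjective.range_comp L'.get).symm

/-- The sum of the coefficients. -/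
def coeffSum (S : Type) : (S →₀ ℤ) →ₗ[ℤ] ℤ := Finsupp.linearCombination ℤ fun _ => 1

@[simp] theorem coeffSum_single {S : Type} (s : S) (r : ℤ) :
    coeffSum S (Finsupp.single s r) = r := by
  simp [coeffSum]

/-- The coefficient sum vanishes on the span of `L` but equals 1 on a circle, so the circle is
independent of `L`. -/
theorem wedge_mul_gen_ne_zero {S : Type} [Finite S] (L : List (S →₀ ℤ)) (hL : wedge L ≠ 0)
    (h : ∀ w ∈ L, coeffSum S w = 0) (s : S) : wedge L * OF.gen s ≠ 0 := by
  rw [OF.gen, wedge_mul_ι]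
  intro h0
  have h1 : wedge (Finsupp.single s 1 :: L) = 0 := by
    rw [wedge_cons]
    rcases neg_one_pow_eq_or (OF S) L.length with h | h
    · simpa [h] using h0
    · simpa [h] using h0
  rw [wedge_eq_ιMulti, ιMulti_ne_zero_iff] at hL
  rw [wedge_eq_ιMulti] at h1
  revert h1
  refine (ιMulti_ne_zero_iff _).2 ?_
  have e : (Finsupp.single s (1 : ℤ) :: L).get = Fin.cons (Finsupp.single s 1) L.get := by
    ext1 i
    refine Fin.cases ?_ ?_ i
    · rfl
    · intro i; rfl
  rw [e]
  refine hL.finCons' _ _ fun r y hy hry => ?_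
  have hw : ∀ y ∈ Submodule.span ℤ (Set.range L.get), coeffSum S y = 0 := by
    rw [range_get_eq]
    exact fun y hy => (Submodule.span_le (p := LinearMap.ker (coeffSum S))).2 h hy
  have := congrArg (coeffSum S) hry
  simpa [hw y hy] using this

/-! ### Independence of the chronology, and the genus criterion for vanishing -/

namespace Chronology

variable {b : Matching n} (γ : Chronology b) (c a : Matching n)

/-- The vectors whose product is the image of `omega` among the circles of `W(c)a`. -/
def splitVectors : List (Circle c a →₀ ℤ) :=
  (γ.splitTimes c a 0 n).map fun v => Finsupp.mapDomain (toCircle c a) (γ.arcVector v)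

theorem renameCircle_omega : renameCircle c a (γ.omega c a) = wedge (γ.splitVectors c a) := by
  rw [omega, OF.rename_wedge, List.map_map]
  rfl

theorem length_splitVectors : (γ.splitVectors c a).length = γ.numSplits c a := by
  simp [splitVectors, numSplits]

/-- The right-hand side does not mention the chronology. The arcs contracted in a merge contribute
nothing new, by `mapDomain_arcVector_mem_span` from time zero on. -/
theorem span_splitVectors : Submodule.span ℤ {w | w ∈ γ.splitVectors c a} = arcSpan c b a := by
  apply le_antisymm
  · rw [Submodule.span_le]
    intro w hw
    obtain ⟨v, _, rfl⟩ := List.mem_map.1 hw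
    have h := single_sub_single_partner_mem_arcSpan c b a (γ.order v).left
    change Finsupp.mapDomain (toCircle c a) (γ.arcVector v) ∈ arcSpan c b a
    rw [mapDomain_arcVector]
    split_ifs
    · exact h
    · rw [← neg_sub]
      exact neg_mem h
  · rw [arcSpan, Submodule.span_le]
    rintro _ ⟨i, rfl⟩
    have key : ∀ i, i < b.partner i → Finsupp.single (toCircle c a i) (1 : ℤ) -
        Finsupp.single (toCircle c a (b.partner i)) 1 ∈
          Submodule.span ℤ {w | w ∈ γ.splitVectors c a} := by
      intro i hi
      let α : b.Arc := ⟨i, hi⟩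
      have h := γ.mapDomain_arcVector_mem_span c a 0 n (Nat.zero_add n)
        (γ.order.symm α) (Nat.zero_le _)
      rw [mapDomain_arcVector, Equiv.apply_symm_apply] at h
      split_ifs at h
      · exact h
      · rw [← neg_sub]
        exact neg_mem h
    rcases lt_or_gt_of_ne (b.ne_self i) with h | h
    · have := key (b.partner i) (by rwa [b.involutive])
      rw [b.involutive] at this
      have := neg_mem this
      rwa [neg_sub] at this
    · exact key i h

theorem numSplits_eq (γ' : Chronology b) : γ.numSplits c a = γ'.numSplits c a := by
  have h1 := γ.numSplits_spec c a
  have h2 := γ'.numSplits_spec c a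
  omega

/-- The multiplication map depends on the chronology only up to sign. -/
theorem renameCircle_omega_eq_or (γ' : Chronology b) :
    renameCircle c a (γ.omega c a) = renameCircle c a (γ'.omega c a) ∨
      renameCircle c a (γ.omega c a) = - renameCircle c a (γ'.omega c a) := by
  rw [renameCircle_omega, renameCircle_omega]
  refine wedge_eq_or_eq_neg _ _ ?_ ?_
  · rw [length_splitVectors, length_splitVectors, numSplits_eq]
  · rw [span_splitVectors, span_splitVectors]

/-- The genus of the contraction cobordism is nonnegative. -/
theorem numCircles_le {b : Matching n} (γ : Chronology b) (c a : Matching n) :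
    numCircles c b + numCircles b a + numCircles c a ≤
    n + 2 * numComps c b a := by
  have h1 := γ.numSplits_spec c a
  have h2 := finrank_arcSpan c b a
  -- The number of splits minus the rank of their span is half of `n + 2 * numComps c b a` minus the
  -- three numbers of circles, which is the total genus of the cobordism. It vanishes precisely when
  -- the split vectors are independent.
  have h3 : Module.finrank ℤ (arcSpan c b a) ≤ γ.numSplits c a := by
    rw [← span_splitVectors γ, ← length_splitVectors, ← range_get_eq]
    exact (finrank_range_le_card _).trans (by simp)
  omega

/-- The odd functor does not vanish on a contraction cobordism if and only if its genus is zero. -/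
theorem renameCircle_omega_ne_zero_iff : renameCircle c a (γ.omega c a) ≠ 0 ↔
    numCircles c b + numCircles b a + numCircles c a = n + 2 * numComps c b a := by
  have h1 := γ.numSplits_spec c a
  have h2 := finrank_arcSpan c b a
  have h3 := γ.numCircles_le c a
  rw [renameCircle_omega, wedge_ne_zero_iff, span_splitVectors, length_splitVectors]
  omega

theorem renameCircle_omega_mul_gen_ne_zero (h : renameCircle c a (γ.omega c a) ≠ 0)
    (s : Circle c a) : renameCircle c a (γ.omega c a) * OF.gen s ≠ 0 := by
  rw [renameCircle_omega] at h ⊢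
  refine wedge_mul_gen_ne_zero _ h ?_ s
  intro w hw
  obtain ⟨v, _, rfl⟩ := List.mem_map.1 hw
  rw [mapDomain_arcVector]
  split_ifs <;> simp

theorem omega_mem : γ.omega c a ∈ ⋀[ℤ]^(γ.numSplits c a) (Fin (2 * n) →₀ ℤ) := by
  have : γ.numSplits c a = ((γ.splitTimes c a 0 n).map γ.arcVector).length := by
    simp [numSplits]
  rw [omega, this, wedge_eq_ιMulti]
  exact (exteriorPower.ιMulti ℤ _ _).2

end Chronology

end OddArc

namespace OddArc

variable {n : ℕ}

/-! ### Numbers of circles -/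

theorem toCircle_eq_imp {b a : Matching n} {T : Type} (f : Fin (2 * n) → T)
    (hb : ∀ i, f (b.partner i) = f i) (ha : ∀ i, f (a.partner i) = f i) {i j : Fin (2 * n)}
    (h : toCircle b a i = toCircle b a j) : f i = f j := by
  refine quot_eq_of_rel f ?_ h
  rintro i j (rfl | rfl)
  exacts [(hb i).symm, (ha i).symm]

theorem numCircles_comm (b a : Matching n) : numCircles b a = numCircles a b := by
  let f : ∀ b a : Matching n, Circle b a → Circle a b := fun b a => Quot.lift (toCircle a b) (by
    rintro i j (rfl | rfl)
    · exact (toCircle_lower a b i).symm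
    · exact (toCircle_upper a b i).symm)
  refine Nat.card_congr ⟨f b a, f a b, ?_, ?_⟩
  · rintro ⟨i⟩; rfl
  · rintro ⟨i⟩; rfl

theorem Chronology.card_arc {b : Matching n} (γ : Chronology b) : Nat.card b.Arc = n := by
  rw [← Nat.card_congr γ.order, Nat.card_fin]

instance (b : Matching n) : Finite b.Arc := Subtype.finite

theorem arcToCircle_surjective (c b : Matching n) :
    Function.Surjective fun α : b.Arc => toCircle c b α.left := by
  rintro ⟨i⟩
  rcases lt_or_gt_of_ne (b.ne_self i) with h | h
  · exact ⟨⟨b.partner i, by rwa [b.involutive]⟩, toCircle_lower c b i⟩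
  · exact ⟨⟨i, h⟩, rfl⟩

theorem Chronology.numCircles_le_left {b : Matching n} (γ : Chronology b) (c : Matching n) :
    numCircles c b ≤ n := by
  exact (Nat.card_le_card_of_surjective _ (arcToCircle_surjective c b)).trans_eq γ.card_arc

theorem Chronology.numCircles_self {b : Matching n} (γ : Chronology b) : numCircles b b = n := by
  refine (Nat.card_eq_of_bijective _ ⟨?_, arcToCircle_surjective b b⟩).symm.trans γ.card_arc
  intro α β h
  have := toCircle_eq_imp (fun i => min i (b.partner i)) (fun i => by simp [b.involutive, min_comm])
    (fun i => by simp [b.involutive, min_comm]) h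
  have h1 : α.1 < b.partner α.1 := α.2
  have h2 : β.1 < b.partner β.1 := β.2
  change min α.1 (b.partner α.1) = min β.1 (b.partner β.1) at this
  rw [min_eq_left h1.le, min_eq_left h2.le] at this
  exact Subtype.ext this

/-! ### Flips -/

theorem Matching.ext {b c : Matching n} (h : ∀ i, b.partner i = c.partner i) : b = c :=
  Matching.partner_injective (funext h)

/-- The points `y` and `z` are not separated by `u` and `v`. -/
def SameSide (u v y z : Fin (2 * n)) : Prop := (u < y ↔ v < y) ↔ (u < z ↔ v < z)

theorem SameSide.swap_left {u v y z : Fin (2 * n)} (h : SameSide u v y z) : SameSide v u y z := by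
  unfold SameSide at *; tauto

theorem SameSide.swap_right {u v y z : Fin (2 * n)} (h : SameSide u v y z) : SameSide u v z y := by
  unfold SameSide at *; tauto

theorem SameSide.trans {u v w y z : Fin (2 * n)} (h : SameSide u v y z) (h' : SameSide v w y z) :
    SameSide u w y z := by
  unfold SameSide at *; tauto

theorem SameSide.comm {u v y z : Fin (2 * n)} (h : SameSide u v y z) (h1 : y ≠ u) (h2 : y ≠ v)
    (h3 : z ≠ u) (h4 : z ≠ v) : SameSide y z u v := by
  have e : ∀ {p q : Fin (2 * n)}, p ≠ q → (p < q ↔ ¬ q < p) := fun {p q} h =>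
    ⟨fun h' => not_lt.2 h'.le, fun h' => lt_of_le_of_ne (not_lt.1 h') h⟩
  unfold SameSide at *
  rw [e h1, e h2, e h3, e h4]
  tauto

/-- The noncrossing condition in a form that does not depend on which end point comes first. In this
form it is symmetric in the two chords and chords can be concatenated, so the many cases of a flip
reduce to transitivity. -/
theorem Matching.sameSide (b : Matching n) {x y : Fin (2 * n)} (h1 : y ≠ x)
    (h2 : y ≠ b.partner x) : SameSide x (b.partner x) y (b.partner y) := by
  have key : ∀ x y : Fin (2 * n), y ≠ x → y ≠ b.partner x → x < b.partner x →
      SameSide x (b.partner x) y (b.partner y) := by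
    intro x y h1 h2 h
    have nc : ∀ y, y ≠ x → y ≠ b.partner x → x < y → y < b.partner x →
      x < b.partner y ∧ b.partner y < b.partner x := fun y _ _ => b.noncrossing x y
    have h3 : b.partner y ≠ x := fun h' => h2 (by rw [← h', b.involutive])
    have h4 : b.partner y ≠ b.partner x := fun h' => h1 (by
      rw [← b.involutive y, h', b.involutive])
    have n1 := b.noncrossing x y
    have n2 := b.noncrossing x (b.partner y)
    rw [b.involutive] at n2
    unfold SameSide
    clear nc
    generalize b.partner y = z at *
    generalize b.partner x = w at *
    omega
  rcases lt_or_gt_of_ne (b.ne_self x) with h | h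
  · have := key (b.partner x) y h2 (by rwa [b.involutive]) (by rwa [b.involutive])
    rw [b.involutive] at this
    exact this.swap_left
  · exact key x y h1 h2 h

theorem noncrossing_of_sameSide (f : Fin (2 * n) → Fin (2 * n)) (hf : ∀ i, f (f i) = i)
    (h : ∀ x y, y ≠ x → y ≠ f x → SameSide x (f x) y (f y)) (x y : Fin (2 * n)) (hxy : x < y)
    (hy : y < f x) : x < f y ∧ f y < f x := by
  have h3 : f y ≠ x := fun h' => hy.ne (by rw [← h', hf])
  have h4 : f y ≠ f x := fun h' => hxy.ne' (by rw [← hf y, h', hf])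
  have := h x y hxy.ne' hy.ne
  unfold SameSide at this
  generalize f y = z at *
  generalize f x = w at *
  omega

namespace Matching

variable (b : Matching n) (i j : Fin (2 * n))

/-- The points `i` and `j` can be joined: the points between them are matched among themselves. -/
structure CanJoin : Prop where
  lt : i < j
  ne : b.partner i ≠ j
  closed : ∀ x, i < x → x < j → i < b.partner x ∧ b.partner x < j

/-- The partner of a point after joining `i` and `j`, and their partners. -/
def flipPartner (x : Fin (2 * n)) : Fin (2 * n) :=
  if x = i then j else if x = j then i else
    if x = b.partner i then b.partner j else if x = b.partner j then b.partner i else b.partner x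

variable {b i j}

theorem CanJoin.outside (h : b.CanJoin i j) :
    (b.partner i < i ∨ j < b.partner i) ∧ (b.partner j < i ∨ j < b.partner j) := by
  obtain ⟨h1, h2, h3⟩ := h
  constructor
  · by_contra hc
    push Not at hc
    have e1 := lt_of_le_of_ne hc.1 (b.ne_self i).symm
    have e2 := lt_of_le_of_ne hc.2 h2
    have := (h3 _ e1 e2).1
    rw [b.involutive] at this
    exact lt_irrefl _ this
  · by_contra hc
    push Not at hc
    have e1 := lt_of_le_of_ne hc.1 (fun h => h2 (by rw [h, b.involutive]))
    have e2 := lt_of_le_of_ne hc.2 (b.ne_self j)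
    have := (h3 _ e1 e2).2
    rw [b.involutive] at this
    exact lt_irrefl _ this

theorem CanJoin.ne' (h : b.CanJoin i j) : b.partner j ≠ i :=
  fun h' => h.ne (by rw [← h', b.involutive])

theorem partner_inj {x y : Fin (2 * n)} : b.partner x = b.partner y ↔ x = y :=
  ⟨fun h => by rw [← b.involutive x, h, b.involutive], fun h => by rw [h]⟩

theorem partner_eq_iff {x y : Fin (2 * n)} : b.partner x = y ↔ x = b.partner y :=
  ⟨fun h => by rw [← h, b.involutive], fun h => by rw [h, b.involutive]⟩

theorem flipPartner_left : b.flipPartner i j i = j := by simp [flipPartner]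

theorem flipPartner_right (h : b.CanJoin i j) : b.flipPartner i j j = i := by
  simp [flipPartner, h.lt.ne']

theorem flipPartner_partner_left (h : b.CanJoin i j) :
    b.flipPartner i j (b.partner i) = b.partner j := by
  simp [flipPartner, h.ne, b.ne_self]

theorem flipPartner_partner_right (h : b.CanJoin i j) :
    b.flipPartner i j (b.partner j) = b.partner i := by
  simp [flipPartner, h.ne', b.ne_self, partner_inj, h.lt.ne']

theorem flipPartner_of_ne {x : Fin (2 * n)} (h1 : x ≠ i) (h2 : x ≠ j) (h3 : x ≠ b.partner i)
    (h4 : x ≠ b.partner j) : b.flipPartner i j x = b.partner x := by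
  simp [flipPartner, h1, h2, h3, h4]

theorem flipPartner_cases (h : b.CanJoin i j) {P : Fin (2 * n) → Fin (2 * n) → Prop}
    (h1 : P i j) (h2 : P j i) (h3 : P (b.partner i) (b.partner j))
    (h4 : P (b.partner j) (b.partner i))
    (h5 : ∀ x, x ≠ i → x ≠ j → x ≠ b.partner i → x ≠ b.partner j → P x (b.partner x))
    (x : Fin (2 * n)) : P x (b.flipPartner i j x) := by
  by_cases e1 : x = i
  · rw [e1, flipPartner_left]; exact h1
  by_cases e2 : x = j
  · rw [e2, flipPartner_right h]; exact h2
  by_cases e3 : x = b.partner i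
  · rw [e3, flipPartner_partner_left h]; exact h3
  by_cases e4 : x = b.partner j
  · rw [e4, flipPartner_partner_right h]; exact h4
  rw [flipPartner_of_ne e1 e2 e3 e4]
  exact h5 x e1 e2 e3 e4

theorem flipPartner_involutive (h : b.CanJoin i j) (x : Fin (2 * n)) :
    b.flipPartner i j (b.flipPartner i j x) = x := by
  refine flipPartner_cases h (P := fun x y => b.flipPartner i j y = x) ?_ ?_ ?_ ?_ ?_ x
  · exact flipPartner_right h
  · exact flipPartner_left
  · exact flipPartner_partner_right h
  · exact flipPartner_partner_left h
  · intro x h1 h2 h3 h4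
    rw [flipPartner_of_ne (by rwa [ne_eq, partner_eq_iff]) (by rwa [ne_eq, partner_eq_iff])
      (by rwa [ne_eq, partner_inj]) (by rwa [ne_eq, partner_inj]), b.involutive]

theorem flipPartner_ne_self (h : b.CanJoin i j) (x : Fin (2 * n)) : b.flipPartner i j x ≠ x := by
  refine flipPartner_cases h (P := fun x y => y ≠ x) ?_ ?_ ?_ ?_ ?_ x
  · exact h.lt.ne'
  · exact h.lt.ne
  · rw [ne_eq, partner_inj]; exact h.lt.ne'
  · rw [ne_eq, partner_inj]; exact h.lt.ne
  · intro x _ _ _ _; exact b.ne_self x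

theorem CanJoin.sameSide (h : b.CanJoin i j) {y : Fin (2 * n)} (h2 : y ≠ j)
    (h3 : y ≠ b.partner i) (h4 : y ≠ b.partner j) : SameSide i j y (b.partner y) := by
  have n1 := h.closed y
  have n2 := h.closed (b.partner y)
  rw [b.involutive] at n2
  have e1 : b.partner y ≠ i := by rwa [ne_eq, partner_eq_iff]
  have e2 : b.partner y ≠ j := by rwa [ne_eq, partner_eq_iff]
  have := h.lt
  unfold SameSide
  generalize b.partner y = z at *
  omega

theorem CanJoin.sameSide_partner (h : b.CanJoin i j) :
    SameSide i j (b.partner i) (b.partner j) := by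
  obtain ⟨h1, h2⟩ := h.outside
  have := h.lt
  unfold SameSide
  generalize b.partner i = z at *
  generalize b.partner j = w at *
  omega

/-- The new chord between the partners is the concatenation of the old arc to `i`, the new arc from
`i` to `j`, and the old arc from `j`; none of them separates `y` from its partner. -/
theorem CanJoin.sameSide_of_partner (h : b.CanJoin i j) {y : Fin (2 * n)} (h1 : y ≠ i) (h2 : y ≠ j)
    (h3 : y ≠ b.partner i) (h4 : y ≠ b.partner j) :
    SameSide (b.partner i) (b.partner j) y (b.partner y) :=
  ((b.sameSide h1 h3).swap_left.trans (h.sameSide h2 h3 h4)).trans (b.sameSide h2 h4)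

theorem flipPartner_sameSide (h : b.CanJoin i j) (x y : Fin (2 * n)) :
    y ≠ x → y ≠ b.flipPartner i j x →
      SameSide x (b.flipPartner i j x) y (b.flipPartner i j y) := by
  have hki : b.partner i ≠ i := b.ne_self i
  have hlj : b.partner j ≠ j := b.ne_self j
  have hp := h.sameSide_partner.comm hki h.ne h.ne' hlj
  revert y
  refine flipPartner_cases h (P := fun x z => ∀ y, y ≠ x → y ≠ z →
    SameSide x z y (b.flipPartner i j y)) ?_ ?_ ?_ ?_ ?_ x
  · refine flipPartner_cases h (P := fun y z => y ≠ i → y ≠ j → SameSide i j y z) ?_ ?_ ?_ ?_ ?_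
    · exact fun h => absurd rfl h
    · exact fun _ h => absurd rfl h
    · exact fun _ _ => h.sameSide_partner
    · exact fun _ _ => h.sameSide_partner.swap_right
    · exact fun y h1 h2 h3 h4 _ _ => h.sameSide h2 h3 h4
  · refine flipPartner_cases h (P := fun y z => y ≠ j → y ≠ i → SameSide j i y z) ?_ ?_ ?_ ?_ ?_
    · exact fun _ h => absurd rfl h
    · exact fun h => absurd rfl h
    · exact fun _ _ => h.sameSide_partner.swap_left
    · exact fun _ _ => h.sameSide_partner.swap_left.swap_right
    · exact fun y h1 h2 h3 h4 _ _ => (h.sameSide h2 h3 h4).swap_left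
  · refine flipPartner_cases h (P := fun y z => y ≠ b.partner i → y ≠ b.partner j →
      SameSide (b.partner i) (b.partner j) y z) ?_ ?_ ?_ ?_ ?_
    · exact fun _ _ => hp
    · exact fun _ _ => hp.swap_right
    · exact fun h => absurd rfl h
    · exact fun _ h => absurd rfl h
    · exact fun y h1 h2 h3 h4 _ _ => h.sameSide_of_partner h1 h2 h3 h4
  · refine flipPartner_cases h (P := fun y z => y ≠ b.partner j → y ≠ b.partner i →
      SameSide (b.partner j) (b.partner i) y z) ?_ ?_ ?_ ?_ ?_
    · exact fun _ _ => hp.swap_left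
    · exact fun _ _ => hp.swap_left.swap_right
    · exact fun _ h => absurd rfl h
    · exact fun h => absurd rfl h
    · exact fun y h1 h2 h3 h4 _ _ => (h.sameSide_of_partner h1 h2 h3 h4).swap_left
  · intro x h1 h2 h3 h4
    have e1 : b.partner x ≠ i := by rwa [ne_eq, partner_eq_iff]
    have e2 : b.partner x ≠ j := by rwa [ne_eq, partner_eq_iff]
    have e3 : b.partner x ≠ b.partner i := by rwa [ne_eq, partner_inj]
    have e4 : b.partner x ≠ b.partner j := by rwa [ne_eq, partner_inj]
    have s1 := (h.sameSide h2 h3 h4).comm h1 h2 e1 e2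
    have s2 := (h.sameSide_of_partner h1 h2 h3 h4).comm h3 h4 e3 e4
    refine flipPartner_cases h (P := fun y z => y ≠ x → y ≠ b.partner x →
      SameSide x (b.partner x) y z) ?_ ?_ ?_ ?_ ?_
    · exact fun _ _ => s1
    · exact fun _ _ => s1.swap_right
    · exact fun _ _ => s2
    · exact fun _ _ => s2.swap_right
    · exact fun y _ _ _ _ => b.sameSide

/-- Joining `i` with `j`, and their partners with each other. -/
def flip (h : b.CanJoin i j) : Matching n where
  partner := b.flipPartner i j
  involutive := flipPartner_involutive h
  ne_self := flipPartner_ne_self h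
  noncrossing := noncrossing_of_sameSide _ (flipPartner_involutive h) (flipPartner_sameSide h)

end Matching

end OddArc

namespace OddArc

variable {n : ℕ}

/-! ### Circles and flips -/

/-- The map of circles when the diagram `W(d)e` is coarser than `W(c)b`. -/
def circleHom {c b d e : Matching n} (hc : ∀ i, toCircle d e (c.partner i) = toCircle d e i)
    (hb : ∀ i, toCircle d e (b.partner i) = toCircle d e i) : Circle c b → Circle d e :=
  Quot.lift (toCircle d e) (by
    rintro i j (rfl | rfl)
    exacts [(hc i).symm, (hb i).symm])

theorem circleHom_surjective {c b d e : Matching n}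
    (hc : ∀ i, toCircle d e (c.partner i) = toCircle d e i)
    (hb : ∀ i, toCircle d e (b.partner i) = toCircle d e i) :
    Function.Surjective (circleHom hc hb) := by
  rintro ⟨i⟩
  exact ⟨toCircle c b i, rfl⟩

theorem numCircles_le_of_coarser {c b d e : Matching n}
    (hc : ∀ i, toCircle d e (c.partner i) = toCircle d e i)
    (hb : ∀ i, toCircle d e (b.partner i) = toCircle d e i) :
    numCircles d e ≤ numCircles c b :=
  Nat.card_le_card_of_surjective _ (circleHom_surjective hc hb)

theorem numCircles_eq_add_one {c b d e : Matching n}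
    (hc : ∀ i, toCircle d e (c.partner i) = toCircle d e i)
    (hb : ∀ i, toCircle d e (b.partner i) = toCircle d e i) (u w : Fin (2 * n))
    (huw : toCircle c b u ≠ toCircle c b w) (h : toCircle d e u = toCircle d e w)
    (hd : ∀ i, toCircle c b (d.partner i) = toCircle c b i ∨
      ((toCircle c b (d.partner i) = toCircle c b u ∨ toCircle c b (d.partner i) = toCircle c b w) ∧
        (toCircle c b i = toCircle c b u ∨ toCircle c b i = toCircle c b w)))
    (he : ∀ i, toCircle c b (e.partner i) = toCircle c b i ∨
      ((toCircle c b (e.partner i) = toCircle c b u ∨ toCircle c b (e.partner i) = toCircle c b w) ∧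
        (toCircle c b i = toCircle c b u ∨ toCircle c b i = toCircle c b w))) :
    numCircles c b = numCircles d e + 1 := by
  refine card_eq_add_one_of_pair_fiber (circleHom hc hb) (circleHom_surjective hc hb)
    (toCircle c b u) (toCircle c b w) huw h ?_
  rintro ⟨x⟩ ⟨y⟩ hxy
  refine quot_eq_or_pair (toCircle c b) _ _ ?_ hxy
  rintro x y (rfl | rfl)
  · rcases hd x with h | h
    exacts [Or.inl h.symm, Or.inr h.symm]
  · rcases he x with h | h
    exacts [Or.inl h.symm, Or.inr h.symm]

namespace Matching

variable {b c : Matching n} {i j : Fin (2 * n)}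

theorem flip_left (h : b.CanJoin i j) : (flip h).partner i = j := flipPartner_left

theorem flip_right (h : b.CanJoin i j) : (flip h).partner j = i := flipPartner_right h

theorem flip_partner_left (h : b.CanJoin i j) :
    (flip h).partner (b.partner i) = b.partner j := flipPartner_partner_left h

theorem flip_partner_right (h : b.CanJoin i j) :
    (flip h).partner (b.partner j) = b.partner i := flipPartner_partner_right h

theorem flip_of_ne (h : b.CanJoin i j) {x : Fin (2 * n)} (h1 : x ≠ i) (h2 : x ≠ j)
    (h3 : x ≠ b.partner i) (h4 : x ≠ b.partner j) : (flip h).partner x = b.partner x :=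
  flipPartner_of_ne h1 h2 h3 h4

theorem flip_invariant (h : b.CanJoin i j) {T : Type*} {f : Fin (2 * n) → T} (h1 : f i = f j)
    (h2 : f (b.partner i) = f (b.partner j))
    (h3 : ∀ x, x ≠ i → x ≠ j → x ≠ b.partner i → x ≠ b.partner j → f (b.partner x) = f x)
    (x : Fin (2 * n)) : f ((flip h).partner x) = f x :=
  flipPartner_cases h (P := fun x y => f y = f x) h1.symm h1 h2.symm h2 h3 x

theorem eq_or_of_flip (h : b.CanJoin i j) {T : Type*} {f : Fin (2 * n) → T}
    (hf : ∀ x, f ((flip h).partner x) = f x) (x : Fin (2 * n)) :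
    f (b.partner x) = f x ∨ ((f (b.partner x) = f i ∨ f (b.partner x) = f (b.partner i)) ∧
      (f x = f i ∨ f x = f (b.partner i))) := by
  have h1 : f j = f i := by rw [← hf i, flip_left]
  have h2 : f (b.partner j) = f (b.partner i) := by
    rw [← hf (b.partner i), flip_partner_left]
  by_cases e1 : x = i
  · subst e1; exact Or.inr ⟨Or.inr rfl, Or.inl rfl⟩
  by_cases e2 : x = j
  · subst e2; exact Or.inr ⟨Or.inr h2, Or.inl h1⟩
  by_cases e3 : x = b.partner i
  · subst e3; rw [b.involutive]; exact Or.inr ⟨Or.inl rfl, Or.inr rfl⟩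
  by_cases e4 : x = b.partner j
  · subst e4; rw [b.involutive]; exact Or.inr ⟨Or.inl h1, Or.inr h2⟩
  rw [← flip_of_ne h e1 e2 e3 e4]
  exact Or.inl (hf x)

theorem toCircle_flip_ne (h : b.CanJoin i j) (hc : c.partner i = j) :
    toCircle c (flip h) i ≠ toCircle c (flip h) (b.partner i) := by
  intro he
  have hcj : c.partner j = i := by rw [← hc, c.involutive]
  have := toCircle_eq_imp (fun x => x = i ∨ x = j) (b := c) (a := flip h) (fun x => by
      apply propext
      rw [partner_eq_iff, partner_eq_iff, hc, hcj, or_comm])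
    (fun x => by
      apply propext
      rw [partner_eq_iff, partner_eq_iff, flip_left, flip_right, or_comm]) he
  have h' : b.partner i = i ∨ b.partner i = j := this ▸ Or.inl rfl
  rcases h' with h' | h'
  · exact b.ne_self _ h'
  · exact h.ne h'

/-- The arc of `c` from `i` to `j` closes up with the new arc of the flip to a circle of its own,
cut off from the circle of `W(c)b` through these points. -/
theorem numCircles_flip (h : b.CanJoin i j) (hc : c.partner i = j) :
    numCircles c (flip h) = numCircles c b + 1 := by
  have hij : toCircle c b i = toCircle c b j := by rw [← hc, toCircle_upper]
  refine numCircles_eq_add_one (toCircle_upper c b) ?_ i (b.partner i)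
    (toCircle_flip_ne h hc) (toCircle_lower c b i).symm ?_ ?_
  · refine flip_invariant h hij ?_ ?_
    · rw [toCircle_lower, toCircle_lower, hij]
    · exact fun x _ _ _ _ => toCircle_lower c b x
  · exact fun x => Or.inl (toCircle_upper c _ x)
  · exact eq_or_of_flip h (toCircle_lower c _)

/-- In `W(b)b` each arc forms a circle with its mirror image; the flip fuses the two circles at `i`
and `j` and touches no other. -/
theorem numCircles_flip_self (h : b.CanJoin i j) :
    numCircles b b = numCircles b (flip h) + 1 := by
  have hk : toCircle b (flip h) j = toCircle b (flip h) i := by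
    have := toCircle_lower b (flip h) i
    rwa [flip_left] at this
  refine numCircles_eq_add_one (toCircle_upper b _) (toCircle_upper b _) i j
    ?_ hk.symm ?_ ?_
  · intro he
    have := toCircle_eq_imp (fun x => x = i ∨ x = b.partner i) (b := b) (a := b) (fun x => by
      apply propext
      rw [partner_eq_iff, partner_eq_iff, b.involutive, or_comm]) (fun x => by
      apply propext
      rw [partner_eq_iff, partner_eq_iff, b.involutive, or_comm]) he
    have h' : j = i ∨ j = b.partner i := this ▸ Or.inl rfl
    rcases h' with h' | h'
    · exact h.lt.ne' h'
    · exact h.ne h'.symm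
  · exact fun x => Or.inl (toCircle_upper b _ x)
  · intro x
    refine flipPartner_cases h (P := fun x y => toCircle b b y = toCircle b b x ∨
      ((toCircle b b y = toCircle b b i ∨ toCircle b b y = toCircle b b j) ∧
        (toCircle b b x = toCircle b b i ∨ toCircle b b x = toCircle b b j)))
      ?_ ?_ ?_ ?_ ?_ x
    · simp
    · simp
    · simp [toCircle_lower]
    · simp [toCircle_lower]
    · exact fun x _ _ _ _ => Or.inl (toCircle_lower b b x)

end Matching

/-- Take an arc of `c` of least length among those that `b` does not have. The arcs of `c` under it
are shorter, hence arcs of `b`, so the points under it are matched among themselves by `b`. -/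
theorem exists_canJoin {c b : Matching n} (hcb : c ≠ b) :
    ∃ i j, c.partner i = j ∧ b.CanJoin i j := by
  classical
  have hne : ∃ d : ℕ, ∃ i j : Fin (2 * n), (j : ℕ) = i + d ∧ i < j ∧ c.partner i = j ∧
      b.partner i ≠ j := by
    by_contra hno
    push Not at hno
    have key : ∀ i, i < c.partner i → b.partner i = c.partner i := fun i hi =>
      hno (c.partner i - i) i (c.partner i) (by omega) hi rfl
    refine hcb (Matching.ext fun i => ?_)
    rcases lt_or_gt_of_ne (c.ne_self i) with h | h
    · have := key (c.partner i) (by rwa [c.involutive])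
      rw [c.involutive] at this
      rw [← this, b.involutive]
      exact this.symm ▸ rfl
    · exact (key i h).symm
  obtain ⟨i, j, hd, hij, hc, hb⟩ := Nat.find_spec hne
  refine ⟨i, j, hc, hij, hb, fun x h1 h2 => ?_⟩
  have hx := c.noncrossing i x h1 (hc ▸ h2)
  rw [hc] at hx
  have key : ∀ u v : Fin (2 * n), i < u → u < v → v < j → c.partner u = v → b.partner u = v := by
    intro u v h1 h2 h3 h4
    by_contra h5
    have := Nat.find_min hne (m := v - u) (by omega)
    exact this ⟨u, v, by omega, h2, h4, h5⟩
  have : b.partner x = c.partner x := by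
    rcases lt_or_gt_of_ne (c.ne_self x) with h | h
    · have := key _ x hx.1 h h2 (c.involutive x)
      rw [← this, b.involutive, this]
    · exact key x _ h1 h hx.2 rfl
  rwa [this]

theorem Choice.numCircles_le (C : Choice n) (c b : Matching n) : numCircles c b ≤ n :=
  (C b b b).numCircles_le_left c

theorem Choice.numCircles_self (C : Choice n) (b : Matching n) : numCircles b b = n :=
  (C b b b).numCircles_self

/-- Otherwise a flip of `b` towards `c` would have `n + 1` circles, more than one for each arc. -/
theorem Choice.eq_of_numCircles (C : Choice n) {c b : Matching n} (h : numCircles c b = n) :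
    c = b := by
  by_contra hcb
  obtain ⟨i, j, hc, hj⟩ := exists_canJoin hcb
  have := Matching.numCircles_flip hj hc
  have := C.numCircles_le c (Matching.flip hj)
  omega

/-- A neighbour of `b` on the way to `c`. -/
theorem Choice.exists_geodesic (C : Choice n) {c b : Matching n} (hcb : c ≠ b) :
    ∃ b', numCircles c b' = numCircles c b + 1 ∧ numCircles b b' + 1 = n := by
  obtain ⟨i, j, hc, hj⟩ := exists_canJoin hcb
  exact ⟨Matching.flip hj, Matching.numCircles_flip hj hc, by
    rw [← Matching.numCircles_flip_self, C.numCircles_self]⟩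

/-- Triangle inequality and parity for the distance `n - |W(c)b|`. -/
theorem Choice.exists_numCircles (C : Choice n) (c b a : Matching n) :
    ∃ s, n + numCircles c a = numCircles c b + numCircles b a + 2 * s :=
  ⟨_, (C b b b).numSplits_spec c a⟩

/-! ### The standard matching -/

/-- The matching with arcs `{2k, 2k+1}`. -/
def Matching.std (n : ℕ) : Matching n where
  partner i := if h : (i : ℕ) % 2 = 0 then ⟨i + 1, by omega⟩ else ⟨i - 1, by omega⟩
  involutive i := by
    apply Fin.ext
    by_cases h : (i : ℕ) % 2 = 0
    · have : ¬ ((i : ℕ) + 1) % 2 = 0 := by omega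
      simp [h, this]
    · have : ((i : ℕ) - 1) % 2 = 0 := by omega
      simp only [h, this, dite_true, dite_false]
      omega
  ne_self i := by
    intro h'
    have := congrArg Fin.val h'
    split_ifs at this <;> simp at this
    omega
  noncrossing i j h1 h2 := by
    exfalso
    rw [Fin.lt_def] at h1 h2
    split_ifs at h2 <;> simp at h2 <;> omega

theorem Matching.std_even {i : Fin (2 * n)} (h : (i : ℕ) % 2 = 0) :
    ((std n).partner i : ℕ) = i + 1 := by
  simp [std, h]

theorem Matching.std_odd {i : Fin (2 * n)} (h : (i : ℕ) % 2 = 1) :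
    ((std n).partner i : ℕ) = i - 1 := by
  simp [std, h]

theorem Matching.canJoin_std {b : Matching n} {m : Fin (2 * n)} (h : (m : ℕ) % 2 = 0)
    (hb : b.partner m ≠ (std n).partner m) : b.CanJoin m ((std n).partner m) := by
  have := std_even h
  exact ⟨by omega, hb, fun x h1 h2 => by omega⟩

theorem Matching.exists_even_of_ne_std {b : Matching n} (hb : b ≠ std n) :
    ∃ m : Fin (2 * n), (m : ℕ) % 2 = 0 ∧ b.partner m ≠ (std n).partner m := by
  by_contra hno
  push Not at hno
  refine hb (Matching.ext fun i => ?_)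
  rcases Nat.mod_two_eq_zero_or_one i with h | h
  · exact hno i h
  · have h1 := std_odd h
    have := hno ((std n).partner i) (by omega)
    rw [(std n).involutive] at this
    conv_lhs => rw [← this]
    rw [b.involutive]

end OddArc

namespace OddArc

variable {n : ℕ}

/-! ### The height map -/

/-- The point `i` with the sign `1` for odd `i` and `-1` for even `i`. -/
def sgnVec (i : Fin (2 * n)) : Fin (2 * n) →₀ ℤ :=
  if (i : ℕ) % 2 = 0 then - Finsupp.single i 1 else Finsupp.single i 1

/-- The signed sum of the points to the left of `j`, and of `j` for odd `j`. -/
def heightVec (j : Fin (2 * n)) : Fin (2 * n) →₀ ℤ :=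
  ∑ i ∈ Finset.Iio j, sgnVec i + if (j : ℕ) % 2 = 0 then 0 else Finsupp.single j 1

/-- The span of the differences of the partners under `b` in `S`. -/
def partnerSpan (b : Matching n) (S : Set (Fin (2 * n))) : Submodule ℤ (Fin (2 * n) →₀ ℤ) :=
  Submodule.span ℤ {v | ∃ i ∈ S, v = Finsupp.single i 1 - Finsupp.single (b.partner i) 1}

theorem sgnVec_add_partner_mem (b : Matching n) {S : Set (Fin (2 * n))} {i : Fin (2 * n)}
    (hi : i ∈ S) : sgnVec i + sgnVec (b.partner i) ∈ partnerSpan b S := by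
  have hp := b.parity_partner i
  have hv : Finsupp.single i (1 : ℤ) - Finsupp.single (b.partner i) 1 ∈ partnerSpan b S :=
    Submodule.subset_span ⟨i, hi, rfl⟩
  unfold sgnVec
  rcases Nat.mod_two_eq_zero_or_one i with h | h
  · have h' : ¬ (b.partner i : ℕ) % 2 = 0 := by omega
    rw [if_pos h, if_neg h', neg_add_eq_sub, ← neg_sub]
    exact Submodule.neg_mem _ hv
  · have h' : (b.partner i : ℕ) % 2 = 0 := by omega
    rw [if_neg (by omega), if_pos h', ← sub_eq_add_neg]
    exact hv

theorem sum_sgnVec_mem (b : Matching n) (S : Finset (Fin (2 * n)))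
    (hS : ∀ i ∈ S, b.partner i ∈ S) : ∑ i ∈ S, sgnVec i ∈ partnerSpan b S := by
  rw [← Submodule.Quotient.mk_eq_zero, ← Submodule.mkQ_apply, map_sum]
  refine Finset.sum_involution (fun i _ => b.partner i) ?_ ?_ hS ?_
  · intro i hi
    rw [← map_add, Submodule.mkQ_apply, Submodule.Quotient.mk_eq_zero]
    exact sgnVec_add_partner_mem b hi
  · exact fun i _ _ => b.ne_self i
  · exact fun i _ => b.involutive i

/-- Counting an odd end point in its own height makes the contribution of the two ends a full
difference for even `l` and nothing for odd `l`. Only the signed points strictly between them remain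
besides. -/
theorem heightVec_sub {l r : Fin (2 * n)} (h : l < r) (hp : ((r : ℕ) + l) % 2 = 1) :
    heightVec r - heightVec l =
      (if (l : ℕ) % 2 = 0 then Finsupp.single r 1 - Finsupp.single l 1 else 0) +
        ∑ i ∈ Finset.Ioo l r, sgnVec i := by
  have h1 : Finset.Iio r = insert l (Finset.Iio l ∪ Finset.Ioo l r) := by
    ext x
    simp only [Finset.mem_Iio, Finset.mem_insert, Finset.mem_union, Finset.mem_Ioo]
    omega
  have h2 : ∑ i ∈ Finset.Iio r, sgnVec i =
      sgnVec l + (∑ i ∈ Finset.Iio l, sgnVec i + ∑ i ∈ Finset.Ioo l r, sgnVec i) := by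
    rw [h1, Finset.sum_insert (by simp), Finset.sum_union]
    rw [Finset.disjoint_left]
    intro x hx
    simp only [Finset.mem_Iio, Finset.mem_Ioo] at hx ⊢
    omega
  unfold heightVec
  rw [h2]
  unfold sgnVec
  rcases Nat.mod_two_eq_zero_or_one l with h | h
  · simp only [h, if_true, show ¬ (r : ℕ) % 2 = 0 by omega, if_false]
    abel
  · simp only [show ¬ (l : ℕ) % 2 = 0 by omega, if_false, show (r : ℕ) % 2 = 0 by omega, if_true]
    abel

theorem heightVec_sub_mem (b : Matching n) {l : Fin (2 * n)} (h : l < b.partner l) :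
    heightVec (b.partner l) - heightVec l - (if (l : ℕ) % 2 = 0 then
      Finsupp.single (b.partner l) 1 - Finsupp.single l 1 else 0) ∈
      partnerSpan b (Set.Ioo l (b.partner l)) := by
  rw [heightVec_sub h (b.parity_partner l), add_sub_cancel_left]
  have := sum_sgnVec_mem b (Finset.Ioo l (b.partner l)) (fun i hi => by
    rw [Finset.mem_Ioo] at hi ⊢
    exact b.partner_mem_Ioo hi)
  rwa [Finset.coe_Ioo] at this

theorem mapDomain_eq_zero_of_mem_partnerSpan (b : Matching n) {S : Set (Fin (2 * n))}
    {T : Type*} (f : Fin (2 * n) → T) (hf : ∀ i, f (b.partner i) = f i)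
    {v : Fin (2 * n) →₀ ℤ} (hv : v ∈ partnerSpan b S) : Finsupp.mapDomain f v = 0 := by
  have : partnerSpan b S ≤ LinearMap.ker (Finsupp.lmapDomain ℤ ℤ f) := by
    refine Submodule.span_le.2 ?_
    rintro _ ⟨i, -, rfl⟩
    rw [SetLike.mem_coe, LinearMap.mem_ker, map_sub]
    simp [hf]
  exact this hv

/-- The signed points under an arc of `b` cancel in pairs of partners, and so does the end point
term once partners are identified. This makes the height map descend to the circles of every diagram
that contains `b`. -/
theorem mapDomain_heightVec_partner (b : Matching n) {T : Type*} (f : Fin (2 * n) → T)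
    (hf : ∀ i, f (b.partner i) = f i) (i : Fin (2 * n)) :
    Finsupp.mapDomain f (heightVec (b.partner i)) = Finsupp.mapDomain f (heightVec i) := by
  have key : ∀ i, i < b.partner i →
      Finsupp.mapDomain f (heightVec (b.partner i)) = Finsupp.mapDomain f (heightVec i) := by
    intro i hi
    have := mapDomain_eq_zero_of_mem_partnerSpan b f hf (heightVec_sub_mem b hi)
    have h0 : Finsupp.mapDomain f ((if (i : ℕ) % 2 = 0 then
      Finsupp.single (b.partner i) (1 : ℤ) - Finsupp.single i 1 else 0)) = 0 := by
      split_ifs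
      · rw [← Finsupp.lmapDomain_apply ℤ ℤ, map_sub]
        simp [hf]
      · simp
    rw [← Finsupp.lmapDomain_apply ℤ ℤ] at this h0 ⊢
    rw [map_sub, map_sub, h0, sub_zero, sub_eq_zero] at this
    exact this
  rcases lt_or_gt_of_ne (b.ne_self i) with h | h
  · have := key (b.partner i) (by rwa [b.involutive])
    rw [b.involutive] at this
    exact this.symm
  · exact key i h

theorem heightVec_mem (j : Fin (2 * n)) :
    heightVec j ∈ partnerSpan (Matching.std n) Set.univ := by
  have hmono : ∀ S, partnerSpan (Matching.std n) S ≤ partnerSpan (Matching.std n) Set.univ :=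
    fun S => Submodule.span_mono fun v ⟨i, _, h⟩ => ⟨i, trivial, h⟩
  have even : ∀ j : Fin (2 * n), (j : ℕ) % 2 = 0 →
      heightVec j ∈ partnerSpan (Matching.std n) Set.univ := by
    intro j hj
    unfold heightVec
    rw [if_pos hj, add_zero]
    refine hmono _ (sum_sgnVec_mem _ _ fun i hi => ?_)
    rw [Finset.mem_Iio] at hi ⊢
    rcases Nat.mod_two_eq_zero_or_one i with h | h
    · have := Matching.std_even h; omega
    · have := Matching.std_odd h; omega
  rcases Nat.mod_two_eq_zero_or_one j with h | h
  · exact even j h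
  · have h1 := Matching.std_odd h
    have h2 : ((Matching.std n).partner j : ℕ) % 2 = 0 := by omega
    have h3 := heightVec_sub_mem (Matching.std n) (l := (Matching.std n).partner j) (by
      rw [Matching.partner_partner]; omega)
    rw [Matching.partner_partner, if_pos h2] at h3
    have h4 : Finsupp.single j (1 : ℤ) - Finsupp.single ((Matching.std n).partner j) 1 ∈
      partnerSpan (Matching.std n) Set.univ := Submodule.subset_span ⟨j, trivial, rfl⟩
    have := Submodule.add_mem _ (Submodule.add_mem _ (hmono _ h3) h4) (even _ h2)
    convert this using 1
    abel

/-- The linear extension of `heightVec`. -/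
def heightMap (n : ℕ) : (Fin (2 * n) →₀ ℤ) →ₗ[ℤ] (Fin (2 * n) →₀ ℤ) :=
  Finsupp.linearCombination ℤ heightVec

theorem heightMap_single (j : Fin (2 * n)) :
    heightMap n (Finsupp.single j 1) = heightVec j := by
  simp [heightMap]

/-- No point lies under a standard arc, and such an arc starts at an even point. Together with
`heightVec_mem` this makes the height map a projection onto the span of the standard differences. -/
theorem heightMap_of_mem {v : Fin (2 * n) →₀ ℤ} {S : Set (Fin (2 * n))}
    (hv : v ∈ partnerSpan (Matching.std n) S) : heightMap n v = v := by
  have key : ∀ i : Fin (2 * n), (i : ℕ) % 2 = 0 →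
      heightVec ((Matching.std n).partner i) - heightVec i =
        Finsupp.single ((Matching.std n).partner i) 1 - Finsupp.single i 1 := by
    intro i hi
    have h1 := Matching.std_even hi
    rw [heightVec_sub (by omega) (by omega), if_pos hi]
    have : Finset.Ioo i ((Matching.std n).partner i) = ∅ := by
      ext x
      simp only [Finset.mem_Ioo, Finset.notMem_empty, iff_false]
      omega
    rw [this, Finset.sum_empty, add_zero]
  have : partnerSpan (Matching.std n) S ≤ LinearMap.eqLocus (heightMap n) LinearMap.id := by
    refine Submodule.span_le.2 ?_
    rintro _ ⟨i, -, rfl⟩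
    rw [SetLike.mem_coe, LinearMap.mem_eqLocus, map_sub, heightMap_single, heightMap_single,
      LinearMap.id_apply]
    rcases Nat.mod_two_eq_zero_or_one i with h | h
    · rw [← neg_sub, key i h, neg_sub]
    · have h1 := Matching.std_odd h
      have := key ((Matching.std n).partner i) (by omega)
      rwa [Matching.partner_partner] at this
  exact this hv

/-- The map induced by `heightMap` on the circles of `W(b)a`. -/
def heightCircle (b a : Matching n) : (Circle b a →₀ ℤ) →ₗ[ℤ] (Circle b a →₀ ℤ) :=
  Finsupp.linearCombination ℤ (Quot.lift
    (fun j => Finsupp.mapDomain (toCircle b a) (heightVec j)) (by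
      rintro i j (rfl | rfl)
      · exact (mapDomain_heightVec_partner b _ (toCircle_upper b a) i).symm
      · exact (mapDomain_heightVec_partner a _ (toCircle_lower b a) i).symm))

theorem heightCircle_single (b a : Matching n) (i : Fin (2 * n)) :
    heightCircle b a (Finsupp.single (toCircle b a i) 1) =
      Finsupp.mapDomain (toCircle b a) (heightVec i) := by
  exact (Finsupp.linearCombination_single ℤ _ _).trans (one_smul ℤ _)

theorem heightCircle_mapDomain (b a : Matching n) (v : Fin (2 * n) →₀ ℤ) :
    heightCircle b a (Finsupp.mapDomain (toCircle b a) v) =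
      Finsupp.mapDomain (toCircle b a) (heightMap n v) := by
  have : heightCircle b a ∘ₗ Finsupp.lmapDomain ℤ ℤ (toCircle b a) =
      Finsupp.lmapDomain ℤ ℤ (toCircle b a) ∘ₗ heightMap n := by
    refine Finsupp.lhom_ext' fun i => LinearMap.ext_ring ?_
    simp only [LinearMap.comp_apply, Finsupp.lsingle_apply, Finsupp.lmapDomain_apply,
      heightMap_single, Finsupp.mapDomain_single, heightCircle_single]
  exact LinearMap.congr_fun this v

theorem heightCircle_eq_self (b a : Matching n) {v : Circle b a →₀ ℤ}
    (hv : v ∈ arcSpan b (Matching.std n) a) : heightCircle b a v = v := by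
  have : arcSpan b (Matching.std n) a ≤ LinearMap.eqLocus (heightCircle b a) LinearMap.id := by
    refine Submodule.span_le.2 ?_
    rintro _ ⟨i, rfl⟩
    rw [SetLike.mem_coe, LinearMap.mem_eqLocus, LinearMap.id_apply]
    have h : Finsupp.single i (1 : ℤ) - Finsupp.single ((Matching.std n).partner i) 1 ∈
      partnerSpan (Matching.std n) Set.univ := Submodule.subset_span ⟨i, trivial, rfl⟩
    have := heightCircle_mapDomain b a _ ▸ congrArg (Finsupp.mapDomain (toCircle b a))
      (heightMap_of_mem h)
    rw [← Finsupp.lmapDomain_apply ℤ ℤ, map_sub] at this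
    simpa using this
  exact this hv

theorem heightCircle_heightCircle (b a : Matching n) (v : Circle b a →₀ ℤ) :
    heightCircle b a (heightCircle b a v) = heightCircle b a v := by
  obtain ⟨w, rfl⟩ := Finsupp.mapDomain_surjective (toCircle_surjective b a) v
  rw [heightCircle_mapDomain, heightCircle_mapDomain]
  congr 1
  have : heightMap n ∘ₗ heightMap n = heightMap n := by
    refine Finsupp.lhom_ext' fun i => LinearMap.ext_ring ?_
    simp only [LinearMap.comp_apply, Finsupp.lsingle_apply, heightMap_single]
    exact heightMap_of_mem (heightVec_mem i)
  exact LinearMap.congr_fun this w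

/-- Heights are combinations of standard differences, which vanish on circles that contain the
standard arcs. -/
theorem heightCircle_std (b : Matching n) (v : Circle b (Matching.std n) →₀ ℤ) :
    heightCircle b (Matching.std n) v = 0 := by
  have : heightCircle b (Matching.std n) = 0 := by
    refine Finsupp.lhom_ext' fun s => LinearMap.ext_ring ?_
    obtain ⟨i, rfl⟩ := toCircle_surjective _ _ s
    simp only [LinearMap.comp_apply, Finsupp.lsingle_apply, heightCircle_single,
      LinearMap.zero_apply]
    exact mapDomain_eq_zero_of_mem_partnerSpan _ _ (toCircle_lower _ _) (heightVec_mem i)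
  rw [this, LinearMap.zero_apply]

end OddArc

namespace OddArc

variable {n : ℕ}

/-! ### Nonvanishing of the products with values in the standard column -/

/-- The component of a point. -/
def toComp (c b a : Matching n) (i : Fin (2 * n)) : Comp c b a := Quot.mk _ i

theorem toComp_left (c b a : Matching n) (i : Fin (2 * n)) :
    toComp c b a (c.partner i) = toComp c b a i := by
  exact Eq.symm (Quot.sound (r := fun i j => j = c.partner i ∨ j = b.partner i ∨ j = a.partner i)
    (Or.inl rfl))

theorem toComp_middle (c b a : Matching n) (i : Fin (2 * n)) :
    toComp c b a (b.partner i) = toComp c b a i := by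
  exact Eq.symm (Quot.sound (r := fun i j => j = c.partner i ∨ j = b.partner i ∨ j = a.partner i)
    (Or.inr (Or.inl rfl)))

theorem toComp_right (c b a : Matching n) (i : Fin (2 * n)) :
    toComp c b a (a.partner i) = toComp c b a i := by
  exact Eq.symm (Quot.sound (r := fun i j => j = c.partner i ∨ j = b.partner i ∨ j = a.partner i)
    (Or.inr (Or.inr rfl)))

/-- The map of components along a coarsening of the first matching. -/
def compHom {c c' b a : Matching n}
    (h : ∀ i, toComp c' b a (c.partner i) = toComp c' b a i) : Comp c b a → Comp c' b a :=
  Quot.lift (toComp c' b a) (by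
    rintro i j (rfl | rfl | rfl)
    exacts [(h i).symm, (toComp_middle c' b a i).symm, (toComp_right c' b a i).symm])

theorem compHom_surjective {c c' b a : Matching n}
    (h : ∀ i, toComp c' b a (c.partner i) = toComp c' b a i) :
    Function.Surjective (compHom h) := by
  rintro ⟨i⟩
  exact ⟨toComp c b a i, rfl⟩

theorem numComps_comm (c b a : Matching n) : numComps c b a = numComps b c a :=
  Nat.card_congr (Quot.congr (Equiv.refl _) fun i j => by
    simp only [Equiv.refl_apply]; tauto)

theorem numComps_rotate (c b a : Matching n) : numComps c b a = numComps b a c :=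
  Nat.card_congr (Quot.congr (Equiv.refl _) fun i j => by
    simp only [Equiv.refl_apply]; tauto)

theorem numComps_self_left (c b : Matching n) : numComps c c b = numCircles c b :=
  Nat.card_congr (Quot.congr (Equiv.refl _) fun i j => by
    simp only [Equiv.refl_apply]; tauto)

namespace Matching

variable {c : Matching n} {m : Fin (2 * n)}

/-- Since `a` already joins `m` to `j`, passing from `c` to the flip only cuts the connection
between `m` and its former partner. Either the two stay connected by other strands, or one component
falls apart into two. -/
theorem numComps_flip {j : Fin (2 * n)} (h : c.CanJoin m j) (b a : Matching n)
    (ha : a.partner m = j) :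
    (toComp (flip h) b a m = toComp (flip h) b a (c.partner m) ∧
      numComps (flip h) b a = numComps c b a) ∨
    numComps (flip h) b a = numComps c b a + 1 := by
  have hmj : ∀ d, toComp d b a m = toComp d b a j := fun d => by rw [← ha, toComp_right]
  have hdown : ∀ i, toComp c b a ((flip h).partner i) = toComp c b a i := by
    refine flip_invariant h (hmj c) ?_ fun x _ _ _ _ => toComp_left c b a x
    rw [toComp_left, toComp_left, hmj]
  have hup := eq_or_of_flip h (toComp_left (flip h) b a)
  by_cases huw : toComp (flip h) b a m = toComp (flip h) b a (c.partner m)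
  · refine Or.inl ⟨huw, le_antisymm ?_ ?_⟩
    · refine Nat.card_le_card_of_surjective _ (compHom_surjective fun i => ?_)
      rcases hup i with h' | ⟨h1 | h1, h2 | h2⟩
      · exact h'
      all_goals simp only [h1, h2, huw]
    · exact Nat.card_le_card_of_surjective _ (compHom_surjective hdown)
  · refine Or.inr (card_eq_add_one_of_pair_fiber (compHom hdown) (compHom_surjective hdown)
      (toComp (flip h) b a m) (toComp (flip h) b a (c.partner m)) huw ?_ ?_)
    · exact (toComp_left c b a m).symm
    · rintro ⟨x⟩ ⟨y⟩ hxy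
      refine quot_eq_or_pair (toComp (flip h) b a) _ _ ?_ hxy
      rintro x y (rfl | rfl | rfl)
      · rcases hup x with h | h
        exacts [Or.inl h.symm, Or.inr h.symm]
      · exact Or.inl (toComp_middle _ _ _ _).symm
      · exact Or.inl (toComp_right _ _ _ _).symm

theorem numCircles_flip_le {i j : Fin (2 * n)} (h : c.CanJoin i j) (b : Matching n)
    (hb : toCircle (flip h) b i = toCircle (flip h) b (c.partner i)) :
    numCircles (flip h) b ≤ numCircles c b := by
  refine numCircles_le_of_coarser (fun x => ?_) (toCircle_lower _ b)
  rcases eq_or_of_flip h (toCircle_upper (flip h) b) x with h' | ⟨h1 | h1, h2 | h2⟩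
  · exact h'
  all_goals simp only [h1, h2, hb]

/-- Let `j` be the standard partner of `m`. The points strictly between `m` and its partner in `c`,
apart from `j` and `c.partner j`, are matched among themselves by the flip, so their signs cancel.
If the arc of `c` starts at `m`, the four remaining terms cancel as well, because the flip joins `m`
to `j` and their old partners to each other. -/
theorem mapDomain_heightVec_flip {m : Fin (2 * n)} (hm : (m : ℕ) % 2 = 0)
    (h : c.CanJoin m ((std n).partner m)) {T : Type*} (f : Fin (2 * n) → T)
    (hf : ∀ i, f ((flip h).partner i) = f i) :
    Finsupp.mapDomain f (heightVec (c.partner m)) = Finsupp.mapDomain f (heightVec m) := by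
  have hj := std_even hm
  generalize hjd : (std n).partner m = j at *
  have hmk := c.parity_partner m
  have hjl := c.parity_partner j
  have hfmj : f j = f m := by rw [← flip_left h, hf]
  have hfkl : f (c.partner j) = f (c.partner m) := by rw [← flip_partner_left h, hf]
  have hmem : ∀ {S : Finset (Fin (2 * n))}, (∀ i ∈ S, (flip h).partner i ∈ S) →
      Finsupp.lmapDomain ℤ ℤ f (∑ i ∈ S, sgnVec i) = 0 := fun hS =>
    mapDomain_eq_zero_of_mem_partnerSpan _ f hf (sum_sgnVec_mem (flip h) _ hS)
  rw [← sub_eq_zero, ← Finsupp.lmapDomain_apply ℤ ℤ, ← Finsupp.lmapDomain_apply ℤ ℤ, ← map_sub]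
  have hne1 : c.partner m ≠ j := h.ne
  have hne2 : c.partner j ≠ m := h.ne'
  have hne3 : c.partner j ≠ c.partner m := by rw [ne_eq, partner_inj]; exact h.lt.ne'
  rcases lt_or_gt_of_ne (c.ne_self m) with hlt | hlt
  · rw [← neg_sub, map_neg, neg_eq_zero, heightVec_sub hlt (by omega), if_neg (by omega), zero_add]
    apply hmem
    intro x hx
    rw [Finset.mem_Ioo] at hx ⊢
    have hcx := c.noncrossing (c.partner m) x hx.1 (by rw [c.involutive]; exact hx.2)
    rw [c.involutive] at hcx
    have hxl : x ≠ c.partner j := by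
      rintro rfl
      rw [c.involutive] at hcx
      omega
    rw [flip_of_ne h hx.2.ne (by omega) hx.1.ne' hxl]
    exact hcx
  · have hl := c.noncrossing m j h.lt (by omega)
    have hsum : ∑ i ∈ Finset.Ioo m (c.partner m), sgnVec i = sgnVec j + (sgnVec (c.partner j) +
        ∑ i ∈ (Finset.Ioo m (c.partner m) \ {j, c.partner j}), sgnVec i) := by
      have hjl' : j ∉ ({c.partner j} : Finset (Fin (2 * n))) := by
        rw [Finset.mem_singleton]; exact (c.ne_self j).symm
      rw [← Finset.sum_sdiff (s₁ := {j, c.partner j}) (s₂ := Finset.Ioo m (c.partner m)) ?_,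
        Finset.sum_insert hjl', Finset.sum_singleton]
      · abel
      · intro x hx
        rw [Finset.mem_insert, Finset.mem_singleton] at hx
        rw [Finset.mem_Ioo]
        rcases hx with rfl | rfl
        · exact ⟨h.lt, by omega⟩
        · exact hl
    rw [heightVec_sub hlt hmk, if_pos hm, hsum, map_add, map_add, map_add, hmem ?_]
    · unfold sgnVec
      rw [if_neg (by omega), if_pos (by omega)]
      rw [map_sub, map_neg]
      simp only [Finsupp.lmapDomain_apply, Finsupp.mapDomain_single, hfmj, hfkl]
      abel
    · intro x hx
      simp only [Finset.mem_sdiff, Finset.mem_Ioo, Finset.mem_insert, Finset.mem_singleton,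
        not_or] at hx ⊢
      obtain ⟨⟨h1, h2⟩, h3, h4⟩ := hx
      rw [flip_of_ne h h1.ne' h3 h2.ne h4]
      refine ⟨c.noncrossing m x h1 h2, ?_, ?_⟩
      · rwa [partner_eq_iff]
      · rwa [partner_inj]

end Matching

/-- Products `Λ⁰ × Λ⁰` with values in the column of the standard matching do not vanish. -/
theorem Choice.numCircles_std (C : Choice n) (c b : Matching n) :
    numCircles c b + numCircles b (Matching.std n) + numCircles c (Matching.std n) =
      n + 2 * numComps c b (Matching.std n) := by
  set A := Matching.std n with hA
  induction hd : n - numCircles c A generalizing c with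
  | zero =>
    have h1 := C.numCircles_le c A
    have := C.eq_of_numCircles (c := c) (b := A) (by omega)
    rw [this, C.numCircles_self, numComps_rotate, numComps_rotate, numComps_self_left,
      numCircles_comm b A]
    omega
  | succ d ih =>
    have hcA : c ≠ A := by
      rintro rfl
      rw [C.numCircles_self] at hd
      omega
    obtain ⟨m, hm, hcm⟩ := Matching.exists_even_of_ne_std hcA
    have h := Matching.canJoin_std hm hcm
    have h1 : numCircles (Matching.flip h) A = numCircles c A + 1 := by
      rw [numCircles_comm, numCircles_comm c]
      exact Matching.numCircles_flip h rfl
    have hi := ih (Matching.flip h) (by omega)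
    have h2 := Matching.numCircles_flip_self h
    rw [C.numCircles_self] at h2
    obtain ⟨s, hs⟩ := C.exists_numCircles c (Matching.flip h) b
    have hle := (C c b A).numCircles_le c A
    rcases Matching.numComps_flip h b A rfl with ⟨hu, he⟩ | he
    · have hX : toCircle (Matching.flip h) b m = toCircle (Matching.flip h) b (c.partner m) := by
        by_contra hne
        have hu' : toComp (Matching.flip h) A b m = toComp (Matching.flip h) A b (c.partner m) :=
          quot_eq_of_rel (toComp (Matching.flip h) A b) (by
            rintro x y (rfl | rfl | rfl)
            exacts [(toComp_left _ _ _ _).symm, (toComp_right _ _ _ _).symm,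
              (toComp_middle _ _ _ _).symm]) hu
        have hmem := single_sub_single_arcSpan_of_quot_eq (Matching.flip h) A b hu'
        have hfix := heightCircle_eq_self _ _ hmem
        rw [map_sub, heightCircle_single, heightCircle_single,
          Matching.mapDomain_heightVec_flip hm h _ (toCircle_upper _ b), sub_self] at hfix
        have := sub_eq_zero.1 hfix.symm
        exact hne (Finsupp.single_left_injective one_ne_zero this)
      -- By parity the flip then has one circle fewer with `b`. The genus for `c` is thus at most
      -- that for the flip, which is zero, and it is not negative.
      have := Matching.numCircles_flip_le h b hX
      omega
    · omega

end OddArc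

namespace OddArc

variable {n : ℕ}

/-! ### Covers -/

/-- `c` and `b` are neighbours, and `c` is nearer to the standard matching. -/
def Cover (c b : Matching n) : Prop :=
  numCircles c b + 1 = n ∧ numCircles (Matching.std n) c = numCircles (Matching.std n) b + 1

theorem Choice.cover_flip (C : Choice n) {b : Matching n} {m : Fin (2 * n)}
    (h : b.CanJoin m ((Matching.std n).partner m)) : Cover (Matching.flip h) b := by
  refine ⟨?_, Matching.numCircles_flip h rfl⟩
  rw [numCircles_comm, ← Matching.numCircles_flip_self h, C.numCircles_self]

theorem Choice.cover_std (C : Choice n) {b : Matching n} :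
    Cover (Matching.std n) b ↔ numCircles (Matching.std n) b + 1 = n := by
  unfold Cover
  rw [C.numCircles_self]
  omega

/-- Moving a cover towards the standard matching. -/
theorem Choice.exists_cover_flip (C : Choice n) {c b : Matching n} (h : Cover c b)
    (hc : c ≠ Matching.std n) :
    ∃ c' b', Cover c' c ∧ Cover c' b' ∧ Cover b' b ∧ b' ≠ c := by
  obtain ⟨m, hm, hcm⟩ := Matching.exists_even_of_ne_std hc
  have hjc := Matching.canJoin_std hm hcm
  have hcc := C.cover_flip hjc
  have hbm : b.partner m ≠ (Matching.std n).partner m := by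
    intro hb
    have h1 := Matching.numCircles_flip hjc hb
    rw [numCircles_comm b c] at h1
    have h2 := C.eq_of_numCircles (h1.trans h.1)
    have h3 := hcc.2
    have h4 := h.2
    rw [← h2] at h3
    omega
  have hjb := Matching.canJoin_std hm hbm
  have hbb := C.cover_flip hjb
  refine ⟨_, _, hcc, ⟨?_, ?_⟩, hbb, ?_⟩
  · have h1 := Matching.numCircles_flip hjb (Matching.flip_left hjc)
    obtain ⟨s, hs⟩ := C.exists_numCircles (Matching.flip hjc) c b
    obtain ⟨t, ht⟩ := C.exists_numCircles (Matching.std n) (Matching.flip hjc) b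
    have := numCircles_comm (Matching.flip hjc) b
    have := numCircles_comm b (Matching.flip hjb)
    have := numCircles_comm (Matching.flip hjc) (Matching.flip hjb)
    have := hcc.1
    have := hcc.2
    have := h.1
    have := h.2
    omega
  · have := hcc.2
    have := hbb.2
    have := h.2
    omega
  · rintro rfl
    exact hcm (Matching.flip_left hjb)

/-- Neighbours of the standard matching join a pair of its arcs. -/
theorem Choice.partner_of_cover_std (C : Choice n) {D : Matching n} (h : Cover (Matching.std n) D)
    {m : Fin (2 * n)} (hm : (m : ℕ) % 2 = 0) (hD : D.partner m ≠ (Matching.std n).partner m) :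
    D.partner ((Matching.std n).partner m) = (Matching.std n).partner (D.partner m) ∧
      ∀ x, x ≠ m → x ≠ (Matching.std n).partner m → x ≠ D.partner m →
        x ≠ D.partner ((Matching.std n).partner m) → D.partner x = (Matching.std n).partner x := by
  have hj := Matching.canJoin_std hm hD
  have h1 := Matching.numCircles_flip hj rfl
  have h2 := C.eq_of_numCircles (h1.trans (C.cover_std.1 h))
  constructor
  · conv_rhs => rw [h2]
    exact (Matching.flip_partner_left hj).symm
  · intro x h3 h4 h5 h6
    conv_rhs => rw [h2]
    exact (Matching.flip_of_ne hj h3 h4 h5 h6).symm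

/-- A neighbour of the standard matching rearranges just two standard arcs, and the new partner of
one end point tells which two. -/
theorem Choice.cover_std_unique (C : Choice n) {D E : Matching n} (hD : Cover (Matching.std n) D)
    (hE : Cover (Matching.std n) E) {m : Fin (2 * n)} (hm : (m : ℕ) % 2 = 0)
    (h : D.partner m ≠ (Matching.std n).partner m) (hDE : D.partner m = E.partner m) : D = E := by
  obtain ⟨d1, d2⟩ := C.partner_of_cover_std hD hm h
  obtain ⟨e1, e2⟩ := C.partner_of_cover_std hE hm (hDE ▸ h)
  have hj : D.partner ((Matching.std n).partner m) = E.partner ((Matching.std n).partner m) := by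
    rw [d1, e1, hDE]
  refine Matching.ext fun x => ?_
  by_cases h1 : x = m
  · rw [h1, hDE]
  by_cases h2 : x = (Matching.std n).partner m
  · rw [h2, hj]
  by_cases h3 : x = D.partner m
  · rw [h3, D.involutive, hDE, E.involutive]
  by_cases h4 : x = D.partner ((Matching.std n).partner m)
  · rw [h4, D.involutive, hj, E.involutive]
  rw [d2 x h1 h2 h3 h4, e2 x h1 h2 (hDE ▸ h3) (hj ▸ h4)]

theorem Choice.exists_of_cover_std (C : Choice n) {D : Matching n}
    (hD : Cover (Matching.std n) D) : ∃ p q : Fin (2 * n), (p : ℕ) % 2 = 0 ∧ (q : ℕ) % 2 = 0 ∧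
      p < q ∧ (D.partner p : ℕ) = q + 1 := by
  have hne : D ≠ Matching.std n := by
    rintro rfl
    have := hD.1
    rw [C.numCircles_self] at this
    omega
  obtain ⟨m, hm, hDm⟩ := Matching.exists_even_of_ne_std hne
  obtain ⟨h1, -⟩ := C.partner_of_cover_std hD hm hDm
  have hp := D.parity_partner m
  have hs := Matching.std_even hm
  have hk := Matching.std_odd (i := D.partner m) (by omega)
  have hDm' : (D.partner m : ℕ) ≠ m + 1 := fun h => hDm (Fin.ext (h.trans hs.symm))
  have hlt := (D.partner m).isLt
  rcases lt_or_gt_of_ne (D.ne_self m) with h | h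
  · refine ⟨(Matching.std n).partner (D.partner m), m, by omega, hm, by omega, ?_⟩
    rw [← h1, D.involutive, hs]
  · exact ⟨m, ⟨D.partner m - 1, by omega⟩, hm, by change ((D.partner m : ℕ) - 1) % 2 = 0; omega,
      by rw [Fin.lt_def]; change (m : ℕ) < (D.partner m : ℕ) - 1; omega,
      by change (D.partner m : ℕ) = (D.partner m : ℕ) - 1 + 1; omega⟩

theorem Matching.std_canJoin {p q : Fin (2 * n)} (hp : (p : ℕ) % 2 = 0) (hq : (q : ℕ) % 2 = 0)
    (hpq : p < q) : (std n).CanJoin ((std n).partner p) q := by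
  have h1 := std_even hp
  refine ⟨by omega, ?_, fun x h2 h3 => ?_⟩
  · rw [partner_partner]; exact hpq.ne
  · rcases Nat.mod_two_eq_zero_or_one x with h | h
    · have := std_even h; omega
    · have := std_odd h; omega

theorem Choice.cover_std_flip (C : Choice n) {p q : Fin (2 * n)} (hp : (p : ℕ) % 2 = 0)
    (hq : (q : ℕ) % 2 = 0) (hpq : p < q) :
    Cover (Matching.std n) (Matching.flip (Matching.std_canJoin hp hq hpq)) := by
  rw [C.cover_std, ← Matching.numCircles_flip_self, C.numCircles_self]

theorem Choice.exists_flip (C : Choice n) {b : Matching n} {i j : Fin (2 * n)}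
    (h : b.CanJoin i j) : ∃ B : Matching n, numCircles b B + 1 = n ∧
      (∀ d : Matching n, d.partner i = j → numCircles d B = numCircles d b + 1) ∧
      B.partner i = j ∧ B.partner (b.partner i) = b.partner j ∧
      B.partner (b.partner j) = b.partner i ∧
      ∀ x, x ≠ i → x ≠ j → x ≠ b.partner i → x ≠ b.partner j → B.partner x = b.partner x :=
  ⟨Matching.flip h, by rw [← Matching.numCircles_flip_self, C.numCircles_self],
    fun _ => Matching.numCircles_flip h, Matching.flip_left h, Matching.flip_partner_left h,
    Matching.flip_partner_right h, fun _ => Matching.flip_of_ne h⟩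

/-- The matching with arcs `(p, r + 1)`, `(p + 1, q)`, `(q + 1, r)`. -/
theorem Choice.exists_three_arcs (C : Choice n) {p q r : Fin (2 * n)} (hp : (p : ℕ) % 2 = 0)
    (hq : (q : ℕ) % 2 = 0) (hr : (r : ℕ) % 2 = 0) (hpq : p < q) (hqr : q < r) :
    ∃ b : Matching n, numCircles (Matching.std n) b + 2 = n ∧
      b.partner ((Matching.std n).partner q) = r ∧ b.partner p = (Matching.std n).partner r ∧
      b.partner ((Matching.std n).partner p) = q := by
  have hj := Matching.std_canJoin hp hq hpq
  have hstd : ∀ x : Fin (2 * n), ((x : ℕ) % 2 = 0 ∧ ((Matching.std n).partner x : ℕ) = x + 1) ∨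
      ((x : ℕ) % 2 = 1 ∧ ((Matching.std n).partner x : ℕ) = x - 1) := fun x => by
    rcases Nat.mod_two_eq_zero_or_one x with h | h
    exacts [Or.inl ⟨h, Matching.std_even h⟩, Or.inr ⟨h, Matching.std_odd h⟩]
  have hself := C.numCircles_self (Matching.std n)
  have huniq : ∀ b, numCircles (Matching.std n) b = n → Matching.std n = b :=
    fun _ => C.eq_of_numCircles
  generalize Matching.std n = A at *
  obtain ⟨B, B0, -, B1, B2, -, B3⟩ := C.exists_flip hj
  rw [A.involutive] at B2 B3
  have sp := hstd p
  have sq := hstd q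
  have sr := hstd r
  have hBr : B.partner r = A.partner r :=
    B3 r (by omega) (by omega) (by omega) (by omega)
  have hB1' : B.partner (A.partner q) = p := by rw [← B2, B.involutive]
  have hj' : B.CanJoin (A.partner q) r := by
    refine ⟨by omega, ?_, fun x h2 h3 => ?_⟩
    · rw [hB1']
      exact (hpq.trans hqr).ne
    · have sx := hstd x
      rw [B3 x (by omega) (by omega) (by omega) (by omega)]
      omega
  obtain ⟨b, b0, -, b1, b2, -, b3⟩ := C.exists_flip hj'
  rw [hB1', hBr] at b2 b3
  have hbA : b.partner (A.partner p) = q := by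
    rw [b3 _ (by omega) (by omega) (by omega) (by omega), B1]
  refine ⟨b, ?_, b1, b2, hbA⟩
  have h3 : numCircles A b ≠ n := by
    intro h
    have := huniq b h
    rw [← this] at b2
    omega
  have h4 := C.numCircles_le A b
  obtain ⟨s, hs⟩ := C.exists_numCircles A B b
  obtain ⟨t, ht⟩ := C.exists_numCircles B b A
  rw [numCircles_comm b A, numCircles_comm B A] at ht
  omega

/-- Three neighbours of the standard matching below one matching. -/
theorem Choice.exists_three_covers (C : Choice n) {p q r : Fin (2 * n)} (hp : (p : ℕ) % 2 = 0)
    (hq : (q : ℕ) % 2 = 0) (hr : (r : ℕ) % 2 = 0) (hpq : p < q) (hqr : q < r) :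
    ∃ b D E F : Matching n, Cover (Matching.std n) D ∧ Cover (Matching.std n) E ∧
      Cover (Matching.std n) F ∧ Cover D b ∧ Cover E b ∧ Cover F b ∧ D ≠ E ∧ D ≠ F ∧ E ≠ F ∧
      (D.partner q : ℕ) = r + 1 ∧ (E.partner p : ℕ) = r + 1 ∧ (F.partner p : ℕ) = q + 1 := by
  obtain ⟨b, hb, b1, b2, b3⟩ := C.exists_three_arcs hp hq hr hpq hqr
  have sp := Matching.std_even hp
  have sq := Matching.std_even hq
  have sr := Matching.std_even hr
  have b1' : b.partner r = (Matching.std n).partner q := by rw [← b1, b.involutive]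
  have b2' : b.partner ((Matching.std n).partner r) = p := by rw [← b2, b.involutive]
  have b3' : b.partner q = (Matching.std n).partner p := by rw [← b3, b.involutive]
  -- Each of the three covers restores one of the three standard arcs in `b` and leaves the other
  -- two rearranged.
  have exists_down : ∀ m : Fin (2 * n), (m : ℕ) % 2 = 0 →
      b.partner m ≠ (Matching.std n).partner m → ∃ D : Matching n, Cover (Matching.std n) D ∧
        Cover D b ∧ D.partner m = (Matching.std n).partner m ∧
        D.partner (b.partner m) = b.partner ((Matching.std n).partner m) ∧
        D.partner (b.partner ((Matching.std n).partner m)) = b.partner m ∧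
        ∀ x, x ≠ m → x ≠ (Matching.std n).partner m → x ≠ b.partner m →
          x ≠ b.partner ((Matching.std n).partner m) → D.partner x = b.partner x := by
    intro m hm hbm
    have hj := Matching.canJoin_std hm hbm
    have hc := C.cover_flip hj
    refine ⟨_, ?_, hc, Matching.flip_left hj, Matching.flip_partner_left hj,
      Matching.flip_partner_right hj, fun _ => Matching.flip_of_ne hj⟩
    rw [C.cover_std]
    have := hc.2
    omega
  obtain ⟨D, D0, Db, D1, -, D2, -⟩ := exists_down p hp (by rw [b2]; omega)
  obtain ⟨E, E0, Eb, E1, -, -, E2⟩ := exists_down q hq (by rw [b3']; omega)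
  obtain ⟨F, F0, Fb, F1, -, F2, -⟩ := exists_down r hr (by rw [b1']; omega)
  rw [b3, b2] at D2
  rw [b2', b1'] at F2
  have E3 := E2 p (by omega) (by omega) (by omega) (by omega)
  rw [b2] at E3
  refine ⟨b, D, E, F, D0, E0, F0, Db, Eb, Fb, ?_, ?_, ?_, by omega, by omega, by omega⟩
  · rintro rfl
    omega
  · rintro rfl
    omega
  · rintro rfl
    omega

/-! ### Functions on covers that are invariant along squares -/

section Constant

variable {G : Type*} {κ : Matching n → Matching n → G}

/-- With standard arcs named by their left ends, `D`, `E`, `F` rearrange the pairs {q, r}, {p, r},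
{p, q}. All three cover one matching `b`, so any two of them form a square with `b` and the standard
matching. Two of them are compared through the edge from the third to `b`. -/
theorem Choice.cover_function_triple (C : Choice n)
    (hκ : ∀ c D E b, Cover c D → Cover c E → Cover D b → Cover E b → D ≠ E → κ c D = κ E b)
    {p q r : Fin (2 * n)} (hp : (p : ℕ) % 2 = 0)
    (hq : (q : ℕ) % 2 = 0) (hr : (r : ℕ) % 2 = 0) (hpq : p < q) (hqr : q < r)
    {D E F : Matching n} (hD : Cover (Matching.std n) D) (hE : Cover (Matching.std n) E)
    (hF : Cover (Matching.std n) F) (dq : (D.partner q : ℕ) = r + 1)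
    (ep : (E.partner p : ℕ) = r + 1) (fp : (F.partner p : ℕ) = q + 1) :
    κ (Matching.std n) D = κ (Matching.std n) E ∧ κ (Matching.std n) E = κ (Matching.std n) F := by
  obtain ⟨b, D', E', F', hD', hE', hF', Db, Eb, Fb, hDE, hDF, hEF, dq', ep', fp'⟩ :=
    C.exists_three_covers hp hq hr hpq hqr
  have sp := Matching.std_even hp
  have sq := Matching.std_even hq
  obtain rfl := C.cover_std_unique hD hD' hq (by omega) (Fin.ext (dq.trans dq'.symm))
  obtain rfl := C.cover_std_unique hE hE' hp (by omega) (Fin.ext (ep.trans ep'.symm))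
  obtain rfl := C.cover_std_unique hF hF' hp (by omega) (Fin.ext (fp.trans fp'.symm))
  refine ⟨?_, ?_⟩
  · rw [hκ _ D F b hD hF Db Fb hDF, hκ _ E F b hE hF Eb Fb hEF]
  · rw [hκ _ E D b hE hD Eb Db hDE.symm, hκ _ F D b hF hD Fb Db hDF.symm]

/-- The triple (0, p, q) replaces the pair {p, q} by {0, q}, and the triple (0, 2, q) replaces {0,
q} by {0, 2}, which is `D₀`. -/
theorem Choice.cover_function_std (C : Choice n)
    (hκ : ∀ c D E b, Cover c D → Cover c E → Cover D b → Cover E b → D ≠ E → κ c D = κ E b)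
    (hn : 2 ≤ n) {D₀ : Matching n} (hD₀ : Cover (Matching.std n) D₀)
    (h₀ : (D₀.partner ⟨0, by omega⟩ : ℕ) = 3) {D : Matching n} (hD : Cover (Matching.std n) D) :
    κ (Matching.std n) D = κ (Matching.std n) D₀ := by
  set o : Fin (2 * n) := ⟨0, by omega⟩ with ho
  have zero : ∀ q : Fin (2 * n), (q : ℕ) % 2 = 0 → o < q →
      ∀ E : Matching n, Cover (Matching.std n) E → (E.partner o : ℕ) = q + 1 →
      κ (Matching.std n) E = κ (Matching.std n) D₀ := by
    intro q hq hoq E hE he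
    by_cases hq2 : (q : ℕ) = 2
    · have so := Matching.std_even (n := n) (i := o) rfl
      have : (o : ℕ) = 0 := rfl
      rw [C.cover_std_unique hE hD₀ (m := o) rfl (by omega) (Fin.ext (by omega))]
    · have hoq' : 0 < (q : ℕ) := hoq
      have hlt : (⟨2, by omega⟩ : Fin (2 * n)) < q := by
        rw [Fin.lt_def]; change 2 < (q : ℕ); omega
      obtain ⟨_, D', _, _, hD', _, _, _, _, _, _, _, _, d, _, _⟩ :=
        C.exists_three_covers (p := o) (q := ⟨2, by omega⟩) (r := q) rfl (Nat.mod_self 2) hq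
          (by rw [Fin.lt_def]; exact Nat.two_pos) hlt
      exact (C.cover_function_triple hκ (p := o) (q := ⟨2, by omega⟩) (r := q) rfl (Nat.mod_self 2) hq
          (by rw [Fin.lt_def]; exact Nat.two_pos) hlt hD' hE hD₀ d he h₀).2
  obtain ⟨p, q, hp, hq, hpq, hd⟩ := C.exists_of_cover_std hD
  by_cases hop : p = o
  · subst hop
    exact zero q hq hpq D hD hd
  · have hop' : o < p := by
      rw [Fin.lt_def]
      exact Nat.pos_of_ne_zero fun h => hop (Fin.ext h)
    obtain ⟨_, _, E', F', _, hE', hF', _, _, _, _, _, _, _, e, f⟩ :=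
      C.exists_three_covers (p := o) (q := p) (r := q) rfl hp hq hop' hpq
    rw [(C.cover_function_triple hκ (p := o) (q := p) (r := q) rfl hp hq hop' hpq hD hE' hF'
      hd e f).1]
    exact zero q hq (hop'.trans hpq) E' hE' e

/-- A function on covers that takes the same values on opposite sides of squares is constant. -/
theorem Choice.cover_function_eq (C : Choice n)
    (hκ : ∀ c D E b, Cover c D → Cover c E → Cover D b → Cover E b → D ≠ E → κ c D = κ E b)
    (hn : 2 ≤ n) {D₀ : Matching n} (hD₀ : Cover (Matching.std n) D₀)
    (h₀ : (D₀.partner ⟨0, by omega⟩ : ℕ) = 3) {c b : Matching n} (h : Cover c b) :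
    κ c b = κ (Matching.std n) D₀ := by
  induction hd : n - numCircles (Matching.std n) c using Nat.strong_induction_on generalizing c b
    with
  | _ d ih =>
    by_cases hc : c = Matching.std n
    · subst hc
      exact C.cover_function_std hκ hn hD₀ h₀ h
    · obtain ⟨c', b', h1, h2, h3, h4⟩ := C.exists_cover_flip h hc
      -- Opposite sides of a square: the cover is moved one step towards the standard matching.
      rw [← hκ c' b' c b h2 h1 h3 h h4]
      have := h1.2
      have := C.numCircles_le (Matching.std n) c'
      exact ih _ (by omega) h2 rfl

theorem Choice.exists_cover_std (C : Choice n) (hn : 2 ≤ n) :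
    ∃ D₀ : Matching n, Cover (Matching.std n) D₀ ∧ (D₀.partner ⟨0, by omega⟩ : ℕ) = 3 := by
  have h := C.cover_std_flip (p := ⟨0, by omega⟩) (q := ⟨2, by omega⟩) rfl (Nat.mod_self 2)
    (by rw [Fin.lt_def]; exact Nat.two_pos)
  refine ⟨_, h, ?_⟩
  have := Matching.flip_partner_left (Matching.std_canJoin (n := n) (p := ⟨0, by omega⟩)
    (q := ⟨2, by omega⟩) rfl (Nat.mod_self 2) (by rw [Fin.lt_def]; exact Nat.two_pos))
  rw [Matching.partner_partner] at this
  rw [this, Matching.std_even (Nat.mod_self 2)]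

end Constant

end OddArc

namespace OddArc

variable {n : ℕ}

/-! ### Cochains on triples of matchings -/

/-- The number of splits in the multiplication cobordism. -/
def Choice.splits (C : Choice n) (c b a : Matching n) : ℕ := (C b b b).numSplits c a

theorem Choice.splits_spec (C : Choice n) (c b a : Matching n) :
    n + numCircles c a = numCircles c b + numCircles b a + 2 * C.splits c b a :=
  (C b b b).numSplits_spec c a

/-- Both bracketings of a triple product land in the same exterior degree; without this the cocycle
relation for rescalings would not make sense. -/
theorem Choice.splits_assoc (C : Choice n) (d c b a : Matching n) :
    C.splits d c b + C.splits d b a = C.splits c b a + C.splits d c a := by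
  have := C.splits_spec d c b
  have := C.splits_spec d b a
  have := C.splits_spec c b a
  have := C.splits_spec d c a
  omega

theorem Choice.splits_self_left (C : Choice n) (b a : Matching n) : C.splits b b a = 0 := by
  have := C.splits_spec b b a
  have := C.numCircles_self b
  omega

theorem Choice.splits_self_right (C : Choice n) (b a : Matching n) : C.splits b a a = 0 := by
  have := C.splits_spec b a a
  have := C.numCircles_self a
  omega

/-- Properties of the nonvanishing of products of two (`V`) and three (`Q`) homogeneous elements
in terms of the total exterior degree. -/
structure Nonvanishing (C : Choice n) (V : Matching n → Matching n → Matching n → ℕ → Prop)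
    (Q : Matching n → Matching n → Matching n → Matching n → ℕ → Prop) : Prop where
  mono : ∀ c b a s t, s ≤ t → V c b a t → V c b a s
  std : ∀ c b, V c b (Matching.std n) 0
  std_one : ∀ c b, 0 < n → V c b (Matching.std n) 1
  pos : ∀ c b a, V c b a 1 → 0 < n
  rotate : ∀ c b a, C.splits c b a = 0 → V c a b 0
  left : ∀ d c b a t, C.splits d c b = 0 → V d b a t → Q d c b a t
  right : ∀ d c b a t, C.splits c b a = 0 → V d c a t → Q d c b a t
  left_factor : ∀ d c b a t, Q d c b a t → V d c b t
  left_product : ∀ d c b a t, Q d c b a t → V d b a (t + C.splits d c b)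
  right_factor : ∀ d c b a t, Q d c b a t → V c b a t
  right_product : ∀ d c b a t, Q d c b a t → V d c a (t + C.splits c b a)

variable {G : Type*} [AddCommGroup G]

/-- The cocycle relation for associative rescalings of the product. -/
def AssocRel (C : Choice n) (σ : Matching n → Matching n → Matching n → ℕ → ℕ → G)
    (d c b a : Matching n) (p q r : ℕ) : Prop :=
  σ d c b p q + σ d b a (p + q + C.splits d c b) r =
    σ c b a q r + σ d c a p (q + r + C.splits c b a)

/-- Cocycles: the relation holds where triple products do not vanish. -/
def IsAssocCocycle (C : Choice n) (Q : Matching n → Matching n → Matching n → Matching n → ℕ → Prop)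
    (σ : Matching n → Matching n → Matching n → ℕ → ℕ → G) : Prop :=
  ∀ d c b a p q r, Q d c b a (p + q + r) → AssocRel C σ d c b a p q r

/-- The change of the product under a rescaling of the homogeneous components. -/
def coboundary (C : Choice n) (θ : Matching n → Matching n → ℕ → G)
    (c b a : Matching n) (p q : ℕ) : G :=
  θ c b p + θ b a q - θ c a (p + q + C.splits c b a)

theorem assocRel_coboundary (C : Choice n) (θ : Matching n → Matching n → ℕ → G)
    (d c b a : Matching n) (p q r : ℕ) : AssocRel C (coboundary C θ) d c b a p q r := by
  unfold AssocRel coboundary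
  have h : p + q + C.splits d c b + r + C.splits d b a =
      p + (q + r + C.splits c b a) + C.splits d c a := by
    have := C.splits_assoc d c b a
    omega
  rw [h]
  abel

theorem IsAssocCocycle.sub_coboundary {C : Choice n}
    {Q : Matching n → Matching n → Matching n → Matching n → ℕ → Prop}
    {σ : Matching n → Matching n → Matching n → ℕ → ℕ → G} (h : IsAssocCocycle C Q σ)
    (θ : Matching n → Matching n → ℕ → G) : IsAssocCocycle C Q (σ - coboundary C θ) := by
  intro d c b a p q r hq
  have h1 := h d c b a p q r hq
  have h2 := assocRel_coboundary C θ d c b a p q r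
  unfold AssocRel at *
  simp only [Pi.sub_apply]
  rw [sub_add_sub_comm, sub_add_sub_comm, h1, h2]

theorem coboundary_add (C : Choice n) (θ θ' : Matching n → Matching n → ℕ → G) :
    coboundary C (θ + θ') = coboundary C θ + coboundary C θ' := by
  funext c b a p q
  simp only [coboundary, Pi.add_apply]
  abel

/-- An invariant of cochains under coboundaries. -/
def atomInvariant (σ : Matching n → Matching n → Matching n → ℕ → ℕ → G) (D : Matching n) : G :=
  σ D (Matching.std n) D 0 0 + σ D D (Matching.std n) 1 0 - σ (Matching.std n) D (Matching.std n) 0 0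
    - σ D (Matching.std n) (Matching.std n) 0 1

theorem Choice.splits_of_neighbour (C : Choice n) {c b : Matching n} (h : numCircles c b + 1 = n) :
    C.splits c b c = 1 := by
  have h1 := C.splits_spec c b c
  have h2 := C.numCircles_self c
  have h4 := numCircles_comm c b
  omega

/-- Each of the round trips between `D` and the standard matching has exactly one split, so the
terms of `θ` in degree one that they produce cancel against those of the two degree-one corrections.
For a normalized cocycle these corrections vanish and only the round trip from `D` survives. -/
theorem atomInvariant_sub_coboundary (C : Choice n)
    (σ : Matching n → Matching n → Matching n → ℕ → ℕ → G)
    (θ : Matching n → Matching n → ℕ → G) {D : Matching n} (hD : Cover (Matching.std n) D) :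
    atomInvariant (σ - coboundary C θ) D = atomInvariant σ D := by
  have h1 := C.splits_of_neighbour hD.1
  have h2 := C.splits_of_neighbour (numCircles_comm (Matching.std n) D ▸ hD.1)
  simp only [atomInvariant, coboundary, Pi.sub_apply, h1, h2, C.splits_self_left,
    C.splits_self_right, zero_add, add_zero]
  abel

/-! ### Normalization of cocycles by coboundaries -/

namespace IsAssocCocycle

variable {C : Choice n} {V : Matching n → Matching n → Matching n → ℕ → Prop}
  {Q : Matching n → Matching n → Matching n → Matching n → ℕ → Prop}
  {σ : Matching n → Matching n → Matching n → ℕ → ℕ → G}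

/-- Every cocycle is cohomologous to one that vanishes on products with `b(OH)b` from the left. -/
theorem exists_unital (hV : Nonvanishing C V Q) (h : IsAssocCocycle C Q σ) :
    ∃ θ : Matching n → Matching n → ℕ → G, ∀ b a p q, V b b a (p + q) →
      (σ - coboundary C θ) b b a p q = 0 := by
  classical
  -- The relation for (b, b, b, a) in degrees (1, p, q) is a recurrence in `p`; `θ` is built from
  -- the partial sums that solve it. The extra term for `b = a` accounts for the initial value in
  -- degree zero.
  refine ⟨fun b a p => (if b = a then σ b b b 0 0 else 0) - ∑ k ∈ Finset.range p, σ b b a 1 k, ?_⟩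
  intro b a p q hv
  have hz : ∀ q, V b b a q → σ b b a 0 q = σ b b b 0 0 := by
    intro q hq
    have := h b b b a 0 0 q (hV.left _ _ _ _ _ (C.splits_self_left b b) (by simpa using hq))
    simp only [AssocRel, C.splits_self_left, zero_add, add_zero] at this
    exact (add_right_cancel this).symm
  have key : ∀ p, V b b a (p + q) → σ b b a p q + ∑ k ∈ Finset.range q, σ b b a 1 k +
      ∑ k ∈ Finset.range p, σ b b b 1 k =
        σ b b b 0 0 + ∑ k ∈ Finset.range (p + q), σ b b a 1 k := by
    intro p
    induction p with
    | zero =>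
      intro hv
      rw [zero_add] at hv ⊢
      rw [hz q hv]
      simp
    | succ p ih =>
      intro hv
      have h1 := ih (hV.mono _ _ _ _ _ (by omega) hv)
      have h2 := h b b b a 1 p q (hV.left _ _ _ _ _ (C.splits_self_left b b)
        (by rwa [add_comm 1 p]))
      simp only [AssocRel, C.splits_self_left, add_zero] at h2
      rw [add_comm 1 p] at h2
      have e : p + 1 + q = (p + q) + 1 := by omega
      rw [e, Finset.sum_range_succ _ (p + q), Finset.sum_range_succ _ p, ← add_assoc (σ b b b 0 0), ← h1]
      have h3 : σ b b a (p + 1) q = σ b b a p q + σ b b a 1 (p + q) - σ b b b 1 p :=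
        eq_sub_of_add_eq' h2
      rw [h3]
      abel
  have hk := key p hv
  simp only [Pi.sub_apply, coboundary, C.splits_self_left, add_zero, if_true]
  rw [sub_eq_zero]
  have h3 : σ b b a p q = σ b b b 0 0 + ∑ k ∈ Finset.range (p + q), σ b b a 1 k -
      ∑ k ∈ Finset.range p, σ b b b 1 k - ∑ k ∈ Finset.range q, σ b b a 1 k := by
    rw [← hk]; abel
  rw [h3]
  abel

/-- Every unital cocycle is cohomologous to one that does not depend on the exterior degrees. -/
theorem exists_constant (hV : Nonvanishing C V Q) (h : IsAssocCocycle C Q σ)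
    (hu : ∀ b a p q, V b b a (p + q) → σ b b a p q = 0) :
    ∃ θ : Matching n → Matching n → ℕ → G,
      (∀ b a p q, V b b a (p + q) → (σ - coboundary C θ) b b a p q = 0) ∧
      ∀ c b a p q, V c b a (p + q) →
        (σ - coboundary C θ) c b a p q = (σ - coboundary C θ) c b a 0 0 := by
  set A := Matching.std n with hA
  -- Repeating the first matching lets degree be moved out of the left factor.
  have hp : ∀ c b a p q, V c b a (p + q) → σ c b a p q = σ c b a 0 q := by
    intro c b a p q hv
    have hQ := hV.left c c b a (p + q) (C.splits_self_left c b) hv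
    have := h c c b a p 0 q (by simpa using hQ)
    simp only [AssocRel, C.splits_self_left, zero_add, add_zero] at this
    rw [hu c b p 0 (hV.mono _ _ _ _ _ (by omega) (hV.left_factor _ _ _ _ _ hQ)),
      hu c a p _ (by rw [← add_assoc]; exact hV.right_product _ _ _ _ _ hQ), zero_add,
      add_zero] at this
    exact this
  -- Repeating the middle matching gives a recurrence whose solution is affine in `q`.
  have hq : ∀ c b a q, V c b a q → σ c b a 0 q = σ c b a 0 0 + q • σ c b b 0 1 := by
    intro c b a q
    induction q with
    | zero => simp
    | succ q ih =>
      intro hv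
      have hQ := hV.left c b b a (q + 1) (C.splits_self_right c b) hv
      have := h c b b a 0 1 q (by rw [zero_add, add_comm]; exact hQ)
      simp only [AssocRel, C.splits_self_left, C.splits_self_right, zero_add, add_zero] at this
      rw [hu b a 1 q (by rw [add_comm]; exact hV.right_factor _ _ _ _ _ hQ), zero_add,
        hp c b a 1 q (by rwa [add_comm]), ih (hV.mono _ _ _ _ _ (by omega) hv), add_comm 1 q] at this
      rw [← this, succ_nsmul]
      abel
  -- Comparison in the standard column, where products of degree one do not vanish, makes the slope
  -- a difference of a term in `c` and a term in `b`. A linear `θ` can absorb it.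
  have hr : ∀ c b, 0 < n → σ c b b 0 1 = σ c A A 0 1 - σ b A A 0 1 := by
    intro c b hn
    have hv := hV.std_one c b hn
    have hQ := hV.right c b A A 1 (C.splits_self_right b A) hv
    have := h c b A A 0 0 1 (by simpa using hQ)
    simp only [AssocRel, C.splits_self_right, zero_add, add_zero] at this
    rw [hp c A A _ 1 (by rw [add_comm]; exact hV.left_product _ _ _ _ _ hQ), hq c b A 1 hv,
      one_smul] at this
    rw [eq_sub_iff_add_eq]
    have h2 : σ c b A 0 0 + σ c A A 0 1 = σ c b A 0 0 + (σ b A A 0 1 + σ c b b 0 1) := by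
      rw [this]; abel
    rw [add_left_cancel h2]
    abel
  have hc : ∀ c b a p q, V c b a (p + q) →
      σ c b a p q = σ c b a 0 0 + (q • σ c A A 0 1 - q • σ b A A 0 1) := by
    intro c b a p q hv
    rw [hp c b a p q hv, hq c b a q (hV.mono _ _ _ _ _ (by omega) hv)]
    rcases Nat.eq_zero_or_pos q with h0 | h0
    · simp [h0]
    · rw [hr c b (hV.pos c b a (hV.mono _ _ _ _ _ (by omega) hv)), smul_sub]
  -- Besides the slope, the coboundary of this `θ` has a term proportional to the number of splits.
  -- It does not involve the degrees and is absent when the first two matchings agree.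
  refine ⟨fun b _ p => - (p • σ b A A 0 1), ?_, ?_⟩
  · intro b a p q hv
    simp only [Pi.sub_apply, coboundary, C.splits_self_left, hu b a p q hv, add_smul, zero_smul]
    abel
  · intro c b a p q hv
    simp only [Pi.sub_apply, coboundary, hc c b a p q hv, add_smul, zero_smul]
    abel

theorem right_unital (hV : Nonvanishing C V Q) (h : IsAssocCocycle C Q σ)
    (hu : ∀ b a p q, V b b a (p + q) → σ b b a p q = 0) (c b : Matching n) (hv : V c b b 0) :
    σ c b b 0 0 = 0 := by
  have hQ := hV.left c b b b 0 (C.splits_self_right c b) hv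
  have := h c b b b 0 0 0 hQ
  simp only [AssocRel, C.splits_self_right, add_zero] at this
  rw [hu b b 0 0 (hV.right_factor _ _ _ _ _ hQ)] at this
  exact add_right_cancel this

/-- Normalization on the column of the standard matching. -/
theorem exists_std_zero (hV : Nonvanishing C V Q) (h : IsAssocCocycle C Q σ)
    (hu : ∀ b a p q, V b b a (p + q) → σ b b a p q = 0)
    (hc : ∀ c b a p q, V c b a (p + q) → σ c b a p q = σ c b a 0 0) :
    ∃ θ : Matching n → Matching n → ℕ → G,
      (∀ b a p q, V b b a (p + q) → (σ - coboundary C θ) b b a p q = 0) ∧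
      (∀ c b a p q, V c b a (p + q) →
        (σ - coboundary C θ) c b a p q = (σ - coboundary C θ) c b a 0 0) ∧
      ∀ c b, (σ - coboundary C θ) c b (Matching.std n) 0 0 = 0 := by
  -- On the standard column the coboundary of this `θ` is `σ c b A + σ b A A - σ c A A` in degrees
  -- zero, and the last two terms vanish by `right_unital`.
  refine ⟨fun c b _ => σ c b (Matching.std n) 0 0, ?_, ?_, ?_⟩
  · intro b a p q hv
    simp only [Pi.sub_apply, coboundary, hu b a p q hv, hu b (Matching.std n) 0 0 (hV.std b b)]
    abel
  · intro c b a p q hv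
    simp only [Pi.sub_apply, coboundary, hc c b a p q hv]
  · intro c b
    simp only [Pi.sub_apply, coboundary, fun b => right_unital hV h hu b _ (hV.std b _)]
    abel

end IsAssocCocycle

/-- Normalized cocycles. -/
structure IsNormalized (C : Choice n) (V : Matching n → Matching n → Matching n → ℕ → Prop)
    (Q : Matching n → Matching n → Matching n → Matching n → ℕ → Prop)
    (σ : Matching n → Matching n → Matching n → ℕ → ℕ → G) : Prop where
  cocycle : IsAssocCocycle C Q σ
  unital : ∀ b a p q, V b b a (p + q) → σ b b a p q = 0
  constant : ∀ c b a p q, V c b a (p + q) → σ c b a p q = σ c b a 0 0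
  std_zero : ∀ c b, σ c b (Matching.std n) 0 0 = 0

/-! ### Vanishing of normalized cocycles -/

namespace IsNormalized

variable {C : Choice n} {V : Matching n → Matching n → Matching n → ℕ → Prop}
  {Q : Matching n → Matching n → Matching n → Matching n → ℕ → Prop}
  {σ : Matching n → Matching n → Matching n → ℕ → ℕ → G}

theorem rel (hV : Nonvanishing C V Q) (h : IsNormalized C V Q σ) {d c b a : Matching n}
    (hQ : Q d c b a 0) : σ d c b 0 0 + σ d b a 0 0 = σ c b a 0 0 + σ d c a 0 0 := by
  have := h.cocycle d c b a 0 0 0 hQ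
  simp only [AssocRel, zero_add] at this
  rwa [h.constant d b a _ 0 (by
      have := hV.left_product _ _ _ _ _ hQ
      rwa [zero_add] at this), h.constant d c a 0 _ (by
      have := hV.right_product _ _ _ _ _ hQ
      rwa [zero_add] at this ⊢)] at this

/-- Three of the four terms in the relation for `d`, `c`, `b` and the standard matching lie in the
standard column. The relation is available since, without splits in the first product, the triple
product does not vanish there. -/
theorem eq_zero_of_splits (hV : Nonvanishing C V Q) (h : IsNormalized C V Q σ)
    {d c b : Matching n} (hs : C.splits d c b = 0) : σ d c b 0 0 = 0 := by
  have := h.rel hV (hV.left d c b (Matching.std n) 0 hs (hV.std d b))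
  rwa [h.std_zero, h.std_zero, h.std_zero, add_zero, add_zero] at this

/-- The way from the standard matching to `b` may be taken through `c` without splits, so the same
comparison with the standard column applies to the round trip from `c` to `b`. The round trip in the
other sense is not controlled in this way. -/
theorem eq_zero_of_cover (hV : Nonvanishing C V Q) (h : IsNormalized C V Q σ)
    {c b : Matching n} (hcb : Cover c b) : σ c b c 0 0 = 0 := by
  have hs : C.splits b c (Matching.std n) = 0 := by
    have := C.splits_spec b c (Matching.std n)
    have := numCircles_comm c b
    have := numCircles_comm c (Matching.std n)
    have := numCircles_comm b (Matching.std n)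
    have := hcb.1
    have := hcb.2
    omega
  have := h.rel hV (hV.right c b c (Matching.std n) 0 hs (hV.std c b))
  rwa [h.std_zero, h.std_zero, h.std_zero, add_zero, add_zero] at this

/-- The round trips at `D` and at `b` are joined by the chain (D, c, D), (b, c, D), (b, E, D), (b,
E, b). Consecutive members occur in one relation whose other two terms have no splits, because `b`,
`c` and likewise `D`, `E` are at distance two. -/
theorem square (hV : Nonvanishing C V Q) (h : IsNormalized C V Q σ) {c D E b : Matching n}
    (hcD : Cover c D) (hcE : Cover c E) (hDb : Cover D b) (hEb : Cover E b) (hDE : D ≠ E) :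
    σ D c D 0 0 = σ b E b 0 0 := by
  have e1 := numCircles_comm c D
  have e2 := numCircles_comm c E
  have e3 := numCircles_comm D b
  have e4 := numCircles_comm E b
  have e5 := numCircles_comm c b
  have e6 := numCircles_comm D E
  have c1 := hcD.1
  have c2 := hcE.1
  have c3 := hDb.1
  have c4 := hEb.1
  have hbc : numCircles b c + 2 = n := by
    have := hcD.2
    have := hDb.2
    have := C.splits_spec b D c
    have := C.splits_spec (Matching.std n) c b
    omega
  have hED : numCircles E D + 2 = n := by
    have h1 := C.splits_spec E c D
    have h2 := C.splits_spec E D c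
    have h3 := C.numCircles_le E D
    have h4 : numCircles E D ≠ n := fun h => hDE (C.eq_of_numCircles h).symm
    omega
  have s1 : C.splits b D c = 0 := by have := C.splits_spec b D c; omega
  have s2 : C.splits b E c = 0 := by have := C.splits_spec b E c; omega
  have s3 : C.splits E c D = 0 := by have := C.splits_spec E c D; omega
  have s4 : C.splits E b D = 0 := by have := C.splits_spec E b D; omega
  have hv : V b c D 0 := hV.rotate b D c s1
  have q1 := hV.left b D c D 0 s1 hv
  have r1 := h.rel hV q1
  rw [h.eq_zero_of_splits hV s1, h.eq_zero_of_splits hV (C.splits_self_right b D), zero_add,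
    add_zero] at r1
  have q2 := hV.left b E c D 0 s2 hv
  have r2 := h.rel hV q2
  rw [h.eq_zero_of_splits hV s2, h.eq_zero_of_splits hV s3, zero_add, zero_add] at r2
  have hv' : V b E D 0 := hV.mono _ _ _ _ _ (Nat.zero_le _) (hV.right_product _ _ _ _ _ q2)
  have r3 := h.rel hV (hV.right b E b D 0 s4 hv')
  rw [h.eq_zero_of_splits hV s4, h.eq_zero_of_splits hV (C.splits_self_left b D), zero_add,
    add_zero] at r3
  rw [← r1, r2, r3]

/-- A normalized cocycle that vanishes on covers vanishes. -/
theorem eq_zero (hV : Nonvanishing C V Q) (h : IsNormalized C V Q σ)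
    (hκ : ∀ c b, Cover c b → σ b c b 0 0 = 0) {d c b : Matching n} (hv : V d c b 0) :
    σ d c b 0 0 = 0 := by
  have key : ∀ b c, numCircles b c + 1 = n → σ b c b 0 0 = 0 := by
    intro b c hbc
    have h1 := C.splits_spec (Matching.std n) c b
    have h2 := C.splits_spec (Matching.std n) b c
    have h3 := numCircles_comm b c
    rcases Nat.lt_or_ge (numCircles (Matching.std n) b) (numCircles (Matching.std n) c) with hlt | hle
    · exact hκ c b ⟨by omega, by omega⟩
    · exact h.eq_zero_of_cover hV ⟨hbc, by omega⟩
  induction hk : n - numCircles c b using Nat.strong_induction_on generalizing d c b with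
  | _ k ih =>
    have hle := C.numCircles_le c b
    -- Here `k` is the distance between `c` and `b`. For distance at least two a geodesic neighbour
    -- of `b` breaks it into shorter steps; otherwise the value is zero or that of a round trip
    -- between neighbours.
    rcases Nat.lt_or_ge 1 k with h1 | h1
    · have hne : b ≠ c := by
        rintro rfl
        have := C.numCircles_self b
        omega
      obtain ⟨e, he1, he2⟩ := C.exists_geodesic hne
      have e1 := numCircles_comm b e
      have e2 := numCircles_comm b c
      have s1 : C.splits c e b = 0 := by have := C.splits_spec c e b; omega
      have hQ := hV.right d c e b 0 s1 hv
      have hr := h.rel hV hQ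
      have v1 := hV.left_factor _ _ _ _ _ hQ
      have v2 := hV.mono _ _ _ _ _ (Nat.zero_le _) (hV.left_product _ _ _ _ _ hQ)
      rw [ih (n - numCircles c e) (by omega) v1 rfl, ih (n - numCircles e b) (by omega) v2 rfl,
        h.eq_zero_of_splits hV s1, zero_add, zero_add] at hr
      exact hr.symm
    · by_cases hs : C.splits d c b = 0
      · exact h.eq_zero_of_splits hV hs
      have hsp := C.splits_spec d c b
      have hdc := C.splits_spec d b c
      have e1 := numCircles_comm c b
      have s1 : C.splits d b c = 0 := by omega
      have hr := h.rel hV (hV.left d b c b 0 s1 hv)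
      rw [h.eq_zero_of_splits hV s1, h.eq_zero_of_splits hV (C.splits_self_right d b),
        zero_add, add_zero] at hr
      rw [hr]
      refine key b c ?_
      have := C.numCircles_le d c
      omega

end IsNormalized

theorem IsAssocCocycle.exists_normalized {C : Choice n}
    {V : Matching n → Matching n → Matching n → ℕ → Prop}
    {Q : Matching n → Matching n → Matching n → Matching n → ℕ → Prop}
    {σ : Matching n → Matching n → Matching n → ℕ → ℕ → G}
    (hV : Nonvanishing C V Q) (h : IsAssocCocycle C Q σ) :
    ∃ θ : Matching n → Matching n → ℕ → G, IsNormalized C V Q (σ - coboundary C θ) := by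
  obtain ⟨θ₁, h₁⟩ := h.exists_unital hV
  have g₁ := h.sub_coboundary θ₁
  obtain ⟨θ₂, h₂, h₂'⟩ := g₁.exists_constant hV h₁
  have g₂ := g₁.sub_coboundary θ₂
  obtain ⟨θ₃, h₃, h₃', h₃''⟩ := g₂.exists_std_zero hV h₂ h₂'
  refine ⟨θ₁ + (θ₂ + θ₃), ?_⟩
  rw [coboundary_add, coboundary_add, ← sub_sub, ← sub_sub]
  exact ⟨g₂.sub_coboundary θ₃, h₃, h₃', h₃''⟩

/-- A cocycle with vanishing invariant is a coboundary where products do not vanish. -/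
theorem IsAssocCocycle.exists_eq_coboundary {C : Choice n}
    {V : Matching n → Matching n → Matching n → ℕ → Prop}
    {Q : Matching n → Matching n → Matching n → Matching n → ℕ → Prop}
    {σ : Matching n → Matching n → Matching n → ℕ → ℕ → G}
    (hV : Nonvanishing C V Q) (h : IsAssocCocycle C Q σ)
    (hI : ∀ hn : 2 ≤ n, ∃ D₀, Cover (Matching.std n) D₀ ∧
      (D₀.partner ⟨0, by omega⟩ : ℕ) = 3 ∧ atomInvariant σ D₀ = 0) :
    ∃ θ : Matching n → Matching n → ℕ → G, ∀ c b a p q, V c b a (p + q) →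
      σ c b a p q = coboundary C θ c b a p q := by
  obtain ⟨θ, hθ⟩ := h.exists_normalized hV
  refine ⟨θ, fun c b a p q hv => ?_⟩
  rw [← sub_eq_zero]
  change (σ - coboundary C θ) c b a p q = 0
  rw [hθ.constant c b a p q hv]
  refine hθ.eq_zero hV (fun c b hcb => ?_) (hV.mono _ _ _ _ _ (Nat.zero_le _) hv)
  -- A cover has `n - 1` circles, and a nonempty diagram has at least one.
  have hn : 2 ≤ n := by
    have h1 := hcb.1
    have h2 := hcb.2
    have h3 := C.splits_spec (Matching.std n) c b
    have h4 := C.numCircles_le (Matching.std n) c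
    by_contra hn
    have hpos : 0 < n := by omega
    have : 0 < numCircles c b := by
      have : Nonempty (Circle c b) := ⟨toCircle c b ⟨0, by omega⟩⟩
      exact Nat.card_pos
    omega
  obtain ⟨D₀, hD₀, h₀, hI₀⟩ := hI hn
  rw [C.cover_function_eq (κ := fun c b => (σ - coboundary C θ) b c b 0 0)
    (fun c D E b hcD hcE hDb hEb hDE => hθ.square hV hcD hcE hDb hEb hDE) hn hD₀ h₀ hcb]
  rw [← atomInvariant_sub_coboundary C σ θ hD₀] at hI₀
  unfold atomInvariant at hI₀
  have u1 := hθ.unital D₀ (Matching.std n) 1 0 (hV.std_one _ _ (by omega))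
  have u2 := hθ.eq_zero_of_cover hV hD₀
  have u3 := hθ.constant D₀ (Matching.std n) (Matching.std n) 0 1 (hV.std_one _ _ (by omega))
  rw [hθ.std_zero] at u3
  rw [u1, u2, u3, add_zero, sub_zero, sub_zero] at hI₀
  exact hI₀

end OddArc

namespace OddArc

variable {n : ℕ}

/-! ### Rescaling along an idempotent -/

/-- The exterior algebra over the Gaussian integers. -/
abbrev GaussOF (S : Type) : Type := GaussianInt ⊗[ℤ] OF S

/-- The renaming of circles over the Gaussian integers. -/
def GaussOF.rename {S T : Type} (f : S → T) : GaussOF S →ₐ[GaussianInt] GaussOF T :=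
  Algebra.TensorProduct.map (AlgHom.id GaussianInt GaussianInt) (OF.rename f)

theorem GaussOF.rename_tmul {S T : Type} (f : S → T) (r : GaussianInt) (x : OF S) :
    GaussOF.rename f (r ⊗ₜ x) = r ⊗ₜ OF.rename f x := rfl

theorem GaussOF.ext {S : Type} {B : Type} [Ring B] [Algebra GaussianInt B]
    {f g : GaussOF S →ₐ[GaussianInt] B}
    (h : ∀ v, f (1 ⊗ₜ ExteriorAlgebra.ι ℤ v) = g (1 ⊗ₜ ExteriorAlgebra.ι ℤ v)) : f = g := by
  refine Algebra.TensorProduct.ext (AlgHom.ext fun r => ?_) ?_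
  · exact (f.commutes r).trans (g.commutes r).symm
  · refine ExteriorAlgebra.hom_ext (LinearMap.ext fun v => ?_)
    exact h v

section Scale

variable {S T : Type} (N : (S →₀ ℤ) →ₗ[ℤ] (S →₀ ℤ)) (μ : GaussianInt)

/-- The images of the generators under `Λ(1 + (μ - 1) N)`. -/
def scaleι : (S →₀ ℤ) →ₗ[ℤ] GaussOF S :=
  TensorProduct.mk ℤ GaussianInt (OF S) 1 ∘ₗ ExteriorAlgebra.ι ℤ +
    TensorProduct.mk ℤ GaussianInt (OF S) (μ - 1) ∘ₗ ExteriorAlgebra.ι ℤ ∘ₗ N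

theorem scaleι_apply (v : S →₀ ℤ) : scaleι N μ v =
    1 ⊗ₜ ExteriorAlgebra.ι ℤ v + (μ - 1) ⊗ₜ ExteriorAlgebra.ι ℤ (N v) := rfl

theorem scaleι_sq (v : S →₀ ℤ) : scaleι N μ v * scaleι N μ v = 0 := by
  have h := ExteriorAlgebra.ι_add_mul_swap (R := ℤ) v (N v)
  simp only [scaleι_apply, mul_add, add_mul, Algebra.TensorProduct.tmul_mul_tmul,
    ExteriorAlgebra.ι_sq_zero, TensorProduct.tmul_zero, one_mul, mul_one, zero_add, add_zero]
  rw [← TensorProduct.tmul_add, add_comm, h, TensorProduct.tmul_zero]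

/-- The algebra map `Λ(1 + (μ - 1) N)`. -/
def scale : GaussOF S →ₐ[GaussianInt] GaussOF S :=
  Algebra.TensorProduct.lift (Algebra.ofId GaussianInt _)
    (ExteriorAlgebra.lift ℤ ⟨scaleι N μ, scaleι_sq N μ⟩) fun r _ => Algebra.commutes r _

theorem scale_ι (v : S →₀ ℤ) : scale N μ (1 ⊗ₜ ExteriorAlgebra.ι ℤ v) =
    1 ⊗ₜ ExteriorAlgebra.ι ℤ v + (μ - 1) ⊗ₜ ExteriorAlgebra.ι ℤ (N v) := by
  refine (Algebra.TensorProduct.lift_tmul _ _ _ _ _).trans ?_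
  rw [map_one, one_mul]
  exact ExteriorAlgebra.lift_ι_apply ℤ _ _ v

theorem scale_one : scale N 1 = AlgHom.id GaussianInt (GaussOF S) := by
  refine GaussOF.ext fun v => ?_
  rw [scale_ι, sub_self, TensorProduct.zero_tmul, add_zero, AlgHom.id_apply]

theorem smul_one_tmul (r : GaussianInt) (x : OF S) : (r ⊗ₜ x : GaussOF S) = r • (1 ⊗ₜ x) := by
  rw [TensorProduct.smul_tmul', smul_eq_mul, mul_one]

/-- For an idempotent `N` the map acts by `μ` on the image and by 1 on the kernel, hence is
multiplicative in `μ`; units give bijections. -/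
theorem scale_comp (hN : N ∘ₗ N = N) (ν : GaussianInt) :
    (scale N μ).comp (scale N ν) = scale N (μ * ν) := by
  refine GaussOF.ext fun v => ?_
  have hNv : N (N v) = N v := LinearMap.congr_fun hN v
  rw [AlgHom.comp_apply, scale_ι, map_add, scale_ι, smul_one_tmul (ν - 1), map_smul, scale_ι, hNv,
    scale_ι, ← TensorProduct.add_tmul, TensorProduct.smul_tmul', add_assoc,
    ← TensorProduct.add_tmul]
  congr 2
  rw [smul_eq_mul]
  ring

theorem scale_bijective (hN : N ∘ₗ N = N) (ν : GaussianInt) (h : μ * ν = 1) :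
    Function.Bijective (scale N μ) := by
  refine Function.bijective_iff_has_inverse.2 ⟨scale N ν, fun x => ?_, fun x => ?_⟩
  · have := DFunLike.congr_fun (scale_comp N ν hN μ) x
    rwa [mul_comm ν, h, scale_one N] at this
  · have := DFunLike.congr_fun (scale_comp N μ hN ν) x
    rwa [h, scale_one N] at this

theorem scale_zero : scale (0 : (S →₀ ℤ) →ₗ[ℤ] (S →₀ ℤ)) μ = AlgHom.id _ _ := by
  refine GaussOF.ext fun v => ?_
  rw [scale_ι, LinearMap.zero_apply, map_zero, TensorProduct.tmul_zero, add_zero, AlgHom.id_apply]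

theorem scale_rename (N' : (T →₀ ℤ) →ₗ[ℤ] (T →₀ ℤ)) (f : S → T)
    (h : ∀ v, N' (Finsupp.mapDomain f v) = Finsupp.mapDomain f (N v)) (x : GaussOF S) :
    scale N' μ (GaussOF.rename f x) = GaussOF.rename f (scale N μ x) := by
  have : (scale N' μ).comp (GaussOF.rename f) = (GaussOF.rename f).comp (scale N μ) := by
    refine GaussOF.ext fun v => ?_
    rw [AlgHom.comp_apply, AlgHom.comp_apply, GaussOF.rename_tmul, OF.rename_ι, scale_ι, scale_ι,
      map_add, GaussOF.rename_tmul, GaussOF.rename_tmul, OF.rename_ι, OF.rename_ι, h]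
  exact DFunLike.congr_fun this x

end Scale

/-! ### Degrees -/

/-- The elements of exterior degree `p` over the Gaussian integers. -/
def gaussPower (S : Type) (p : ℕ) : Submodule GaussianInt (GaussOF S) :=
  Submodule.span GaussianInt {z | ∃ x ∈ ⋀[ℤ]^p (S →₀ ℤ), z = 1 ⊗ₜ x}

theorem tmul_mem_gaussPower {S : Type} {p : ℕ} (r : GaussianInt) {x : OF S}
    (hx : x ∈ ⋀[ℤ]^p (S →₀ ℤ)) : r ⊗ₜ x ∈ gaussPower S p := by
  rw [smul_one_tmul]
  exact Submodule.smul_mem _ _ (Submodule.subset_span ⟨x, hx, rfl⟩)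

theorem mul_mem_exteriorPower {S : Type} {p q : ℕ} {x y : OF S} (hx : x ∈ ⋀[ℤ]^p (S →₀ ℤ))
    (hy : y ∈ ⋀[ℤ]^q (S →₀ ℤ)) : x * y ∈ ⋀[ℤ]^(p + q) (S →₀ ℤ) := by
  change x * y ∈ LinearMap.range (ExteriorAlgebra.ι ℤ) ^ (p + q)
  rw [pow_add]
  exact Submodule.mul_mem_mul hx hy

theorem mul_mem_gaussPower {S : Type} {p q : ℕ} {x y : GaussOF S} (hx : x ∈ gaussPower S p)
    (hy : y ∈ gaussPower S q) : x * y ∈ gaussPower S (p + q) := by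
  induction hx using Submodule.span_induction with
  | mem x hx =>
    obtain ⟨x, hx, rfl⟩ := hx
    induction hy using Submodule.span_induction with
    | mem y hy =>
      obtain ⟨y, hy, rfl⟩ := hy
      rw [Algebra.TensorProduct.tmul_mul_tmul]
      exact tmul_mem_gaussPower _ (mul_mem_exteriorPower hx hy)
    | zero => rw [mul_zero]; exact Submodule.zero_mem _
    | add y z _ _ h h' => rw [mul_add]; exact Submodule.add_mem _ h h'
    | smul r y _ h => rw [mul_smul_comm]; exact Submodule.smul_mem _ _ h
  | zero => rw [zero_mul]; exact Submodule.zero_mem _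
  | add y z _ _ h h' => rw [add_mul]; exact Submodule.add_mem _ h h'
  | smul r y _ h => rw [smul_mul_assoc]; exact Submodule.smul_mem _ _ h

theorem ι_mem_exteriorPower {S : Type} (v : S →₀ ℤ) :
    ExteriorAlgebra.ι ℤ v ∈ ⋀[ℤ]^1 (S →₀ ℤ) := by
  change _ ∈ LinearMap.range (ExteriorAlgebra.ι ℤ) ^ 1
  rw [pow_one]
  exact LinearMap.mem_range_self _ v

theorem scale_mem_gaussPower {S : Type} (N : (S →₀ ℤ) →ₗ[ℤ] (S →₀ ℤ)) (μ : GaussianInt) {p : ℕ}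
    {x : GaussOF S} (hx : x ∈ gaussPower S p) : scale N μ x ∈ gaussPower S p := by
  have key : ∀ (p : ℕ) (x : OF S), x ∈ ⋀[ℤ]^p (S →₀ ℤ) →
      scale N μ (1 ⊗ₜ x) ∈ gaussPower S p := by
    intro p
    induction p with
    | zero =>
      intro x hx
      have hx' := hx
      change x ∈ LinearMap.range (ExteriorAlgebra.ι ℤ) ^ 0 at hx
      rw [pow_zero, Submodule.mem_one] at hx
      obtain ⟨r, rfl⟩ := hx
      have : (1 ⊗ₜ algebraMap ℤ (OF S) r : GaussOF S) = algebraMap GaussianInt _ (r : GaussianInt) := by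
        rw [Algebra.TensorProduct.algebraMap_apply, Algebra.algebraMap_eq_smul_one,
          ← TensorProduct.smul_tmul]
        simp
      rw [this, AlgHom.commutes, ← this]
      exact tmul_mem_gaussPower _ hx'
    | succ p ih =>
      intro x hx
      change x ∈ LinearMap.range (ExteriorAlgebra.ι ℤ) ^ (p + 1) at hx
      rw [pow_succ] at hx
      refine Submodule.mul_induction_on hx ?_ ?_
      · rintro x hx _ ⟨v, rfl⟩
        have : (1 ⊗ₜ (x * ExteriorAlgebra.ι ℤ v) : GaussOF S) =
            (1 ⊗ₜ x) * (1 ⊗ₜ ExteriorAlgebra.ι ℤ v) := by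
          rw [Algebra.TensorProduct.tmul_mul_tmul, one_mul]
        rw [this, map_mul, scale_ι]
        exact mul_mem_gaussPower (ih x hx) (Submodule.add_mem _
          (tmul_mem_gaussPower _ (ι_mem_exteriorPower _))
          (tmul_mem_gaussPower _ (ι_mem_exteriorPower _)))
      · intro x y hx hy
        rw [TensorProduct.tmul_add, map_add]
        exact Submodule.add_mem _ hx hy
  induction hx using Submodule.span_induction with
  | mem x hx =>
    obtain ⟨x, hx, rfl⟩ := hx
    exact key p x hx
  | zero => rw [map_zero]; exact Submodule.zero_mem _
  | add y z _ _ h h' => rw [map_add]; exact Submodule.add_mem _ h h'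
  | smul r y _ h => rw [map_smul]; exact Submodule.smul_mem _ _ h

theorem exteriorPower_eq_zero {S : Type} [Finite S] {p : ℕ} (hp : Nat.card S < p) {x : OF S}
    (hx : x ∈ ⋀[ℤ]^p (S →₀ ℤ)) : x = 0 := by
  have := Fintype.ofFinite S
  have h : Module.finrank ℤ (⋀[ℤ]^p (S →₀ ℤ)) = 0 := by
    rw [exteriorPower.finrank_eq, Module.finrank_finsupp_self, ← Nat.card_eq_fintype_card,
      Nat.choose_eq_zero_of_lt hp]
  have := Module.finrank_zero_iff.1 h
  exact congrArg Subtype.val (Subsingleton.elim (⟨x, hx⟩ : ⋀[ℤ]^p (S →₀ ℤ)) 0)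

end OddArc

namespace OddArc

variable {n : ℕ}

/-! ### The split product as an eigenvector of the rescaling -/

namespace Chronology

variable {b : Matching n} (γ : Chronology b) (c a : Matching n)

/-- Does the arc that is contracted at time `u` start at an even point? -/
def isEven (u : Fin n) : Bool := decide (((γ.order u).left : ℕ) % 2 = 0)

/-- The number of splits along arcs that start at even points. -/
def evenSplits : ℕ := (γ.splitTimes c a 0 n).countP γ.isEven

/-- This is where the condition on the order enters: arcs surrounded by the arc of `u` are
contracted after it, so their vectors are spanned by those of the later splits. -/
theorem partnerSpan_le_span {t₀ k : ℕ} (u : Fin n) (hu : (u : ℕ) = t₀) (hk : t₀ + 1 + k = n)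
    {v : Fin (2 * n) →₀ ℤ}
    (hv : v ∈ partnerSpan b (Set.Ioo (γ.order u).left (γ.order u).right)) :
    Finsupp.mapDomain (toCircle c a) v ∈
      Submodule.span ℤ {w | w ∈ (γ.splitTimes c a (t₀ + 1) k).map fun v =>
        Finsupp.mapDomain (toCircle c a) (γ.arcVector v)} := by
  set W := Submodule.span ℤ {w | w ∈ (γ.splitTimes c a (t₀ + 1) k).map fun v =>
        Finsupp.mapDomain (toCircle c a) (γ.arcVector v)} with hW
  have key : ∀ α : b.Arc, (γ.order u).Surrounds α →
      Finsupp.single (toCircle c a α.left) (1 : ℤ) - Finsupp.single (toCircle c a α.right) 1 ∈ W := by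
    intro α hα
    have h1 := γ.outer_first _ _ hα
    rw [Equiv.symm_apply_apply, Fin.lt_def] at h1
    have h2 := γ.mapDomain_arcVector_mem_span c a (t₀ + 1) k hk (γ.order.symm α) (by omega)
    rw [γ.mapDomain_arcVector, Equiv.apply_symm_apply] at h2
    split_ifs at h2
    · exact h2
    · rw [← neg_sub]; exact Submodule.neg_mem _ h2
  have hle : partnerSpan b (Set.Ioo (γ.order u).left (γ.order u).right) ≤
      W.comap (Finsupp.lmapDomain ℤ ℤ (toCircle c a)) := by
    refine Submodule.span_le.2 ?_
    rintro _ ⟨i, ⟨h1, h2⟩, rfl⟩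
    rw [SetLike.mem_coe, Submodule.mem_comap, map_sub, Finsupp.lmapDomain_apply,
      Finsupp.lmapDomain_apply, Finsupp.mapDomain_single, Finsupp.mapDomain_single]
    have h3 := b.noncrossing (γ.order u).left i h1 h2
    rcases lt_or_gt_of_ne (b.ne_self i) with h | h
    · rw [← neg_sub]
      refine Submodule.neg_mem _ ?_
      have := key ⟨b.partner i, by rwa [b.involutive]⟩ ⟨h3.1, by
        change b.partner (b.partner i) < _
        rwa [b.involutive]⟩
      change Finsupp.single (toCircle c a (b.partner i)) 1 -
        Finsupp.single (toCircle c a (b.partner (b.partner i))) 1 ∈ W at this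
      rwa [b.involutive] at this
    · exact key ⟨i, h⟩ ⟨h1, h3.2⟩
  exact hle hv

/-- Modulo the arcs nested under it, the vector of an arc is fixed by the height map if the arc
starts at an even point and killed otherwise. -/
theorem heightCircle_arcVector {t₀ k : ℕ} (u : Fin n) (hu : (u : ℕ) = t₀) (hk : t₀ + 1 + k = n) :
    heightCircle c a (Finsupp.mapDomain (toCircle c a) (γ.arcVector u)) -
      (if γ.isEven u then Finsupp.mapDomain (toCircle c a) (γ.arcVector u) else 0) ∈
      Submodule.span ℤ {w | w ∈ (γ.splitTimes c a (t₀ + 1) k).map fun v =>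
        Finsupp.mapDomain (toCircle c a) (γ.arcVector v)} := by
  have h := γ.partnerSpan_le_span c a u hu hk (heightVec_sub_mem b (γ.order u).2)
  change Finsupp.mapDomain (toCircle c a) (heightVec (γ.order u).right -
    heightVec (γ.order u).left - (if ((γ.order u).left : ℕ) % 2 = 0 then
      Finsupp.single (γ.order u).right 1 - Finsupp.single (γ.order u).left 1 else 0)) ∈ _ at h
  rw [heightCircle_mapDomain]
  have e : ∀ x y : Fin (2 * n) →₀ ℤ, Finsupp.mapDomain (toCircle c a) (x - y) =
      Finsupp.mapDomain (toCircle c a) x - Finsupp.mapDomain (toCircle c a) y :=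
    fun x y => map_sub (Finsupp.lmapDomain ℤ ℤ (toCircle c a)) x y
  have hg : Finsupp.mapDomain (toCircle c a) (heightMap n (γ.arcVector u)) -
      (if γ.isEven u then Finsupp.mapDomain (toCircle c a) (γ.arcVector u) else 0) =
      Finsupp.mapDomain (toCircle c a) (heightMap n (γ.arcVector u) -
        if ((γ.order u).left : ℕ) % 2 = 0 then γ.arcVector u else 0) := by
    rw [e]
    unfold isEven
    by_cases h : ((γ.order u).left : ℕ) % 2 = 0 <;> simp [h]
  rw [hg]
  have ha' : γ.arcVector u = if γ.arrow (γ.order u) then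
      Finsupp.single (γ.order u).left 1 - Finsupp.single (γ.order u).right 1
    else Finsupp.single (γ.order u).right 1 - Finsupp.single (γ.order u).left 1 := rfl
  rw [ha']
  by_cases ha : γ.arrow (γ.order u)
  · rw [if_pos ha, ← neg_sub]
    have := Submodule.neg_mem _ h
    convert this using 1
    rw [map_sub, heightMap_single, heightMap_single, ← Finsupp.lmapDomain_apply ℤ ℤ,
      ← Finsupp.lmapDomain_apply ℤ ℤ, ← map_neg]
    congr 1
    split_ifs <;> abel
  · rw [if_neg ha]
    convert h using 1
    rw [map_sub, heightMap_single, heightMap_single]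

/-- The height map is triangular on the split vectors, with diagonal entries 1 for even arcs and 0
for odd ones. Removing the earliest split, which stands on the right, gives the induction. -/
theorem scale_wedge (μ : GaussianInt) (k : ℕ) : ∀ t₀, t₀ + k = n →
    scale (heightCircle c a) μ (1 ⊗ₜ wedge ((γ.splitTimes c a t₀ k).map fun v =>
      Finsupp.mapDomain (toCircle c a) (γ.arcVector v))) =
    μ ^ (γ.splitTimes c a t₀ k).countP γ.isEven •
      (1 ⊗ₜ wedge ((γ.splitTimes c a t₀ k).map fun v =>
        Finsupp.mapDomain (toCircle c a) (γ.arcVector v))) := by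
  induction k with
  | zero =>
    intro t₀ _
    change scale (heightCircle c a) μ 1 = (1 : GaussianInt) • (1 : GaussOF (Circle c a))
    rw [map_one, one_smul]
  | succ k ih =>
    intro t₀ ht
    have hi := ih (t₀ + 1) (by omega)
    rw [splitTimes_succ_left, List.map_append, wedge_append, List.countP_append]
    set L := (γ.splitTimes c a (t₀ + 1) k).map fun v =>
      Finsupp.mapDomain (toCircle c a) (γ.arcVector v) with hL
    have ht₀ : t₀ < n := by omega
    have hsp : γ.splitTime c a t₀ = [] ∨ γ.splitTime c a t₀ = [⟨t₀, ht₀⟩] := by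
      unfold splitTime
      split_ifs <;> simp
    rcases hsp with hsp | hsp
    · rw [hsp]
      simpa using hi
    · rw [hsp]
      have hh := γ.heightCircle_arcVector c a (t₀ := t₀) (k := k) ⟨t₀, ht₀⟩ rfl (by omega)
      set v := Finsupp.mapDomain (toCircle c a) (γ.arcVector ⟨t₀, ht₀⟩) with hv
      rw [← hL] at hh
      -- The product of the later vectors kills the off-diagonal part.
      have hz := wedge_mul_ι_of_mem_span hh
      rw [map_sub, mul_sub, sub_eq_zero] at hz
      have hw : wedge ([(⟨t₀, ht₀⟩ : Fin n)].map fun v =>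
          Finsupp.mapDomain (toCircle c a) (γ.arcVector v)) = ExteriorAlgebra.ι ℤ v := by
        simp [wedge, hv]
      rw [hw]
      have hm : (1 ⊗ₜ (wedge L * ExteriorAlgebra.ι ℤ v) : GaussOF (Circle c a)) =
          (1 ⊗ₜ wedge L) * (1 ⊗ₜ ExteriorAlgebra.ι ℤ v) := by
        rw [Algebra.TensorProduct.tmul_mul_tmul, one_mul]
      rw [hm, map_mul, hi, scale_ι, mul_add, smul_mul_assoc, smul_mul_assoc,
        Algebra.TensorProduct.tmul_mul_tmul, Algebra.TensorProduct.tmul_mul_tmul, hz, one_mul,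
        one_mul]
      by_cases he : γ.isEven ⟨t₀, ht₀⟩
      · rw [if_pos he, ← smul_add, ← TensorProduct.add_tmul, smul_one_tmul (1 + (μ - 1)), smul_smul]
        congr 1
        simp [he, pow_succ]
      · rw [if_neg he]
        simp [he]

theorem scale_omega (μ : GaussianInt) :
    scale (heightCircle c a) μ (1 ⊗ₜ renameCircle c a (γ.omega c a)) =
      μ ^ γ.evenSplits c a • (1 ⊗ₜ renameCircle c a (γ.omega c a)) := by
  rw [renameCircle_omega]
  exact γ.scale_wedge c a μ n 0 (zero_add n)

end Chronology

end OddArc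

namespace OddArc

variable {n : ℕ}

/-! ### The blocks of the arc algebra -/

theorem OH.entry_single_self (b a : Matching n) (x : OF (Circle b a)) :
    OH.entry b a (OH.single b a x) = x := by
  simp [OH.entry, OH.single]

theorem OH.entry_single_of_ne {b a b' a' : Matching n} (h : b ≠ b' ∨ a ≠ a')
    (x : OF (Circle b' a')) : OH.entry b a (OH.single b' a' x) = 0 := by
  simp only [OH.entry, OH.single, LinearMap.comp_apply, LinearMap.proj_apply,
    LinearMap.single_apply]
  by_cases hb : b = b'
  · subst hb
    rw [Pi.single_eq_same, Pi.single_eq_of_ne (h.resolve_left fun h => h rfl)]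
  · rw [Pi.single_eq_of_ne hb]
    rfl

theorem OH.sum_single_entry (x : OH n) : ∑ b, ∑ a, OH.single b a (OH.entry b a x) = x := by
  funext b a
  rw [Finset.sum_apply, Finset.sum_apply, Finset.sum_eq_single b, Finset.sum_apply,
    Finset.sum_apply, Finset.sum_eq_single a]
  · exact OH.entry_single_self b a (x b a)
  · intro a' _ h
    exact OH.entry_single_of_ne (Or.inr h.symm) _
  · simp
  · intro b' _ h
    rw [Finset.sum_apply, Finset.sum_apply]
    exact Finset.sum_eq_zero fun a' _ => OH.entry_single_of_ne (Or.inl h.symm) _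
  · simp

theorem OH.mul_single (C : Choice n) (c b a : Matching n) (x : OF (Circle c b))
    (y : OF (Circle b a)) :
    OH.mul C (OH.single c b x) (OH.single b a y) = OH.single c a ((C c b a).mulMap c a x y) := by
  simp only [OH.mul, LinearMap.sum_apply, LinearMap.compr₂_apply, LinearMap.compl₁₂_apply]
  rw [Finset.sum_eq_single c, Finset.sum_eq_single b, Finset.sum_eq_single a,
    OH.entry_single_self, OH.entry_single_self]
  · intro a' _ h
    rw [OH.entry_single_of_ne (Or.inr h) y, map_zero, map_zero]
  · simp
  · intro b' _ h
    refine Finset.sum_eq_zero fun a' _ => ?_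
    rw [OH.entry_single_of_ne (Or.inl h) y, map_zero, map_zero]
  · simp
  · intro c' _ h
    refine Finset.sum_eq_zero fun b' _ => Finset.sum_eq_zero fun a' _ => ?_
    rw [OH.entry_single_of_ne (Or.inl h) x, LinearMap.map_zero₂, map_zero]
  · simp

namespace GaussOH

/-- The inclusion of a block. -/
def inc (b a : Matching n) : GaussOF (Circle b a) →ₗ[GaussianInt] GaussOH n :=
  (OH.single b a).baseChange GaussianInt

/-- The projection on a block. -/
def pr (b a : Matching n) : GaussOH n →ₗ[GaussianInt] GaussOF (Circle b a) :=
  (OH.entry b a).baseChange GaussianInt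

theorem inc_tmul (b a : Matching n) (r : GaussianInt) (x : OF (Circle b a)) :
    inc b a (r ⊗ₜ x) = r ⊗ₜ OH.single b a x := rfl

theorem pr_tmul (b a : Matching n) (r : GaussianInt) (x : OH n) :
    pr b a (r ⊗ₜ x) = r ⊗ₜ OH.entry b a x := rfl

theorem pr_inc (b a : Matching n) (x : GaussOF (Circle b a)) : pr b a (inc b a x) = x := by
  induction x using TensorProduct.induction_on with
  | zero => simp
  | tmul r x => rw [inc_tmul, pr_tmul, OH.entry_single_self]
  | add x y hx hy => rw [map_add, map_add, hx, hy]

theorem pr_inc_of_ne {b a b' a' : Matching n} (h : b ≠ b' ∨ a ≠ a')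
    (x : GaussOF (Circle b' a')) : pr b a (inc b' a' x) = 0 := by
  induction x using TensorProduct.induction_on with
  | zero => simp
  | tmul r x => rw [inc_tmul, pr_tmul, OH.entry_single_of_ne h, TensorProduct.tmul_zero]
  | add x y hx hy => rw [map_add, map_add, hx, hy, add_zero]

theorem sum_inc_pr (x : GaussOH n) : ∑ b, ∑ a, inc b a (pr b a x) = x := by
  induction x using TensorProduct.induction_on with
  | zero => simp
  | tmul r x =>
    simp only [pr_tmul, inc_tmul, ← TensorProduct.tmul_sum]
    rw [OH.sum_single_entry]
  | add x y hx hy =>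
    simp only [map_add, Finset.sum_add_distrib]
    rw [hx, hy]

theorem inc_injective (b a : Matching n) : Function.Injective (inc b a) :=
  Function.LeftInverse.injective (pr_inc b a)

theorem ext_inc {M : Type*} [AddCommGroup M] [Module GaussianInt M]
    {f g : GaussOH n →ₗ[GaussianInt] M} (h : ∀ b a x, f (inc b a x) = g (inc b a x)) : f = g := by
  refine LinearMap.ext fun x => ?_
  rw [← sum_inc_pr x]
  simp only [map_sum, h]

/-- The product of two blocks. -/
def blockMul (C : Choice n) (c b a : Matching n) : GaussOF (Circle c b) →ₗ[GaussianInt]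
    GaussOF (Circle b a) →ₗ[GaussianInt] GaussOF (Circle c a) :=
  ((GaussOH.mul C).compl₁₂ (inc c b) (inc b a)).compr₂ (pr c a)

theorem mul_inc_tmul (C : Choice n) (c b a : Matching n) (r s : GaussianInt) (x : OF (Circle c b))
    (y : OF (Circle b a)) : GaussOH.mul C (inc c b (r ⊗ₜ x)) (inc b a (s ⊗ₜ y)) =
      inc c a ((r * s) ⊗ₜ (C c b a).mulMap c a x y) := by
  rw [inc_tmul, inc_tmul, inc_tmul, GaussOH.mul, LinearMap.BilinMap.baseChange_tmul, OH.mul_single]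

theorem blockMul_tmul (C : Choice n) (c b a : Matching n) (r s : GaussianInt) (x : OF (Circle c b))
    (y : OF (Circle b a)) : blockMul C c b a (r ⊗ₜ x) (s ⊗ₜ y) =
      (r * s) ⊗ₜ (C c b a).mulMap c a x y := by
  change pr c a (GaussOH.mul C (inc c b (r ⊗ₜ x)) (inc b a (s ⊗ₜ y))) = _
  rw [mul_inc_tmul, pr_inc]

theorem mul_inc (C : Choice n) (c b a : Matching n) (x : GaussOF (Circle c b))
    (y : GaussOF (Circle b a)) :
    GaussOH.mul C (inc c b x) (inc b a y) = inc c a (blockMul C c b a x y) := by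
  induction x using TensorProduct.induction_on with
  | zero => simp
  | tmul r x =>
    induction y using TensorProduct.induction_on with
    | zero => simp
    | tmul s y => rw [mul_inc_tmul, blockMul_tmul]
    | add x y hx hy => simp only [map_add, hx, hy]
  | add x y hx hy => simp only [map_add, LinearMap.add_apply, hx, hy]

/-- The projection on the elements of degree `p`. -/
def degreeProj (S : Type) (p : ℕ) : GaussOF S →ₗ[GaussianInt] GaussOF S :=
  (GradedAlgebra.proj (fun p : ℕ => ⋀[ℤ]^p (S →₀ ℤ)) p).baseChange GaussianInt

theorem degreeProj_tmul (S : Type) (p : ℕ) (r : GaussianInt) (x : OF S) : degreeProj S p (r ⊗ₜ x) =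
    r ⊗ₜ GradedAlgebra.proj (fun p : ℕ => ⋀[ℤ]^p (S →₀ ℤ)) p x := rfl

theorem degreeProj_of_mem {S : Type} {p : ℕ} {x : GaussOF S} (hx : x ∈ gaussPower S p) (q : ℕ) :
    degreeProj S q x = if q = p then x else 0 := by
  induction hx using Submodule.span_induction with
  | mem x hx =>
    obtain ⟨x, hx, rfl⟩ := hx
    rw [degreeProj_tmul, GradedAlgebra.proj_apply]
    split_ifs with h
    · subst h
      rw [DirectSum.decompose_of_mem_same (fun p : ℕ => ⋀[ℤ]^p (S →₀ ℤ)) hx]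
    · rw [DirectSum.decompose_of_mem_ne (fun p : ℕ => ⋀[ℤ]^p (S →₀ ℤ)) hx (Ne.symm h),
        TensorProduct.tmul_zero]
  | zero => simp
  | add y z _ _ h h' => rw [map_add, h, h']; split_ifs <;> simp
  | smul r y _ h => rw [map_smul, h]; split_ifs <;> simp

theorem degreeProj_mem (S : Type) (p : ℕ) (x : GaussOF S) : degreeProj S p x ∈ gaussPower S p := by
  induction x using TensorProduct.induction_on with
  | zero => rw [map_zero]; exact Submodule.zero_mem _
  | tmul r x =>
    rw [degreeProj_tmul, GradedAlgebra.proj_apply]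
    exact tmul_mem_gaussPower _ (SetLike.coe_mem _)
  | add x y hx hy => rw [map_add]; exact Submodule.add_mem _ hx hy

theorem eq_zero_of_mem_gaussPower {S : Type} [Finite S] {p : ℕ} (hp : Nat.card S < p)
    {x : GaussOF S} (hx : x ∈ gaussPower S p) : x = 0 := by
  induction hx using Submodule.span_induction with
  | mem x hx =>
    obtain ⟨x, hx, rfl⟩ := hx
    rw [exteriorPower_eq_zero hp hx, TensorProduct.tmul_zero]
  | zero => rfl
  | add y z _ _ h h' => rw [h, h', add_zero]
  | smul r y _ h => rw [h, smul_zero]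

theorem sum_degreeProj {S : Type} [Finite S] (x : GaussOF S) :
    ∑ p ∈ Finset.range (Nat.card S + 1), degreeProj S p x = x := by
  classical
  induction x using TensorProduct.induction_on with
  | zero => simp
  | tmul r x =>
    simp only [degreeProj_tmul, ← TensorProduct.tmul_sum]
    congr 1
    conv_rhs => rw [← DirectSum.sum_support_decompose (fun p : ℕ => ⋀[ℤ]^p (S →₀ ℤ)) x]
    refine (Finset.sum_subset ?_ ?_).symm
    · intro p hp
      rw [Finset.mem_range]
      by_contra hlt
      rw [DFinsupp.mem_support_iff] at hp
      exact hp (Subtype.ext (exteriorPower_eq_zero (p := p) (by omega) (SetLike.coe_mem _)))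
    · intro p _ hp
      rw [DFinsupp.notMem_support_iff] at hp
      rw [GradedAlgebra.proj_apply, hp]
      rfl
  | add x y hx hy => simp only [map_add, Finset.sum_add_distrib, hx, hy]

theorem component_eq (b a : Matching n) (p : ℕ) (x : GaussOH n) :
    GaussOH.component b a p x = inc b a (degreeProj _ p (pr b a x)) := by
  induction x using TensorProduct.induction_on with
  | zero => simp
  | tmul r x => rfl
  | add x y hx hy => simp only [map_add, hx, hy]

theorem twistedMul_inc (C : Choice n) (τ : Twist n) {c b a : Matching n} {p q : ℕ}
    {x : GaussOF (Circle c b)} {y : GaussOF (Circle b a)} (hx : x ∈ gaussPower _ p)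
    (hy : y ∈ gaussPower _ q) : GaussOH.twistedMul C τ (inc c b x) (inc b a y) =
      iPow (τ c b a (quantumDegree c b p) (quantumDegree b a q)) •
        inc c a (blockMul C c b a x y) := by
  -- The sums in the twisted product stop at the number of circles; beyond it the exterior powers
  -- are zero.
  by_cases hp : numCircles c b < p
  · rw [eq_zero_of_mem_gaussPower hp hx]; simp
  by_cases hq : numCircles b a < q
  · rw [eq_zero_of_mem_gaussPower hq hy]; simp
  simp only [GaussOH.twistedMul, LinearMap.sum_apply, LinearMap.smul_apply,
    LinearMap.compl₁₂_apply, component_eq]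
  rw [Finset.sum_eq_single c, Finset.sum_eq_single b, Finset.sum_eq_single a,
    Finset.sum_eq_single p, Finset.sum_eq_single q, pr_inc, pr_inc, degreeProj_of_mem hx,
    degreeProj_of_mem hy, if_pos rfl, if_pos rfl, mul_inc]
  · intro q' _ h
    rw [pr_inc b a, degreeProj_of_mem hy, if_neg h, map_zero, map_zero, smul_zero]
  · intro h
    exact absurd (Finset.mem_range.2 (by omega)) h
  · intro p' _ h
    refine Finset.sum_eq_zero fun q' _ => ?_
    rw [pr_inc c b, degreeProj_of_mem hx, if_neg h, map_zero, LinearMap.map_zero₂, smul_zero]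
  · intro h
    exact absurd (Finset.mem_range.2 (by omega)) h
  · intro a' _ h
    refine Finset.sum_eq_zero fun p' _ => Finset.sum_eq_zero fun q' _ => ?_
    rw [pr_inc_of_ne (Or.inr h) y, map_zero, map_zero, map_zero, smul_zero]
  · simp
  · intro b' _ h
    refine Finset.sum_eq_zero fun a' _ => Finset.sum_eq_zero fun p' _ =>
      Finset.sum_eq_zero fun q' _ => ?_
    rw [pr_inc_of_ne (Or.inl h) y, map_zero, map_zero, map_zero, smul_zero]
  · simp
  · intro c' _ h
    refine Finset.sum_eq_zero fun b' _ => Finset.sum_eq_zero fun a' _ =>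
      Finset.sum_eq_zero fun p' _ => Finset.sum_eq_zero fun q' _ => ?_
    rw [pr_inc_of_ne (Or.inl h) x, map_zero, map_zero, LinearMap.map_zero₂, smul_zero]
  · simp

theorem twistedMul_inc_of_ne (C : Choice n) (τ : Twist n) {d c b a : Matching n} (hcb : c ≠ b)
    (x : GaussOF (Circle d c)) (y : GaussOF (Circle b a)) :
    GaussOH.twistedMul C τ (inc d c x) (inc b a y) = 0 := by
  simp only [GaussOH.twistedMul, LinearMap.sum_apply, LinearMap.smul_apply,
    LinearMap.compl₁₂_apply, component_eq]
  refine Finset.sum_eq_zero fun c' _ => Finset.sum_eq_zero fun b' _ => Finset.sum_eq_zero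
    fun a' _ => Finset.sum_eq_zero fun p' _ => Finset.sum_eq_zero fun q' _ => ?_
  by_cases h : b' = c
  · rw [pr_inc_of_ne (Or.inl (h ▸ hcb)) y, map_zero, map_zero, map_zero, smul_zero]
  · rw [pr_inc_of_ne (Or.inr h) x, map_zero, map_zero, LinearMap.map_zero₂, smul_zero]

end GaussOH

end OddArc

namespace OddArc

variable {n : ℕ}

/-! ### Powers of the imaginary unit -/

theorem iPow_add (s t : ZMod 4) : iPow (s + t) = iPow s * iPow t := by
  revert s t; decide

theorem iPow_zero : iPow 0 = 1 := rfl

theorem iPow_two : iPow 2 = -1 := by decide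

theorem iPow_injective : Function.Injective iPow := by
  unfold Function.Injective; decide

theorem iPow_mul_neg (t : ZMod 4) : iPow t * iPow (-t) = 1 := by
  rw [← iPow_add, add_neg_cancel, iPow_zero]

theorem iPow_mul (s : ZMod 4) (k : ℕ) : iPow (s * k) = iPow s ^ k := by
  induction k with
  | zero => simp [iPow_zero]
  | succ k ih => rw [Nat.cast_succ, mul_add, mul_one, iPow_add, ih, pow_succ]

/-- Weights can be read off a nonzero element because the module is torsion-free over the Gaussian
integers. -/
theorem iPow_smul_injective {S : Type} [Finite S] {u : GaussOF S} (hu : u ≠ 0) {s t : ZMod 4}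
    (h : iPow s • u = iPow t • u) : s = t :=
  iPow_injective (smul_left_injective _ hu h)

theorem one_tmul_ne_zero {S : Type} [Finite S] {u : OF S} (hu : u ≠ 0) :
    (1 ⊗ₜ u : GaussOF S) ≠ 0 := by
  intro h
  refine hu (Algebra.TensorProduct.includeRight_injective (R := ℤ) (A := GaussianInt) ?_
    (h.trans (map_zero Algebra.TensorProduct.includeRight).symm))
  exact Int.cast_injective

/-! ### Products of blocks -/

theorem OF.exists_rename {S T : Type} {f : S → T} (hf : Function.Surjective f) {p : ℕ} {y : OF T}
    (hy : y ∈ ⋀[ℤ]^p (T →₀ ℤ)) : ∃ x ∈ ⋀[ℤ]^p (S →₀ ℤ), OF.rename f x = y := by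
  have h : Submodule.map (OF.rename f).toLinearMap
      (LinearMap.range (ExteriorAlgebra.ι ℤ (M := S →₀ ℤ))) =
      LinearMap.range (ExteriorAlgebra.ι ℤ) := by
    rw [← LinearMap.range_comp]
    refine le_antisymm ?_ ?_
    · rintro _ ⟨v, rfl⟩
      exact ⟨Finsupp.mapDomain f v, (OF.rename_ι f v).symm⟩
    · rintro _ ⟨w, rfl⟩
      obtain ⟨v, rfl⟩ := Finsupp.mapDomain_surjective hf w
      exact ⟨v, OF.rename_ι f v⟩
  have hp : Submodule.map (OF.rename f).toLinearMap (⋀[ℤ]^p (S →₀ ℤ)) = ⋀[ℤ]^p (T →₀ ℤ) := by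
    change Submodule.map _ (LinearMap.range (ExteriorAlgebra.ι ℤ) ^ p) =
      LinearMap.range (ExteriorAlgebra.ι ℤ) ^ p
    rw [Submodule.map_pow, h]
  rw [← hp] at hy
  exact hy

theorem OF.rename_mem {S T : Type} (f : S → T) {p : ℕ} {x : OF S} (hx : x ∈ ⋀[ℤ]^p (S →₀ ℤ)) :
    OF.rename f x ∈ ⋀[ℤ]^p (T →₀ ℤ) := by
  have h : Submodule.map (OF.rename f).toLinearMap (⋀[ℤ]^p (S →₀ ℤ)) ≤ ⋀[ℤ]^p (T →₀ ℤ) := by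
    change Submodule.map _ (LinearMap.range (ExteriorAlgebra.ι ℤ) ^ p) ≤
      LinearMap.range (ExteriorAlgebra.ι ℤ) ^ p
    rw [Submodule.map_pow, ← LinearMap.range_comp]
    refine pow_le_pow_left' ?_ p
    rintro _ ⟨v, rfl⟩
    exact ⟨Finsupp.mapDomain f v, (OF.rename_ι f v).symm⟩
  exact h ⟨x, hx, rfl⟩

theorem Choice.numSplits_eq (C : Choice n) (c b a : Matching n) :
    (C c b a).numSplits c a = C.splits c b a := Chronology.numSplits_eq _ _ _ _

theorem Choice.omega_mem (C : Choice n) (c b a : Matching n) :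
    (C c b a).omega c a ∈ ⋀[ℤ]^(C.splits c b a) (Fin (2 * n) →₀ ℤ) := by
  rw [← C.numSplits_eq]
  exact (C c b a).omega_mem c a

theorem mulMap_mem (C : Choice n) (c b a : Matching n) {p q : ℕ} {x : OF (Circle c b)}
    {y : OF (Circle b a)} (hx : x ∈ ⋀[ℤ]^p (Circle c b →₀ ℤ)) (hy : y ∈ ⋀[ℤ]^q (Circle b a →₀ ℤ)) :
    (C c b a).mulMap c a x y ∈ ⋀[ℤ]^(p + q + C.splits c b a) (Circle c a →₀ ℤ) := by
  obtain ⟨X, hX, rfl⟩ := OF.exists_rename (toCircle_surjective c b) hx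
  obtain ⟨Y, hY, rfl⟩ := OF.exists_rename (toCircle_surjective b a) hy
  have h : (C c b a).mulMap c a (OF.rename (toCircle c b) X) (OF.rename (toCircle b a) Y) =
    renameCircle c a ((C c b a).omega c a * X * Y) := (C c b a).mulMap_renameCircle c a X Y
  rw [h]
  refine OF.rename_mem _ ?_
  have := mul_mem_exteriorPower (mul_mem_exteriorPower (C.omega_mem c b a) hX) hY
  rwa [show C.splits c b a + p + q = p + q + C.splits c b a by ring] at this

namespace GaussOH

theorem blockMul_mem (C : Choice n) (c b a : Matching n) {p q : ℕ} {x : GaussOF (Circle c b)}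
    {y : GaussOF (Circle b a)} (hx : x ∈ gaussPower _ p) (hy : y ∈ gaussPower _ q) :
    blockMul C c b a x y ∈ gaussPower _ (p + q + C.splits c b a) := by
  induction hx using Submodule.span_induction with
  | mem x hx =>
    obtain ⟨x, hx, rfl⟩ := hx
    induction hy using Submodule.span_induction with
    | mem y hy =>
      obtain ⟨y, hy, rfl⟩ := hy
      rw [blockMul_tmul]
      exact tmul_mem_gaussPower _ (mulMap_mem C c b a hx hy)
    | zero => rw [map_zero]; exact Submodule.zero_mem _
    | add y z _ _ h h' => rw [map_add]; exact Submodule.add_mem _ h h'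
    | smul r y _ h => rw [map_smul]; exact Submodule.smul_mem _ _ h
  | zero => rw [LinearMap.map_zero₂]; exact Submodule.zero_mem _
  | add y z _ _ h h' => rw [LinearMap.map_add₂]; exact Submodule.add_mem _ h h'
  | smul r y _ h => rw [LinearMap.map_smul₂]; exact Submodule.smul_mem _ _ h

theorem rename_surjective {S T : Type} {f : S → T} (hf : Function.Surjective f) :
    Function.Surjective (GaussOF.rename f) := by
  intro y
  induction y using TensorProduct.induction_on with
  | zero => exact ⟨0, map_zero _⟩
  | tmul r y =>
    obtain ⟨x, rfl⟩ := OF.rename_surjective hf y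
    exact ⟨r ⊗ₜ x, rfl⟩
  | add x y hx hy =>
    obtain ⟨x, rfl⟩ := hx
    obtain ⟨y, rfl⟩ := hy
    exact ⟨x + y, map_add _ _ _⟩

theorem blockMul_rename (C : Choice n) (c b a : Matching n) (X Y : GaussOF (Fin (2 * n))) :
    blockMul C c b a (GaussOF.rename (toCircle c b) X) (GaussOF.rename (toCircle b a) Y) =
      GaussOF.rename (toCircle c a) (1 ⊗ₜ (C c b a).omega c a * X * Y) := by
  induction X using TensorProduct.induction_on with
  | zero => simp
  | tmul r X =>
    induction Y using TensorProduct.induction_on with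
    | zero => simp
    | tmul s Y =>
      rw [GaussOF.rename_tmul, GaussOF.rename_tmul, blockMul_tmul,
        Algebra.TensorProduct.tmul_mul_tmul, Algebra.TensorProduct.tmul_mul_tmul, one_mul,
        GaussOF.rename_tmul]
      exact congrArg _ ((C c b a).mulMap_renameCircle c a X Y)
    | add x y hx hy => simp only [map_add, mul_add, hx, hy]
  | add x y hx hy => simp only [map_add, LinearMap.add_apply, mul_add, add_mul, hx, hy]

/-- Rescaling along the height map multiplies products by a power of the factor. -/
theorem scale_blockMul (C : Choice n) (c b a : Matching n) (μ : GaussianInt)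
    (x : GaussOF (Circle c b)) (y : GaussOF (Circle b a)) :
    scale (heightCircle c a) μ (blockMul C c b a x y) = μ ^ (C c b a).evenSplits c a •
      blockMul C c b a (scale (heightCircle c b) μ x) (scale (heightCircle b a) μ y) := by
  obtain ⟨X, rfl⟩ := rename_surjective (toCircle_surjective c b) x
  obtain ⟨Y, rfl⟩ := rename_surjective (toCircle_surjective b a) y
  have hs : ∀ (b a : Matching n) (Z : GaussOF (Fin (2 * n))),
      scale (heightCircle b a) μ (GaussOF.rename (toCircle b a) Z) =
        GaussOF.rename (toCircle b a) (scale (heightMap n) μ Z) :=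
    fun b a Z => scale_rename _ μ _ _ (heightCircle_mapDomain b a) Z
  rw [blockMul_rename, hs c b, hs b a, blockMul_rename, map_mul, map_mul, map_mul, map_mul,
    GaussOF.rename_tmul, hs c a X, hs c a Y]
  have := (C c b a).scale_omega c a μ
  rw [show OF.rename (toCircle c a) ((C c b a).omega c a) =
    renameCircle c a ((C c b a).omega c a) from rfl, this, smul_mul_assoc, smul_mul_assoc, map_mul,
    map_mul, GaussOF.rename_tmul]

end GaussOH

end OddArc

namespace OddArc

variable {n : ℕ}

open GaussOH

/-! ### Associating weights -/

/-- The weights of a twist in terms of exterior degrees. -/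
def Twist.weight (τ : Twist n) (c b a : Matching n) (p q : ℕ) : ZMod 4 :=
  τ c b a (quantumDegree c b p) (quantumDegree b a q)

/-- The products of blocks, rescaled by `i ^ w`, are associative. -/
def AssocWeights (C : Choice n) (w : Matching n → Matching n → Matching n → ℕ → ℕ → ZMod 4) :
    Prop :=
  ∀ (d c b a : Matching n) (p q r : ℕ) (x : OF (Circle d c)) (y : OF (Circle c b))
    (z : OF (Circle b a)), x ∈ ⋀[ℤ]^p (Circle d c →₀ ℤ) → y ∈ ⋀[ℤ]^q (Circle c b →₀ ℤ) →
    z ∈ ⋀[ℤ]^r (Circle b a →₀ ℤ) →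
    iPow (w d c b p q + w d b a (p + q + C.splits d c b) r) •
        (1 ⊗ₜ (C d b a).mulMap d a ((C d c b).mulMap d b x y) z : GaussOF (Circle d a)) =
      iPow (w c b a q r + w d c a p (q + r + C.splits c b a)) •
        (1 ⊗ₜ (C d c a).mulMap d a x ((C c b a).mulMap c a y z))

theorem assocWeights_of_isAssociative {C : Choice n} {τ : Twist n}
    (h : TwistedOH.IsAssociative C τ) : AssocWeights C τ.weight := by
  intro d c b a p q r x y z hx hy hz
  have h1 : GaussOH.twistedMul C τ (GaussOH.twistedMul C τ (inc d c (1 ⊗ₜ x)) (inc c b (1 ⊗ₜ y)))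
      (inc b a (1 ⊗ₜ z)) = GaussOH.twistedMul C τ (inc d c (1 ⊗ₜ x))
        (GaussOH.twistedMul C τ (inc c b (1 ⊗ₜ y)) (inc b a (1 ⊗ₜ z))) :=
    h (inc d c (1 ⊗ₜ x)) (inc c b (1 ⊗ₜ y)) (inc b a (1 ⊗ₜ z))
  have hx' := tmul_mem_gaussPower 1 hx
  have hy' := tmul_mem_gaussPower 1 hy
  have hz' := tmul_mem_gaussPower 1 hz
  rw [twistedMul_inc C τ hx' hy', twistedMul_inc C τ hy' hz', map_smul, map_smul,
    LinearMap.smul_apply, twistedMul_inc C τ (blockMul_mem C d c b hx' hy') hz',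
    twistedMul_inc C τ hx' (blockMul_mem C c b a hy' hz'), smul_smul, smul_smul, ← iPow_add,
    ← iPow_add] at h1
  simp only [blockMul_tmul, one_mul] at h1
  apply inc_injective d a
  rw [map_smul, map_smul]
  exact h1

/-- The split products of two chronologies agree up to sign, and the signs are i⁰ and i². -/
theorem exists_sign (C C' : Choice n) : ∃ e : Matching n → Matching n → Matching n → ZMod 4,
    ∀ c b a x y, (1 ⊗ₜ (C' c b a).mulMap c a x y : GaussOF (Circle c a)) =
      iPow (e c b a) • (1 ⊗ₜ (C c b a).mulMap c a x y) := by
  have h : ∀ c b a : Matching n, ∃ e : ZMod 4, ∀ x y,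
      (1 ⊗ₜ (C' c b a).mulMap c a x y : GaussOF (Circle c a)) =
        iPow e • (1 ⊗ₜ (C c b a).mulMap c a x y) := by
    intro c b a
    rcases (C' c b a).renameCircle_omega_eq_or c a (C c b a) with h | h
    · refine ⟨0, fun x y => ?_⟩
      obtain ⟨X, rfl⟩ := renameCircle_surjective c b x
      obtain ⟨Y, rfl⟩ := renameCircle_surjective b a y
      rw [(C' c b a).mulMap_renameCircle, (C c b a).mulMap_renameCircle, map_mul, map_mul, h,
        map_mul, map_mul, iPow_zero, one_smul]
    · refine ⟨2, fun x y => ?_⟩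
      obtain ⟨X, rfl⟩ := renameCircle_surjective c b x
      obtain ⟨Y, rfl⟩ := renameCircle_surjective b a y
      rw [(C' c b a).mulMap_renameCircle, (C c b a).mulMap_renameCircle, map_mul, map_mul, h,
        map_mul, map_mul, iPow_two, neg_mul, neg_mul, TensorProduct.tmul_neg, neg_one_smul]
  choose e he using h
  exact ⟨e, he⟩

theorem blockMul_eq_smul {C C' : Choice n} {c b a : Matching n} {e : ZMod 4}
    (he : ∀ x y, (1 ⊗ₜ (C' c b a).mulMap c a x y : GaussOF (Circle c a)) =
      iPow e • (1 ⊗ₜ (C c b a).mulMap c a x y)) (x : GaussOF (Circle c b))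
    (y : GaussOF (Circle b a)) : blockMul C' c b a x y = iPow e • blockMul C c b a x y := by
  induction x using TensorProduct.induction_on with
  | zero => simp
  | tmul r x =>
    induction y using TensorProduct.induction_on with
    | zero => simp
    | tmul s y =>
      rw [blockMul_tmul, blockMul_tmul, smul_one_tmul, he, smul_comm, ← smul_one_tmul]
    | add x y hx hy => simp only [map_add, smul_add, hx, hy]
  | add x y hx hy => simp only [map_add, LinearMap.add_apply, smul_add, hx, hy]

/-- The signs between two choices are absorbed into the weights, so that only one choice has to be
considered afterwards. -/
theorem AssocWeights.change {C C' : Choice n}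
    {w : Matching n → Matching n → Matching n → ℕ → ℕ → ZMod 4} (h : AssocWeights C' w)
    {e : Matching n → Matching n → Matching n → ZMod 4}
    (he : ∀ c b a x y, (1 ⊗ₜ (C' c b a).mulMap c a x y : GaussOF (Circle c a)) =
      iPow (e c b a) • (1 ⊗ₜ (C c b a).mulMap c a x y)) :
    AssocWeights C fun c b a p q => w c b a p q + e c b a := by
  intro d c b a p q r x y z hx hy hz
  have h1 := h d c b a p q r x y z hx hy hz
  have hs : C'.splits = C.splits := by
    funext c b a
    have := C.splits_spec c b a
    have := C'.splits_spec c b a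
    omega
  have e1 : (1 ⊗ₜ (C' d b a).mulMap d a ((C' d c b).mulMap d b x y) z : GaussOF (Circle d a)) =
      (iPow (e d c b + e d b a)) • (1 ⊗ₜ (C d b a).mulMap d a ((C d c b).mulMap d b x y) z) := by
    have g : ∀ C : Choice n, blockMul C d b a (blockMul C d c b (1 ⊗ₜ x) (1 ⊗ₜ y)) (1 ⊗ₜ z) =
        1 ⊗ₜ (C d b a).mulMap d a ((C d c b).mulMap d b x y) z := fun C => by
      rw [blockMul_tmul, blockMul_tmul]; simp only [one_mul]
    rw [← g C, ← g C', blockMul_eq_smul (he d b a), blockMul_eq_smul (he d c b), LinearMap.map_smul₂, smul_smul, ← iPow_add, add_comm (e d b a)]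
  have e2 : (1 ⊗ₜ (C' d c a).mulMap d a x ((C' c b a).mulMap c a y z) : GaussOF (Circle d a)) =
      (iPow (e c b a + e d c a)) • (1 ⊗ₜ (C d c a).mulMap d a x ((C c b a).mulMap c a y z)) := by
    have g : ∀ C : Choice n, blockMul C d c a (1 ⊗ₜ x) (blockMul C c b a (1 ⊗ₜ y) (1 ⊗ₜ z)) =
        1 ⊗ₜ (C d c a).mulMap d a x ((C c b a).mulMap c a y z) := fun C => by
      rw [blockMul_tmul, blockMul_tmul]; simp only [one_mul]
    rw [← g C, ← g C', blockMul_eq_smul (he d c a), blockMul_eq_smul (he c b a), map_smul, smul_smul, ← iPow_add, add_comm (e d c a)]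
  rw [e1, e2, smul_smul, smul_smul, ← iPow_add, ← iPow_add, hs] at h1
  convert h1 using 3 <;> ring

/-! ### Nonvanishing of products -/

/-- Products of two elements of total exterior degree `t` do not all vanish. -/
def Choice.NonzeroTwo (C : Choice n) (c b a : Matching n) (t : ℕ) : Prop :=
  ∃ z ∈ ⋀[ℤ]^t (Fin (2 * n) →₀ ℤ), renameCircle c a ((C c b a).omega c a * z) ≠ 0

/-- Products of three elements of total exterior degree `t` do not all vanish. -/
def Choice.NonzeroThree (C : Choice n) (d c b a : Matching n) (t : ℕ) : Prop :=
  ∃ z ∈ ⋀[ℤ]^t (Fin (2 * n) →₀ ℤ),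
    renameCircle d a ((C d b a).omega d a * ((C d c b).omega d b * z)) ≠ 0

theorem exists_factors {V T : Type*} [AddCommGroup V] [AddCommGroup T]
    (f : ExteriorAlgebra ℤ V →+ T) {p q : ℕ} {z : ExteriorAlgebra ℤ V} (hz : z ∈ ⋀[ℤ]^(p + q) V)
    (h : f z ≠ 0) : ∃ x ∈ ⋀[ℤ]^p V, ∃ y ∈ ⋀[ℤ]^q V, f (x * y) ≠ 0 := by
  by_contra hno
  push Not at hno
  refine h ?_
  change z ∈ LinearMap.range (ExteriorAlgebra.ι ℤ) ^ (p + q) at hz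
  rw [pow_add] at hz
  refine Submodule.mul_induction_on hz (fun x hx y hy => hno x hx y hy) fun x y hx hy => ?_
  rw [map_add, hx, hy, add_zero]

theorem one_mem_exteriorPower {V : Type*} [AddCommGroup V] :
    (1 : ExteriorAlgebra ℤ V) ∈ ⋀[ℤ]^0 V := by
  change _ ∈ LinearMap.range (ExteriorAlgebra.ι ℤ) ^ 0
  rw [pow_zero]
  exact Submodule.one_le.1 le_rfl

theorem Choice.omega_eq_one (C : Choice n) {c b a : Matching n} (h : C.splits c b a = 0) :
    (C c b a).omega c a = 1 := by
  rw [← C.numSplits_eq] at h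
  have : (C c b a).splitTimes c a 0 n = [] := List.length_eq_zero_iff.1 h
  rw [Chronology.omega, this]
  rfl

theorem Choice.nonzeroTwo_zero (C : Choice n) {c b a : Matching n}
    (h : numCircles c b + numCircles b a + numCircles c a = n + 2 * numComps c b a) :
    C.NonzeroTwo c b a 0 :=
  ⟨1, one_mem_exteriorPower, by
    rw [mul_one]
    exact ((C c b a).renameCircle_omega_ne_zero_iff c a).2 h⟩

section Triple

variable (C : Choice n) (d c b a : Matching n) (X Y Z : OF (Fin (2 * n)))

theorem mulMap_mulMap_left : (C d b a).mulMap d a ((C d c b).mulMap d b (renameCircle d c X)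
      (renameCircle c b Y)) (renameCircle b a Z) =
    renameCircle d a ((C d b a).omega d a * ((C d c b).omega d b * (X * Y * Z))) := by
  rw [Chronology.mulMap_renameCircle, Chronology.mulMap_renameCircle]
  simp only [mul_assoc]

theorem mulMap_mulMap_right : (C d c a).mulMap d a (renameCircle d c X)
      ((C c b a).mulMap c a (renameCircle c b Y) (renameCircle b a Z)) =
    renameCircle d a ((C d c a).omega d a * X * ((C c b a).omega c a * Y * Z)) := by
  rw [Chronology.mulMap_renameCircle, Chronology.mulMap_renameCircle]

end Triple

/-! ### From associative weights to cocycles -/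

namespace AssocWeights

variable {C : Choice n} {w w' : Matching n → Matching n → Matching n → ℕ → ℕ → ZMod 4}

theorem rename (h : AssocWeights C w) (d c b a : Matching n) {p q r : ℕ}
    {X Y Z : OF (Fin (2 * n))} (hX : X ∈ ⋀[ℤ]^p (Fin (2 * n) →₀ ℤ))
    (hY : Y ∈ ⋀[ℤ]^q (Fin (2 * n) →₀ ℤ)) (hZ : Z ∈ ⋀[ℤ]^r (Fin (2 * n) →₀ ℤ)) :
    iPow (w d c b p q + w d b a (p + q + C.splits d c b) r) •
        (1 ⊗ₜ renameCircle d a ((C d b a).omega d a * ((C d c b).omega d b * (X * Y * Z))) :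
          GaussOF (Circle d a)) =
      iPow (w c b a q r + w d c a p (q + r + C.splits c b a)) •
        (1 ⊗ₜ renameCircle d a ((C d c a).omega d a * X * ((C c b a).omega c a * Y * Z))) := by
  have := h d c b a p q r _ _ _ (OF.rename_mem (toCircle d c) hX) (OF.rename_mem (toCircle c b) hY)
    (OF.rename_mem (toCircle b a) hZ)
  rwa [mulMap_mulMap_left, mulMap_mulMap_right] at this

theorem smul_eq_zero_iff {S : Type} [Finite S] {s : ZMod 4} {u : OF S} :
    iPow s • (1 ⊗ₜ u : GaussOF S) = 0 ↔ u = 0 := by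
  constructor
  · intro h
    by_contra hu
    have := congrArg (fun v => iPow (-s) • v) h
    simp only [smul_smul, smul_zero] at this
    rw [mul_comm, iPow_mul_neg, one_smul] at this
    exact one_tmul_ne_zero hu this
  · rintro rfl
    simp

/-- The two bracketings of 1, 1, z differ by powers of i, which are units. The existence of
associating weights thus gives access to the nonvanishing of the other bracketing. -/
theorem nonzeroThree_iff (h : AssocWeights C w) (d c b a : Matching n) (t : ℕ) :
    C.NonzeroThree d c b a t ↔ ∃ z ∈ ⋀[ℤ]^t (Fin (2 * n) →₀ ℤ),
      renameCircle d a ((C d c a).omega d a * ((C c b a).omega c a * z)) ≠ 0 := by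
  refine exists_congr fun z => and_congr_right fun hz => not_congr ?_
  have := h.rename d c b a one_mem_exteriorPower one_mem_exteriorPower hz
  simp only [one_mul, mul_one] at this
  rw [← smul_eq_zero_iff, this, smul_eq_zero_iff]

theorem nonvanishing (h : AssocWeights C w) : Nonvanishing C C.NonzeroTwo C.NonzeroThree where
  mono c b a s t hst := by
    rintro ⟨z, hz, hne⟩
    obtain ⟨k, rfl⟩ := Nat.exists_eq_add_of_le hst
    obtain ⟨x, hx, y, -, hxy⟩ := exists_factors
      ((renameCircle c a).toLinearMap ∘ₗ LinearMap.mulLeft ℤ ((C c b a).omega c a)).toAddMonoidHom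
      hz hne
    refine ⟨x, hx, fun h0 => hxy ?_⟩
    change renameCircle c a ((C c b a).omega c a * (x * y)) = 0
    rw [← mul_assoc, map_mul, h0, zero_mul]
  std c b := C.nonzeroTwo_zero (C.numCircles_std c b)
  std_one c b hn := by
    have h0 := ((C c b (Matching.std n)).renameCircle_omega_ne_zero_iff c (Matching.std n)).2
      (C.numCircles_std c b)
    refine ⟨ExteriorAlgebra.ι ℤ (Finsupp.single ⟨0, by omega⟩ 1), ι_mem_exteriorPower _, ?_⟩
    rw [map_mul, OF.rename_ι, Finsupp.mapDomain_single]
    exact (C c b (Matching.std n)).renameCircle_omega_mul_gen_ne_zero c _ h0 _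
  pos c b a := by
    rintro ⟨z, hz, hne⟩
    by_contra hn
    have hz0 : z = 0 := exteriorPower_eq_zero (by rw [Nat.card_fin]; omega) hz
    rw [hz0, mul_zero, map_zero] at hne
    exact hne rfl
  rotate c b a hs := by
    refine C.nonzeroTwo_zero ?_
    have h1 : renameCircle c a ((C c b a).omega c a) ≠ 0 := by
      rw [C.omega_eq_one hs, map_one]
      exact one_ne_zero
    have h2 := ((C c b a).renameCircle_omega_ne_zero_iff c a).1 h1
    have h3 : numComps c a b = numComps c b a := by
      rw [numComps_comm c a b, numComps_rotate a c b, numComps_comm c b a, numComps_rotate b c a,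
        numComps_comm c a b, numComps_rotate a c b]
    rw [h3, numCircles_comm a b]
    omega
  left d c b a t hs := by
    rintro ⟨z, hz, hne⟩
    exact ⟨z, hz, by rwa [C.omega_eq_one hs, one_mul]⟩
  right d c b a t hs := by
    rintro ⟨z, hz, hne⟩
    rw [h.nonzeroThree_iff]
    exact ⟨z, hz, by rwa [C.omega_eq_one hs, one_mul]⟩
  left_factor d c b a t := by
    rintro ⟨z, hz, hne⟩
    refine ⟨z, hz, fun h0 => hne ?_⟩
    have := (C d b a).mulMap_renameCircle d a ((C d c b).omega d b * z) 1
    rw [h0, LinearMap.map_zero₂, mul_one] at this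
    exact this.symm
  left_product d c b a t := by
    rintro ⟨z, hz, hne⟩
    refine ⟨_, ?_, hne⟩
    rw [add_comm]
    exact mul_mem_exteriorPower (C.omega_mem d c b) hz
  right_factor d c b a t hQ := by
    obtain ⟨z, hz, hne⟩ := (h.nonzeroThree_iff d c b a t).1 hQ
    refine ⟨z, hz, fun h0 => hne ?_⟩
    have := (C d c a).mulMap_renameCircle d a 1 ((C c b a).omega c a * z)
    rw [h0, map_zero, mul_one] at this
    exact this.symm
  right_product d c b a t hQ := by
    obtain ⟨z, hz, hne⟩ := (h.nonzeroThree_iff d c b a t).1 hQ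
    refine ⟨_, ?_, hne⟩
    rw [add_comm]
    exact mul_mem_exteriorPower (C.omega_mem c b a) hz

theorem isAssocCocycle_sub (h : AssocWeights C w) (h' : AssocWeights C w') :
    IsAssocCocycle C C.NonzeroThree (w - w') := by
  rintro d c b a p q r ⟨z, hz, hne⟩
  -- Exterior powers are spanned by products, so the nonvanishing in total degree `p + q + r` is
  -- witnessed by some `X * Y * Z`. On it both weights express the same pair of bracketings, and
  -- their quotient can be compared.
  obtain ⟨x, hx, Z, hZ, hxZ⟩ := exists_factors ((renameCircle d a).toLinearMap ∘ₗ
    LinearMap.mulLeft ℤ ((C d b a).omega d a) ∘ₗ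
      LinearMap.mulLeft ℤ ((C d c b).omega d b)).toAddMonoidHom hz hne
  obtain ⟨X, hX, Y, hY, hXY⟩ := exists_factors ((renameCircle d a).toLinearMap ∘ₗ
    LinearMap.mulLeft ℤ ((C d b a).omega d a) ∘ₗ LinearMap.mulLeft ℤ ((C d c b).omega d b) ∘ₗ
      LinearMap.mulRight ℤ Z).toAddMonoidHom hx hxZ
  have hu : (1 ⊗ₜ renameCircle d a ((C d b a).omega d a * ((C d c b).omega d b * (X * Y * Z))) :
    GaussOF (Circle d a)) ≠ 0 := one_tmul_ne_zero hXY
  have e1 := h.rename d c b a hX hY hZ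
  have e2 := h'.rename d c b a hX hY hZ
  unfold AssocRel
  simp only [Pi.sub_apply]
  generalize w d c b p q = s1 at *
  generalize w d b a (p + q + C.splits d c b) r = s2 at *
  generalize w c b a q r = s3 at *
  generalize w d c a p (q + r + C.splits c b a) = s4 at *
  generalize w' d c b p q = s1' at *
  generalize w' d b a (p + q + C.splits d c b) r = s2' at *
  generalize w' c b a q r = s3' at *
  generalize w' d c a p (q + r + C.splits c b a) = s4' at *
  have e3 := congrArg (fun v => iPow (s3' + s4') • v) e1
  have e4 := congrArg (fun v => iPow (s3 + s4) • v) e2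
  simp only [smul_smul, ← iPow_add] at e3 e4
  rw [add_comm (s3 + s4) (s3' + s4'), ← e3] at e4
  have := iPow_smul_injective hu e4
  have h0 : s1 - s1' + (s2 - s2') - (s3 - s3' + (s4 - s4')) =
    (s3' + s4' + (s1 + s2)) - (s3 + s4 + (s1' + s2')) := by ring
  rw [← sub_eq_zero, h0, ← this, sub_self]

end AssocWeights

end OddArc

namespace OddArc

variable {n : ℕ}

open GaussOH

/-! ### The cocycle of splits at even arcs -/

/-- The number of splits along arcs that start at even points, as a cochain. -/
def Choice.evenCochain (C : Choice n) (c b a : Matching n) (_ _ : ℕ) : ZMod 4 :=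
  (C c b a).evenSplits c a

theorem scale_blockMul_one (C : Choice n) (c b a : Matching n) :
    scale (heightCircle c a) (iPow 1) (blockMul C c b a 1 1) =
      iPow (C.evenCochain c b a 0 0) • blockMul C c b a 1 1 := by
  rw [scale_blockMul, map_one (scale _ _), map_one (scale _ _), Choice.evenCochain, ← one_mul ((_ : ℕ) : ZMod 4), iPow_mul]

/-- The rescaling multiplies each bracketing of 1, 1, 1 by the power of i found on the corresponding
side of the cocycle relation. The bracketings are nonzero and proportional by a unit, so the
eigenvalues agree. -/
theorem AssocWeights.isAssocCocycle_evenCochain {C : Choice n}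
    {w : Matching n → Matching n → Matching n → ℕ → ℕ → ZMod 4} (h : AssocWeights C w) :
    IsAssocCocycle C C.NonzeroThree C.evenCochain := by
  rintro d c b a p q r ⟨z, -, hz⟩
  have hu : blockMul C d b a (blockMul C d c b 1 1) 1 ≠ 0 := by
    simp only [Algebra.TensorProduct.one_def, blockMul_tmul]
    rw [one_mul, one_mul]
    refine one_tmul_ne_zero fun h0 => hz ?_
    have h1 := mulMap_mulMap_left C d c b a 1 1 1
    simp only [map_one (renameCircle _ _), mul_one] at h1
    rw [← mul_assoc, map_mul, ← h1, h0, zero_mul]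
  have hw : iPow (w d c b 0 0 + w d b a (0 + 0 + C.splits d c b) 0) •
      blockMul C d b a (blockMul C d c b 1 1) 1 =
      iPow (w c b a 0 0 + w d c a 0 (0 + 0 + C.splits c b a)) •
        blockMul C d c a 1 (blockMul C c b a 1 1) := by
    have := h d c b a 0 0 0 1 1 1 one_mem_exteriorPower one_mem_exteriorPower one_mem_exteriorPower
    simp only [Algebra.TensorProduct.one_def, blockMul_tmul]
    simpa only [one_mul] using this
  have h1 : scale (heightCircle d a) (iPow 1) (blockMul C d b a (blockMul C d c b 1 1) 1) =
      iPow (C.evenCochain d c b 0 0 + C.evenCochain d b a 0 0) •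
        blockMul C d b a (blockMul C d c b 1 1) 1 := by
    rw [scale_blockMul, scale_blockMul_one, map_one (scale _ _), LinearMap.map_smul₂, smul_smul, ← iPow_mul,
      one_mul, ← iPow_add, add_comm]
    rfl
  have h2 : scale (heightCircle d a) (iPow 1) (blockMul C d c a 1 (blockMul C c b a 1 1)) =
      iPow (C.evenCochain c b a 0 0 + C.evenCochain d c a 0 0) •
        blockMul C d c a 1 (blockMul C c b a 1 1) := by
    rw [scale_blockMul, scale_blockMul_one, map_one (scale _ _), map_smul, smul_smul, ← iPow_mul,
      one_mul, ← iPow_add, add_comm]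
    rfl
  have h3 := congrArg (scale (heightCircle d a) (iPow 1)) hw
  rw [map_smul, map_smul, h1, h2, smul_comm, smul_comm _ (iPow (_ + C.evenCochain d c a 0 0)),
    ← hw, smul_smul, smul_smul, ← iPow_add, ← iPow_add] at h3
  exact add_right_cancel (iPow_smul_injective hu h3)

theorem isEven_std (γ : Chronology (Matching.std n)) (u : Fin n) : γ.isEven u = true := by
  rw [Chronology.isEven, decide_eq_true_eq]
  by_contra h
  have h1 := Matching.std_odd (i := (γ.order u).left) (by omega)
  have h2 : (γ.order u).left < (Matching.std n).partner (γ.order u).left := (γ.order u).2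
  rw [Fin.lt_def] at h2
  omega

theorem evenSplits_le (C : Choice n) (c b a : Matching n) :
    (C c b a).evenSplits c a ≤ C.splits c b a := by
  rw [← C.numSplits_eq]
  exact List.countP_le_length

/-- All standard arcs start at even points, so the one split on the round trip from `D` counts. On
the round trip from the standard matching the height map is zero, so a nonzero product has
eigenvalue 1 and the even splits vanish modulo 4. The other two products have no splits. -/
theorem atomInvariant_evenCochain (C : Choice n) {D : Matching n}
    (hD : numCircles (Matching.std n) D + 1 = n) : atomInvariant C.evenCochain D = 1 := by
  have h0 : ∀ c b a, C.splits c b a = 0 → ∀ p q, C.evenCochain c b a p q = 0 := by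
    intro c b a h p q
    have := evenSplits_le C c b a
    rw [Choice.evenCochain, Nat.le_zero.1 (this.trans h.le), Nat.cast_zero]
  have h1 : C.evenCochain D (Matching.std n) D 0 0 = 1 := by
    have : (C D (Matching.std n) D).evenSplits D D = C.splits D (Matching.std n) D := by
      rw [← C.numSplits_eq]
      exact List.countP_eq_length.2 fun u _ => isEven_std _ u
    rw [Choice.evenCochain, this, C.splits_of_neighbour (by rw [numCircles_comm]; exact hD),
      Nat.cast_one]
  have h2 : C.evenCochain (Matching.std n) D (Matching.std n) 0 0 = 0 := by
    have h3 := scale_blockMul_one C (Matching.std n) D (Matching.std n)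
    have h4 : heightCircle (Matching.std n) (Matching.std n) = 0 :=
      LinearMap.ext fun v => heightCircle_std _ v
    rw [h4, scale_zero, AlgHom.id_apply] at h3
    have hu : blockMul C (Matching.std n) D (Matching.std n) 1 1 ≠ 0 := by
      simp only [Algebra.TensorProduct.one_def, blockMul_tmul]
      rw [one_mul]
      refine one_tmul_ne_zero ?_
      have := (C (Matching.std n) D (Matching.std n)).mulMap_renameCircle (Matching.std n)
        (Matching.std n) 1 1
      rw [map_one (renameCircle _ _), map_one (renameCircle _ _), mul_one, mul_one] at this
      rw [this]
      exact ((C _ D _).renameCircle_omega_ne_zero_iff _ _).2 (C.numCircles_std _ _)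
    refine (iPow_smul_injective hu ?_).symm
    rw [iPow_zero, one_smul]
    exact h3
  rw [atomInvariant, h1, h2, h0 D D _ (C.splits_self_left _ _),
    h0 D _ _ (C.splits_self_right _ _)]
  decide

theorem IsAssocCocycle.add_mul {C : Choice n}
    {Q : Matching n → Matching n → Matching n → Matching n → ℕ → Prop}
    {σ ρ : Matching n → Matching n → Matching n → ℕ → ℕ → ZMod 4} (hσ : IsAssocCocycle C Q σ)
    (hρ : IsAssocCocycle C Q ρ) (κ : ZMod 4) :
    IsAssocCocycle C Q fun c b a p q => σ c b a p q + κ * ρ c b a p q := by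
  intro d c b a p q r h
  have h1 := hσ d c b a p q r h
  have h2 := hρ d c b a p q r h
  unfold AssocRel at *
  linear_combination h1 + κ * h2

/-- Two associative weights differ by a rescaling of the homogeneous components and a multiple of
the number of splits at even arcs, where products do not vanish. -/
theorem AssocWeights.exists_rescaling {C : Choice n}
    {w w' : Matching n → Matching n → Matching n → ℕ → ℕ → ZMod 4} (h : AssocWeights C w)
    (h' : AssocWeights C w') : ∃ (κ : ZMod 4) (θ : Matching n → Matching n → ℕ → ZMod 4),
      ∀ c b a p q, C.NonzeroTwo c b a (p + q) →
        w c b a p q + θ c a (p + q + C.splits c b a) + κ * C.evenCochain c b a p q =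
          θ c b p + θ b a q + w' c b a p q := by
  have key : ∃ κ : ZMod 4, ∀ hn : 2 ≤ n, ∃ D₀, Cover (Matching.std n) D₀ ∧
      (D₀.partner ⟨0, by omega⟩ : ℕ) = 3 ∧
      atomInvariant (fun c b a p q => (w - w') c b a p q + κ * C.evenCochain c b a p q) D₀ = 0 := by
    by_cases hn : 2 ≤ n
    · obtain ⟨D, hD, h3⟩ := C.exists_cover_std hn
      -- The invariant of `evenCochain` is 1, so this multiple cancels the invariant of the
      -- difference. For `n < 2` the condition is void.
      refine ⟨-atomInvariant (w - w') D, fun _ => ⟨D, hD, h3, ?_⟩⟩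
      have h1 := atomInvariant_evenCochain C hD.1
      generalize hκ : atomInvariant (w - w') D = κ
      unfold atomInvariant at *
      linear_combination hκ - κ * h1
    · exact ⟨0, fun h => absurd h hn⟩
  obtain ⟨κ, hκ⟩ := key
  obtain ⟨θ, hθ⟩ := ((h.isAssocCocycle_sub h').add_mul
    h.isAssocCocycle_evenCochain κ).exists_eq_coboundary h.nonvanishing hκ
  refine ⟨κ, θ, fun c b a p q hv => ?_⟩
  have := hθ c b a p q hv
  simp only [Pi.sub_apply, coboundary] at this
  linear_combination this

end OddArc

namespace OddArc

variable {n : ℕ}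

open GaussOH

/-! ### Rescaling isomorphisms -/

/-- The map that multiplies the elements of degree `p` by `i ^ θ p`. -/
def degreeScale (S : Type) (θ : ℕ → ZMod 4) : GaussOF S →ₗ[GaussianInt] GaussOF S :=
  ∑ p ∈ Finset.range (Nat.card S + 1), iPow (θ p) • degreeProj S p

theorem degreeScale_of_mem {S : Type} [Finite S] (θ : ℕ → ZMod 4) {p : ℕ} {x : GaussOF S}
    (hx : x ∈ gaussPower S p) : degreeScale S θ x = iPow (θ p) • x := by
  by_cases hp : Nat.card S < p
  · rw [eq_zero_of_mem_gaussPower hp hx, map_zero, smul_zero]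
  rw [degreeScale, LinearMap.sum_apply, Finset.sum_eq_single p]
  · rw [LinearMap.smul_apply, degreeProj_of_mem hx, if_pos rfl]
  · intro q _ h
    rw [LinearMap.smul_apply, degreeProj_of_mem hx, if_neg h, smul_zero]
  · intro h
    exact absurd (Finset.mem_range.2 (by omega)) h

theorem degreeScale_neg {S : Type} [Finite S] (θ : ℕ → ZMod 4) (x : GaussOF S) :
    degreeScale S (-θ) (degreeScale S θ x) = x := by
  conv_lhs => rw [← sum_degreeProj x]
  conv_rhs => rw [← sum_degreeProj x]
  simp only [map_sum]
  refine Finset.sum_congr rfl fun p _ => ?_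
  rw [degreeScale_of_mem θ (degreeProj_mem S p x), map_smul,
    degreeScale_of_mem (-θ) (degreeProj_mem S p x), smul_smul, Pi.neg_apply, iPow_mul_neg, one_smul]

theorem degreeScale_bijective {S : Type} [Finite S] (θ : ℕ → ZMod 4) :
    Function.Bijective (degreeScale S θ) := by
  refine Function.bijective_iff_has_inverse.2 ⟨degreeScale S (-θ), degreeScale_neg θ, fun x => ?_⟩
  have := degreeScale_neg (-θ) x
  rwa [neg_neg] at this

/-- The rescaling of a block. -/
def blockScale (κ : ZMod 4) (θ : Matching n → Matching n → ℕ → ZMod 4) (b a : Matching n) :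
    GaussOF (Circle b a) →ₗ[GaussianInt] GaussOF (Circle b a) :=
  (scale (heightCircle b a) (iPow κ)).toLinearMap ∘ₗ degreeScale _ (θ b a)

variable (κ : ZMod 4) (θ : Matching n → Matching n → ℕ → ZMod 4)

theorem blockScale_of_mem {b a : Matching n} {p : ℕ} {x : GaussOF (Circle b a)}
    (hx : x ∈ gaussPower _ p) :
    blockScale κ θ b a x = iPow (θ b a p) • scale (heightCircle b a) (iPow κ) x := by
  rw [blockScale, LinearMap.comp_apply, degreeScale_of_mem _ hx, map_smul]
  rfl

theorem blockScale_mem {b a : Matching n} {p : ℕ} {x : GaussOF (Circle b a)}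
    (hx : x ∈ gaussPower _ p) : blockScale κ θ b a x ∈ gaussPower _ p := by
  rw [blockScale_of_mem κ θ hx]
  exact Submodule.smul_mem _ _ (scale_mem_gaussPower _ _ hx)

theorem blockScale_bijective (b a : Matching n) : Function.Bijective (blockScale κ θ b a) :=
  (scale_bijective _ _ (LinearMap.ext (heightCircle_heightCircle b a)) _ (iPow_mul_neg κ)).comp
    (degreeScale_bijective _)

/-- The linear map with given blocks on the diagonal. -/
def diagonal (f : (b a : Matching n) → GaussOF (Circle b a) →ₗ[GaussianInt] GaussOF (Circle b a)) :
    GaussOH n →ₗ[GaussianInt] GaussOH n :=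
  ∑ b, ∑ a, inc b a ∘ₗ f b a ∘ₗ pr b a

theorem diagonal_inc
    (f : (b a : Matching n) → GaussOF (Circle b a) →ₗ[GaussianInt] GaussOF (Circle b a))
    (b a : Matching n) (x : GaussOF (Circle b a)) :
    diagonal f (inc b a x) = inc b a (f b a x) := by
  simp only [diagonal, LinearMap.sum_apply, LinearMap.comp_apply]
  rw [Finset.sum_eq_single b, Finset.sum_eq_single a, pr_inc]
  · intro a' _ h
    rw [pr_inc_of_ne (Or.inr h), map_zero, map_zero]
  · simp
  · intro b' _ h
    refine Finset.sum_eq_zero fun a' _ => ?_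
    rw [pr_inc_of_ne (Or.inl h), map_zero, map_zero]
  · simp

theorem diagonal_bijective
    (f : (b a : Matching n) → GaussOF (Circle b a) →ₗ[GaussianInt] GaussOF (Circle b a))
    (hf : ∀ b a, Function.Bijective (f b a)) : Function.Bijective (diagonal f) := by
  let g (b a : Matching n) : GaussOF (Circle b a) →ₗ[GaussianInt] GaussOF (Circle b a) :=
    (LinearEquiv.ofBijective (f b a) (hf b a)).symm.toLinearMap
  have hgf : diagonal g ∘ₗ diagonal f = LinearMap.id := ext_inc fun b a x => by
    rw [LinearMap.comp_apply, diagonal_inc, diagonal_inc, LinearMap.id_apply]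
    exact congrArg _ ((LinearEquiv.ofBijective (f b a) (hf b a)).symm_apply_apply x)
  have hfg : diagonal f ∘ₗ diagonal g = LinearMap.id := ext_inc fun b a x => by
    rw [LinearMap.comp_apply, diagonal_inc, diagonal_inc, LinearMap.id_apply]
    exact congrArg _ ((LinearEquiv.ofBijective (f b a) (hf b a)).apply_symm_apply x)
  exact Function.bijective_iff_has_inverse.2
    ⟨diagonal g, LinearMap.congr_fun hgf, LinearMap.congr_fun hfg⟩

theorem blockMul_eq_zero (C : Choice n) {c b a : Matching n} {p q : ℕ}
    (h : ¬C.NonzeroTwo c b a (p + q)) {x : GaussOF (Circle c b)} {y : GaussOF (Circle b a)}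
    (hx : x ∈ gaussPower _ p) (hy : y ∈ gaussPower _ q) : blockMul C c b a x y = 0 := by
  induction hx using Submodule.span_induction with
  | mem x hx =>
    obtain ⟨x, hx, rfl⟩ := hx
    obtain ⟨X, hX, rfl⟩ := OF.exists_rename (toCircle_surjective c b) hx
    induction hy using Submodule.span_induction with
    | mem y hy =>
      obtain ⟨y, hy, rfl⟩ := hy
      obtain ⟨Y, hY, rfl⟩ := OF.exists_rename (toCircle_surjective b a) hy
      have h0 : (C c b a).mulMap c a (OF.rename (toCircle c b) X) (OF.rename (toCircle b a) Y) =
          0 := by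
        refine ((C c b a).mulMap_renameCircle c a X Y).trans ?_
        by_contra hne
        exact h ⟨X * Y, mul_mem_exteriorPower hX hY, by rwa [← mul_assoc]⟩
      rw [blockMul_tmul, h0, TensorProduct.tmul_zero]
    | zero => rw [map_zero]
    | add y z _ _ h h' => rw [map_add, h, h', add_zero]
    | smul r y _ h => rw [map_smul, h, smul_zero]
  | zero => rw [LinearMap.map_zero₂]
  | add y z _ _ h h' => rw [LinearMap.map_add₂, h, h', add_zero]
  | smul r y _ h => rw [LinearMap.map_smul₂, h, smul_zero]

variable {κ θ}

theorem diagonal_twistedMul_inc {C C' : Choice n} {τ τ' : Twist n}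
    {e : Matching n → Matching n → Matching n → ZMod 4}
    (he : ∀ c b a x y, (1 ⊗ₜ (C' c b a).mulMap c a x y : GaussOF (Circle c a)) =
      iPow (e c b a) • (1 ⊗ₜ (C c b a).mulMap c a x y))
    (hθ : ∀ c b a p q, C.NonzeroTwo c b a (p + q) →
      τ.weight c b a p q + θ c a (p + q + C.splits c b a) + κ * C.evenCochain c b a p q =
        θ c b p + θ b a q + (τ'.weight c b a p q + e c b a))
    {c b a : Matching n} {p q : ℕ} {x : GaussOF (Circle c b)} {y : GaussOF (Circle b a)}
    (hx : x ∈ gaussPower _ p) (hy : y ∈ gaussPower _ q) :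
    diagonal (blockScale κ θ) (twistedMul C τ (inc c b x) (inc b a y)) =
      twistedMul C' τ' (inc c b (blockScale κ θ c b x)) (inc b a (blockScale κ θ b a y)) := by
  rw [twistedMul_inc C τ hx hy, map_smul, diagonal_inc,
    twistedMul_inc C' τ' (blockScale_mem κ θ hx) (blockScale_mem κ θ hy),
    blockScale_of_mem κ θ (blockMul_mem C c b a hx hy), scale_blockMul,
    blockScale_of_mem κ θ hx, blockScale_of_mem κ θ hy, LinearMap.map_smul₂,
    map_smul (blockMul C' c b a _), blockMul_eq_smul (he c b a)]
  -- Where products of this total degree vanish the weights are irrelevant, which is why the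
  -- identity for `θ` is needed only on the support.
  by_cases h : C.NonzeroTwo c b a (p + q)
  · have := hθ c b a p q h
    simp only [map_smul, smul_smul, ← iPow_add, ← iPow_mul]
    congr 2
    unfold Choice.evenCochain Twist.weight at this
    linear_combination this
  · rw [blockMul_eq_zero C h (scale_mem_gaussPower _ _ hx) (scale_mem_gaussPower _ _ hy)]
    simp only [map_zero, smul_zero]

theorem diagonal_twistedMul {C C' : Choice n} {τ τ' : Twist n}
    {e : Matching n → Matching n → Matching n → ZMod 4}
    (he : ∀ c b a x y, (1 ⊗ₜ (C' c b a).mulMap c a x y : GaussOF (Circle c a)) =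
      iPow (e c b a) • (1 ⊗ₜ (C c b a).mulMap c a x y))
    (hθ : ∀ c b a p q, C.NonzeroTwo c b a (p + q) →
      τ.weight c b a p q + θ c a (p + q + C.splits c b a) + κ * C.evenCochain c b a p q =
        θ c b p + θ b a q + (τ'.weight c b a p q + e c b a)) (x y : GaussOH n) :
    diagonal (blockScale κ θ) (twistedMul C τ x y) =
      twistedMul C' τ' (diagonal (blockScale κ θ) x) (diagonal (blockScale κ θ) y) := by
  have key : (twistedMul C τ).compr₂ (diagonal (blockScale κ θ)) =
      (twistedMul C' τ').compl₁₂ (diagonal (blockScale κ θ)) (diagonal (blockScale κ θ)) := by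
    refine ext_inc fun d c x => ext_inc fun b a y => ?_
    rw [LinearMap.compr₂_apply, LinearMap.compl₁₂_apply, diagonal_inc, diagonal_inc]
    by_cases hcb : c = b
    · subst hcb
      rw [← sum_degreeProj x, ← sum_degreeProj y]
      simp only [map_sum, LinearMap.sum_apply]
      exact Finset.sum_congr rfl fun p _ => Finset.sum_congr rfl fun q _ =>
        diagonal_twistedMul_inc he hθ (degreeProj_mem _ _ _) (degreeProj_mem _ _ _)
    · rw [twistedMul_inc_of_ne C τ hcb, twistedMul_inc_of_ne C' τ' hcb, map_zero]
  exact LinearMap.congr_fun₂ key x y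

/-- The rescaling is not a scalar on a component, but it is an exterior power of a linear map in
each block and so preserves both degrees. -/
theorem diagonal_mem_homogeneous (C C' : Choice n) (τ τ' : Twist n) {b a : Matching n} {k : ℤ}
    {x : GaussOH n} (hx : x ∈ TwistedOH.homogeneous C τ b a k) :
    diagonal (blockScale κ θ) x ∈ TwistedOH.homogeneous C' τ' b a k := by
  have hc (p : ℕ) (y : GaussOH n) : GaussOH.component b a p (diagonal (blockScale κ θ)
      (GaussOH.component b a p y)) = diagonal (blockScale κ θ) (GaussOH.component b a p y) := by
    rw [component_eq b a p y, diagonal_inc, component_eq, pr_inc,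
      degreeProj_of_mem (blockScale_mem κ θ (degreeProj_mem _ _ _)), if_pos rfl]
  have h : TwistedOH.homogeneous C τ b a k ≤
      (TwistedOH.homogeneous C' τ' b a k).comap (diagonal (blockScale κ θ)) := by
    refine iSup_le fun p => ?_
    rintro _ ⟨y, rfl⟩
    exact Submodule.mem_iSup_of_mem p ⟨_, hc p y⟩
  exact h hx

end OddArc

end

theorem mainTheorem5 (n : ℕ) (C C' : OddArc.Choice n) (τ τ' : OddArc.Twist n)
    (hτ : OddArc.TwistedOH.IsAssociative C τ) (hτ' : OddArc.TwistedOH.IsAssociative C' τ') :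
    ∃ φ : OddArc.TwistedOH C τ →ₙₐ[GaussianInt] OddArc.TwistedOH C' τ',
      Function.Bijective φ ∧
      ∀ (b a : OddArc.Matching n) (k : ℤ), ∀ x ∈ OddArc.TwistedOH.homogeneous C τ b a k,
        φ x ∈ OddArc.TwistedOH.homogeneous C' τ' b a k := by
  obtain ⟨e, he⟩ := OddArc.exists_sign C C'
  -- Both twists are turned into weights for the choice `C`; the second one picks up the signs `e`.
  obtain ⟨κ, θ, hθ⟩ := (OddArc.assocWeights_of_isAssociative hτ).exists_rescaling
    ((OddArc.assocWeights_of_isAssociative hτ').change he)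
  refine ⟨{ OddArc.diagonal (OddArc.blockScale κ θ) with
    map_zero' := map_zero (OddArc.diagonal (OddArc.blockScale κ θ))
    map_mul' := OddArc.diagonal_twistedMul he hθ }, ?_, fun b a k x hx => ?_⟩
  · exact OddArc.diagonal_bijective _ (OddArc.blockScale_bijective κ θ)
  · exact OddArc.diagonal_mem_homogeneous C C' τ τ' hx
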